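/- **Setting.** Fix $J_0\in\mathbb N\cup\{0\}$ and a wavelet basis $\{\psi_{lk}\}$ of $L^2([0,1])$, $l\ge J_0-1$, with $2^{J_0}$ scaling functions at level $l=J_0-1$ and $2^l$ wavelets $\psi_{lk}$, $0\le k<2^l$, at each level $l\ge J_0$. That is, $\{\psi_{lk}\}$ is an orthonormal basis, $\int_0^1\psi_{lk}=0$ for $l\ge J_0$, and for every $m\in\mathbb N$ there is $C_m$ with $|\psi_{lk}(x)|\le C_m2^{l/2}(1+2^l d(x,k2^{-l}))^{-m}$ for all $l,k$ and $x\in[0,1]$, where $d$ is the distance on the circle $\mathbb R/\mathbb Z$. (Haar bases, periodised and boundary corrected wavelet bases are of this kind.) Let $w=(w_l)_{l\ge J_0-1}$, $w_l\ge1$, be increasing and admissible, i.e. $w_l/\sqrt l\uparrow\infty$, with $\sum_l w_l2^{-l/2}<\infty$. Let $\mathcal M_0(w)$ be the Banach space of sequences $x=(x_{lk})$ with $\max_k|x_{lk}|/w_l\to0$ as $l\to\infty$, normed by $\|x\|=\sup_l\max_k|x_{lk}|/w_l$, and regard $f\in L^2$ as the element $(\langle f,\psi_{lk}\rangle)$ of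 it. Let $\beta$ be the bounded-Lipschitz metric between laws on $\mathcal M_0(w)$. Let $f_0$ be the true parameter, and consider either of two models for data $X$ with law $P^n_f$, $f\in L^2([0,1])$: * *White noise model*: $X=\mathbb X^{(n)}=f+\mathbb W/\sqrt n$ in $\mathcal M_0(w)$, where $\mathbb W=(g_{lk})$ with $g_{lk}$ i.i.d. $N(0,1)$; here $f_0\in L^2$, and $\mathcal N$ denotes the law of $\mathbb W$ in $\mathcal M_0(w)$. * *Sampling model*: $X=(X_1,\dots,X_n)$ i.i.d. with density $f$ on $[0,1]$; here $f_0$ is a bounded density, and $\mathcal N$ denotes the law in $\mathcal M_0(w)$ of the $P_0$-white bridge, the centred Gaussian process $(\mathbb G_{P_0}(\psi_{lk}))$ with covariance $E\,\mathbb G_{P_0}(g)\mathbb G_{P_0}(h)=\int(g-P_0g)(h-P_0h)\,dP_0$, $dP_0=f_0\,dx$. Let $\Pi=\Pi_n$ be a prior (possibly depending on $n$) on $L^2([0,1])$, in the sampling model concentrated on probability densities, and $\Pi(\cdot\mid X)$ its posterior. Let the centring $T_n=T_n(X)$ be of one of these kinds: 1. in the white noise model, $T_n=\mathbb X^{(n)}$;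 2. in the sampling model, $T_n=P_n(j_n)=\sum_{l\le j_n,k}\bigl(\frac1n\sum_{i=1}^n\psi_{lk}(X_i)\bigr)\psi_{lk}$, where for some $\gamma\ge0$ the density $f_0$ is continuous with $\sup_{l,k}2^{l(\gamma+1/2)}|\langle f_0,\psi_{lk}\rangle|<\infty$, and $j_n\ge J_0-1$ satisfies $\sqrt n\,2^{-j_n(\gamma+1/2)}w_{j_n}^{-1}\to0$ and $2^{j_n}j_n/n=O(1)$; 3. in either model, $T_n$ is a (measurable) estimator with values in $L^2([0,1])$ that is efficient in $\mathcal M_0(w)$: under $P^n_{f_0}$, $\sqrt n(T_n-f_0)\to^d\mathcal N$ in $\mathcal M_0(w)$. Put $F(t)=\int_0^tf$, $F_0(t)=\int_0^tf_0$, and $\mathbb T_n(t)=\int_0^tT_n(x)\,dx$ if $T_n\in L^2$, respectively $\mathbb T_n(t)=\sum_{l,k}\mathbb X^{(n)}_{lk}\int_0^t\psi_{lk}$ if $T_n=\mathbb X^{(n)}$, for $t\in[0,1]$. **Corollary (Kolmogorov–Smirnov credible band).** Suppose that the weak Bernstein–von Mises phenomenon holds in $\mathcal M_0(w)$ with centring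 $T_n$: as $n\to\infty$, the law $\tilde\Pi_n$ of $\sqrt n(f-T_n)$ under $f\sim\Pi(\cdot\mid X)$ satisfies $\beta(\tilde\Pi_n,\mathcal N)\to0$ in $P^n_{f_0}$-probability. Let $0<\alpha<1$, and let $R_n=R_n(X)$ be such that the band $$C_n=\{F:\ \|F-\mathbb T_n\|_\infty\le R_n/\sqrt n\}$$ has posterior mass $\Pi(f: F\in C_n\mid X)=1-\alpha$, $P^n_{f_0}$-almost surely for all large $n$. Then, as $n\to\infty$, $$P^n_{f_0}(F_0\in C_n)\to1-\alpha,\qquad\text{and}\qquad R_n\to c\ \text{ in }P^n_{f_0}\text{-probability for some constant } c.$$ -/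

import Mathlib

open MeasureTheory ProbabilityTheory Filter Set
open scoped Topology

noncomputable section

/-- Lebesgue measure on `[0,1]`. -/
abbrev unitVol : Measure ℝ := (volume : Measure ℝ).restrict (Icc 0 1)

/-- The Hilbert space `L²([0,1])`, with its Borel σ-algebra. -/
abbrev L2 : Type := Lp ℝ 2 unitVol

instance instMeasurableSpaceL2 : MeasurableSpace L2 := borel L2

instance instBorelSpaceL2 : BorelSpace L2 := ⟨rfl⟩

/-! ### Levels and indices

The multiscale index set is `{(l, k) : l ≥ J₀ - 1}`. The `i`-th level is `l = J₀ - 1 + i`.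
Level `J₀ - 1` carries the `2 ^ J₀` scaling functions, level `l ≥ J₀` carries `2 ^ l` wavelets. -/

/-- The resolution level `l = J₀ - 1 + i`. -/
def level (J₀ i : ℕ) : ℤ := (J₀ : ℤ) - 1 + i

/-- The number of indices `k` at the `i`-th level. -/
def levelCard (J₀ : ℕ) : ℕ → ℕ
  | 0 => 2 ^ J₀
  | i + 1 => 2 ^ (J₀ + i)

theorem levelCard_pos (J₀ i : ℕ) : 0 < levelCard J₀ i := by
  cases i <;> simp [levelCard]

instance instNonemptyFinLevelCard (J₀ i : ℕ) : Nonempty (Fin (levelCard J₀ i)) :=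
  ⟨⟨0, levelCard_pos J₀ i⟩⟩

/-- Multiscale indices: a level and a location at that level. -/
abbrev Idx (J₀ : ℕ) : Type := Σ i : ℕ, Fin (levelCard J₀ i)

/-- The resolution level of an index. -/
def Idx.lev {J₀ : ℕ} (p : Idx J₀) : ℤ := level J₀ p.1

/-- Distance of two points of `[0,1]` on the circle `ℝ / ℤ`. -/
def circDist (x y : ℝ) : ℝ := |(x - y) - round (x - y)|

/-- A multiscale wavelet basis of `L²([0,1])`: an orthonormal basis of localised functions
`ψ_{lk}`, `|ψ_{lk}(x)| ≤ C_m 2^{l/2} (1 + 2^l d(x, k 2^{-l}))^{-m}` for all `m`, with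
`∫ ψ_{lk} = 0` at all levels except the one of the scaling functions.
No smoothness is asked for (regularity `S ≥ 0` is arbitrary), and `d` is the distance on the
circle, so that the Haar basis, periodised wavelet bases and boundary corrected wavelet bases
are all of this kind. -/
structure WaveletBasis (J₀ : ℕ) where
  ψ : Idx J₀ → ℝ → ℝ
  measurable_ψ : ∀ p, Measurable (ψ p)
  basis : HilbertBasis (Idx J₀) ℝ L2
  basis_ae_eq : ∀ p, (basis p : ℝ → ℝ) =ᵐ[unitVol] ψ p
  localised : ∀ m : ℕ, ∃ C : ℝ, ∀ p : Idx J₀, ∀ x ∈ Icc (0 : ℝ) 1,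
    |ψ p x| ≤ C * (2 : ℝ) ^ ((p.lev : ℝ) / 2) /
      (1 + (2 : ℝ) ^ p.lev * circDist x ((p.2 : ℝ) / (2 : ℝ) ^ p.lev)) ^ m
  integral_eq_zero : ∀ p : Idx J₀, 1 ≤ p.1 → ∫ x in (0 : ℝ)..1, ψ p x = 0

/-- Admissible weights: `w_l ≥ 1` is increasing in `l ≥ J₀ - 1`, and `w_l / √l ↑ ∞`.
(The values of `w` below level `J₀ - 1` play no role.) -/
structure AdmissibleWeight (J₀ : ℕ) where
  w : ℤ → ℝ
  one_le : ∀ l : ℤ, (J₀ : ℤ) - 1 ≤ l → 1 ≤ w l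
  mono : MonotoneOn w {l : ℤ | (J₀ : ℤ) - 1 ≤ l}
  ratio_mono : MonotoneOn (fun l : ℤ => w l / √(l : ℝ)) {l : ℤ | (J₀ : ℤ) - 1 ≤ l ∧ 1 ≤ l}
  ratio_tendsto : Tendsto (fun l : ℤ => w l / √(l : ℝ)) atTop atTop

variable {J₀ : ℕ}

/-- The weight attached to the `i`-th level. -/
def AdmissibleWeight.at (w : AdmissibleWeight J₀) (i : ℕ) : ℝ := w.w (level J₀ i)

theorem AdmissibleWeight.one_le_at (w : AdmissibleWeight J₀) (i : ℕ) : 1 ≤ w.at i :=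
  w.one_le _ (by simp [level])

theorem AdmissibleWeight.at_pos (w : AdmissibleWeight J₀) (i : ℕ) : 0 < w.at i :=
  lt_of_lt_of_le one_pos (w.one_le_at i)

/-! ### The multiscale space `𝓜₀(w)` -/

/-- `max_k |x_{lk}| / w_l` at the `i`-th level. -/
def levelMax (w : AdmissibleWeight J₀) (x : Idx J₀ → ℝ) (i : ℕ) : ℝ :=
  ⨆ k : Fin (levelCard J₀ i), |x ⟨i, k⟩| / w.at i

theorem le_levelMax (w : AdmissibleWeight J₀) (x : Idx J₀ → ℝ) (p : Idx J₀) :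
    |x p| / w.at p.1 ≤ levelMax w x p.1 :=
  le_ciSup (f := fun k : Fin (levelCard J₀ p.1) => |x ⟨p.1, k⟩| / w.at p.1)
    (Set.finite_range _).bddAbove p.2

theorem levelMax_nonneg (w : AdmissibleWeight J₀) (x : Idx J₀ → ℝ) (i : ℕ) :
    0 ≤ levelMax w x i :=
  Real.iSup_nonneg fun _ => div_nonneg (abs_nonneg _) (w.at_pos i).le

/-- The sequences with `max_k |x_{lk}| / w_l → 0` as `l → ∞`. -/
def mZeroSubmodule (w : AdmissibleWeight J₀) : Submodule ℝ (Idx J₀ → ℝ) where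
  carrier := {x | Tendsto (levelMax w x) atTop (𝓝 0)}
  zero_mem' := by
    have : levelMax w (0 : Idx J₀ → ℝ) = fun _ => 0 := by
      funext i; simp [levelMax]
    simp only [mem_ofPred_eq, this]
    exact tendsto_const_nhds
  add_mem' := by
    intro x y hx hy
    simp only [mem_ofPred_eq] at hx hy ⊢
    refine squeeze_zero (levelMax_nonneg w _) (fun i => ?_) (by simpa using hx.add hy)
    refine ciSup_le fun k => ?_
    have h1 := le_levelMax w x ⟨i, k⟩
    have h2 := le_levelMax w y ⟨i, k⟩
    refine le_trans ?_ (add_le_add h1 h2)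
    rw [← add_div]
    exact div_le_div_of_nonneg_right (abs_add_le _ _) (w.at_pos i).le
  smul_mem' := by
    intro c x hx
    simp only [mem_ofPred_eq] at hx ⊢
    refine squeeze_zero (levelMax_nonneg w _) (fun i => ?_) (by simpa using hx.const_mul |c|)
    refine ciSup_le fun k => ?_
    have h1 := le_levelMax w x ⟨i, k⟩
    simp only [Pi.smul_apply, smul_eq_mul, abs_mul, mul_div_assoc]
    exact mul_le_mul_of_nonneg_left h1 (abs_nonneg c)

/-- The multiscale space `𝓜₀(w)`. -/
def MZero (w : AdmissibleWeight J₀) : Type := mZeroSubmodule w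

namespace MZero

variable {w : AdmissibleWeight J₀}

instance instAddCommGroup : AddCommGroup (MZero w) :=
  inferInstanceAs (AddCommGroup (mZeroSubmodule w))

instance instModule : Module ℝ (MZero w) := inferInstanceAs (Module ℝ (mZeroSubmodule w))

/-- The coordinates `(x_{lk})` of an element of `𝓜₀(w)`. -/
def coord (x : MZero w) : Idx J₀ → ℝ := x.1

theorem coord_injective : Function.Injective (coord : MZero w → Idx J₀ → ℝ) :=
  Subtype.val_injective

theorem tendsto_levelMax (x : MZero w) : Tendsto (levelMax w x.coord) atTop (𝓝 0) := x.2

@[simp] theorem coord_add (x y : MZero w) (p : Idx J₀) :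
    (x + y).coord p = x.coord p + y.coord p := rfl

@[simp] theorem coord_smul (c : ℝ) (x : MZero w) (p : Idx J₀) :
    (c • x).coord p = c * x.coord p := rfl

@[simp] theorem coord_zero (p : Idx J₀) : (0 : MZero w).coord p = 0 := rfl

/-- `‖x‖ = sup_l max_k |x_{lk}| / w_l`. -/
instance instNorm : Norm (MZero w) := ⟨fun x => ⨆ p : Idx J₀, |x.coord p| / w.at p.1⟩

theorem norm_def (x : MZero w) : ‖x‖ = ⨆ p : Idx J₀, |x.coord p| / w.at p.1 := rfl

theorem bddAbove (x : MZero w) :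
    BddAbove (Set.range fun p : Idx J₀ => |x.coord p| / w.at p.1) := by
  obtain ⟨M, hM⟩ := x.tendsto_levelMax.bddAbove_range
  refine ⟨M, ?_⟩
  rintro _ ⟨p, rfl⟩
  exact (le_levelMax w x.coord p).trans (hM ⟨p.1, rfl⟩)

theorem le_norm (x : MZero w) (p : Idx J₀) : |x.coord p| / w.at p.1 ≤ ‖x‖ :=
  le_ciSup x.bddAbove p

instance instNonemptyIdx : Nonempty (Idx J₀) := ⟨⟨0, ⟨0, levelCard_pos J₀ 0⟩⟩⟩

theorem normCore : NormedSpace.Core ℝ (MZero w) where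
  norm_nonneg x := Real.iSup_nonneg fun p => div_nonneg (abs_nonneg _) (w.at_pos _).le
  norm_smul c x := by
    simp only [norm_def, coord_smul, abs_mul, mul_div_assoc, Real.norm_eq_abs]
    rw [Real.mul_iSup_of_nonneg (abs_nonneg c)]
  norm_triangle x y := by
    refine ciSup_le fun p => ?_
    refine le_trans ?_ (add_le_add (x.le_norm p) (y.le_norm p))
    rw [← add_div]
    exact div_le_div_of_nonneg_right (abs_add_le _ _) (w.at_pos _).le
  norm_eq_zero_iff x := by
    constructor
    · intro h
      apply coord_injective
      funext p
      have h1 := x.le_norm p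
      rw [h] at h1
      have h2 : |x.coord p| ≤ 0 := by
        have := (div_le_iff₀ (w.at_pos p.1)).1 h1
        simpa using this
      simpa using abs_nonpos_iff.1 h2
    · rintro rfl
      simp [norm_def]

instance instNormedAddCommGroup : NormedAddCommGroup (MZero w) :=
  NormedAddCommGroup.ofCore normCore

instance instNormedSpace : NormedSpace ℝ (MZero w) := ⟨fun c x => (normCore.norm_smul c x).le⟩

instance instMeasurableSpace : MeasurableSpace (MZero w) := borel (MZero w)

instance instBorelSpace : BorelSpace (MZero w) := ⟨rfl⟩

end MZero

/-- The embedding `f ↦ (⟨f, ψ_{lk}⟩)` of `L²` into `𝓜₀(w)`. -/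
def WaveletBasis.embed (B : WaveletBasis J₀) (w : AdmissibleWeight J₀) (f : L2) : MZero w :=
  ⟨fun p => B.basis.repr f p, by
    have hs : Summable fun p : Idx J₀ => ‖B.basis.repr f p‖ ^ (2 : ENNReal).toReal :=
      (lp.memℓp (B.basis.repr f)).summable (by norm_num)
    have h0 := hs.tendsto_cofinite_zero
    change Tendsto (levelMax w fun p => B.basis.repr f p) atTop (𝓝 0)
    rw [Metric.tendsto_atTop]
    intro ε hε
    have hfin := h0.eventually (gt_mem_nhds (show (0 : ℝ) < (ε / 2) ^ 2 by positivity))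
    rw [Filter.eventually_cofinite] at hfin
    obtain ⟨N, hN⟩ := (hfin.image Sigma.fst).bddAbove
    refine ⟨N + 1, fun i hi => ?_⟩
    rw [Real.dist_eq, sub_zero, abs_of_nonneg (levelMax_nonneg w _ i)]
    refine lt_of_le_of_lt (ciSup_le fun k => ?_) (half_lt_self hε)
    have hlt : ‖B.basis.repr f ⟨i, k⟩‖ ^ (2 : ENNReal).toReal < (ε / 2) ^ 2 := by
      by_contra hcon
      have := hN ⟨⟨i, k⟩, hcon, rfl⟩
      have : i ≤ N := this
      omega
    have h2 : |B.basis.repr f ⟨i, k⟩| ≤ ε / 2 := by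
      have hsq : |B.basis.repr f ⟨i, k⟩| ^ 2 < (ε / 2) ^ 2 := by
        simpa using hlt
      exact le_of_lt (lt_of_pow_lt_pow_left₀ 2 (by positivity) hsq)
    exact (div_le_self (abs_nonneg _) (w.one_le_at i)).trans h2⟩

/-! ### Bounded-Lipschitz metric and convergence in probability -/

/-- The bounded-Lipschitz distance `β(μ, ν) = sup {|∫ F dμ - ∫ F dν| : ‖F‖_BL ≤ 1}`, where
`‖F‖_BL` is the sup-norm plus the Lipschitz constant of `F`. -/
def blDist {S : Type*} [MetricSpace S] [MeasurableSpace S] (μ ν : Measure S) : ℝ :=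
  sSup {r : ℝ | ∃ (F : S → ℝ) (a b : ℝ), 0 ≤ a ∧ 0 ≤ b ∧ a + b ≤ 1 ∧ (∀ x, |F x| ≤ a) ∧
    (∀ x y, |F x - F y| ≤ b * dist x y) ∧ r = |∫ x, F x ∂μ - ∫ x, F x ∂ν|}

/-- `Y_n → c` in `P_n`-probability. -/
def TendstoInProb {D : ℕ → Type*} [∀ n, MeasurableSpace (D n)] (P : ∀ n, Measure (D n))
    (Y : ∀ n, D n → ℝ) (c : ℝ) : Prop :=
  ∀ ε : ℝ, 0 < ε → Tendsto (fun n => P n {x | ε ≤ |Y n x - c|}) atTop (𝓝 0)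

/-! ### Gaussian limits -/

/-- The law of an i.i.d. sequence of standard normal variables indexed by `(l, k)`. -/
def gaussSeq (J₀ : ℕ) : Measure (Idx J₀ → ℝ) := Measure.infinitePi fun _ => gaussianReal 0 1

/-- The law in `𝓜₀(w)` of the white noise `𝕎 = (g_{lk})`, `g_{lk}` i.i.d. `N(0,1)`. -/
def whiteNoiseLaw (w : AdmissibleWeight J₀) : Measure (MZero w) :=
  (gaussSeq J₀).comap MZero.coord

theorem memLp_gaussSeq (q : Idx J₀) : MemLp (fun g : Idx J₀ → ℝ => g q) 2 (gaussSeq J₀) := by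
  have h := measurePreserving_eval_infinitePi (fun _ : Idx J₀ => gaussianReal 0 1) q
  exact (memLp_id_gaussianReal 2).comp_measurePreserving h

/-- The isonormal Gaussian process: `a ∈ ℓ²` is sent to `∑_q a_q g_q` (convergence in `L²`),
a centred Gaussian family with covariance `∑_q a_q b_q`. -/
def isonormal (a : Idx J₀ → ℝ) : Lp ℝ 2 (gaussSeq J₀) :=
  ∑' q, a q • (memLp_gaussSeq q).toLp (fun g : Idx J₀ → ℝ => g q)

/-- The probability measure on `[0,1]` with density `f`. -/
def densityLaw (f : L2) : Measure ℝ := unitVol.withDensity fun x => ENNReal.ofReal (f x)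

/-- `f` is a probability density on `[0,1]`. -/
def IsDensity (f : L2) : Prop := (∀ᵐ x ∂unitVol, 0 ≤ f x) ∧ ∫ x, f x ∂unitVol = 1

namespace WaveletBasis

/-- The `ψ_q`-coefficient of `(ψ_p - Pψ_p) √f`, where `P` has density `f`. -/
def bridgeCoeff (B : WaveletBasis J₀) (f : L2) (p q : Idx J₀) : ℝ :=
  ∫ x, (B.ψ p x - ∫ y, B.ψ p y ∂(densityLaw f)) * √(f x) * B.ψ q x ∂unitVol

/-- The law in `𝓜₀(w)` of the `P`-white bridge `(𝔾_P(ψ_p))_p`, where `P` has density `f`: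
`𝔾_P(g)` is the isonormal process at `(g - Pg) √f`, so that `(𝔾_P(ψ_p))_p` is centred Gaussian
with covariance `∫ (ψ_p - Pψ_p) (ψ_q - Pψ_q) dP`. -/
def whiteBridgeLaw (B : WaveletBasis J₀) (w : AdmissibleWeight J₀) (f : L2) :
    Measure (MZero w) :=
  ((gaussSeq J₀).map fun g p => isonormal (B.bridgeCoeff f p) g).comap MZero.coord

/-! ### The two sampling models -/

/-- The white noise model: `P_f^n` is the law of `f + 𝕎 / √n` in `𝓜₀(w)`. -/
def whiteNoiseModel (B : WaveletBasis J₀) (w : AdmissibleWeight J₀) (n : ℕ) (f : L2) :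
    Measure (MZero w) :=
  (whiteNoiseLaw w).map fun z => B.embed w f + (√(n : ℝ))⁻¹ • z

end WaveletBasis

/-- The i.i.d. sampling model: the law of `n` independent observations with density `f`. -/
def samplingModel (n : ℕ) (f : L2) : Measure (Fin n → ℝ) := Measure.pi fun _ => densityLaw f

/-- `post` is a posterior distribution for the prior `prior` and the model `P`: under the joint
law of parameter and data, `post x` is a version of the conditional law of the parameter given
the data `x`. -/
def IsPosterior {Θ D : Type*} [MeasurableSpace Θ] [MeasurableSpace D] (prior : Measure Θ)
    (P : Θ → Measure D) (post : Kernel D Θ) : Prop :=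
  ∀ (A : Set D) (E : Set Θ), MeasurableSet A → MeasurableSet E →
    ∫⁻ f, ∫⁻ x in A, post x E ∂(P f) ∂prior = ∫⁻ f in E, P f A ∂prior

/-- The primitive `F(t) = ∫₀ᵗ f` of `f ∈ L²`. -/
def primitive (f : L2) (t : ℝ) : ℝ := ∫ x in (0 : ℝ)..t, f x

namespace WaveletBasis

/-- The primitive map `t ↦ ∑_{l,k} h_{lk} ∫₀ᵗ ψ_{lk}` on `𝓜₀(w)`. -/
def primitiveMap (B : WaveletBasis J₀) {w : AdmissibleWeight J₀} (h : MZero w) (t : ℝ) : ℝ :=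
  ∑' p, h.coord p * ∫ x in (0 : ℝ)..t, B.ψ p x

/-- The weak Bernstein–von Mises phenomenon in `𝓜₀(w)` with centring `T n`: under `P n`, the
posterior law of `√n (f - T n)` converges to `G` in probability, in bounded-Lipschitz metric. -/
def WeakBvM (B : WaveletBasis J₀) (w : AdmissibleWeight J₀) {D : ℕ → Type*}
    [∀ n, MeasurableSpace (D n)] (P : ∀ n, Measure (D n)) (post : ∀ n, Kernel (D n) L2)
    (T : ∀ n, D n → MZero w) (G : Measure (MZero w)) : Prop :=
  TendstoInProb P
    (fun n x => blDist ((post n x).map fun f => √(n : ℝ) • (B.embed w f - T n x)) G) 0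

/-- `T n` is an efficient estimator of `f₀` in `𝓜₀(w)`: under `P n`, `√n (T n - f₀)` converges
in distribution to `G` in `𝓜₀(w)`. -/
def IsEfficient (B : WaveletBasis J₀) (w : AdmissibleWeight J₀) {D : ℕ → Type*}
    [∀ n, MeasurableSpace (D n)] (P : ∀ n, Measure (D n)) (f₀ : L2)
    (T : ∀ n, D n → MZero w) (G : Measure (MZero w)) : Prop :=
  Tendsto (fun n => blDist ((P n).map fun x => √(n : ℝ) • (T n x - B.embed w f₀)) G)
    atTop (𝓝 0)

/-- The projection `P_n(j)` of the empirical measure of `x₁, …, x_n` onto the levels `l ≤ j`. -/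
def empiricalProj (B : WaveletBasis J₀) (j n : ℕ) (x : Fin n → ℝ) : L2 :=
  ∑ i ∈ (Finset.range (j + 2)).filter (fun i => level J₀ i ≤ (j : ℤ)),
    ∑ k : Fin (levelCard J₀ i),
      ((n : ℝ)⁻¹ * ∑ m : Fin n, B.ψ ⟨i, k⟩ (x m)) • B.basis ⟨i, k⟩

/-- `f ∈ C^s([0,1])`: `f` is continuous and `sup_{l,k} 2^{l(s+1/2)} |⟨ψ_{lk}, f⟩| < ∞`. -/
def IsHolder (B : WaveletBasis J₀) (s : ℝ) (f : L2) : Prop :=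
  (∃ g : ℝ → ℝ, ContinuousOn g (Icc 0 1) ∧ f =ᵐ[unitVol] g) ∧
    ∃ C : ℝ, ∀ p : Idx J₀, (2 : ℝ) ^ ((p.lev : ℝ) * (s + 1 / 2)) * |B.basis.repr f p| ≤ C

/-- The centring `T n` is the projected empirical measure `P_n(j_n)`, where, for some `γ ≥ 0`,
`f₀ ∈ C^γ`, `√n 2^{-j_n(γ+1/2)} / w_{j_n} → 0` and `2^{j_n} j_n / n = O(1)`. -/
def IsEmpiricalCentring (B : WaveletBasis J₀) (w : AdmissibleWeight J₀) (f₀ : L2)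
    (T : ∀ n : ℕ, (Fin n → ℝ) → L2) : Prop :=
  ∃ (γ : ℝ) (j : ℕ → ℕ), 0 ≤ γ ∧ B.IsHolder γ f₀ ∧ (∀ n, (J₀ : ℤ) - 1 ≤ j n) ∧
    Tendsto (fun n : ℕ => √(n : ℝ) * (2 : ℝ) ^ (-(j n : ℝ) * (γ + 1 / 2)) / w.w (j n))
      atTop (𝓝 0) ∧
    (fun n : ℕ => (2 : ℝ) ^ j n * (j n : ℝ)) =O[atTop] (fun n : ℕ => (n : ℝ)) ∧
    ∀ n x, T n x = B.empiricalProj (j n) n x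

end WaveletBasis

/-! ### Credible bands -/

/-- `F` lies in the band with centre `c` and radius `r`: `‖F - c‖_∞ ≤ r` on `[0,1]`. -/
def InBand (c : ℝ → ℝ) (r : ℝ) (F : ℝ → ℝ) : Prop := ∀ t ∈ Icc (0 : ℝ) 1, |F t - c t| ≤ r

/-- The band with centre `c n x` and radius `R n x / √n` is a credible band of posterior mass
`1 - α` for the primitive `F` of `f`, almost surely for all large `n`. -/
def IsCredibleBand {D : ℕ → Type*} [∀ n, MeasurableSpace (D n)] (P : ∀ n, Measure (D n))
    (post : ∀ n, Kernel (D n) L2) (c : ∀ n, D n → ℝ → ℝ) (R : ∀ n, D n → ℝ) (α : ℝ) : Prop :=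
  ∀ᶠ n in atTop, ∀ᵐ x ∂(P n),
    post n x {f | InBand (c n x) (R n x / √(n : ℝ)) (primitive f)} = ENNReal.ofReal (1 - α)

/-- Asymptotic coverage `1 - α` of `F₀ = ∫₀ f₀` by the band, and convergence in probability of
`R n` to a constant. -/
def BandConclusion {D : ℕ → Type*} [∀ n, MeasurableSpace (D n)] (P : ∀ n, Measure (D n))
    (f₀ : L2) (c : ∀ n, D n → ℝ → ℝ) (R : ∀ n, D n → ℝ) (α : ℝ) : Prop :=
  Tendsto (fun n => P n {x | InBand (c n x) (R n x / √(n : ℝ)) (primitive f₀)}) atTop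
      (𝓝 (ENNReal.ofReal (1 - α))) ∧
    ∃ r : ℝ, TendstoInProb P R r

end

/-! Write `L` for the primitive map `x ↦ ∑ x_{lk} ∫₀ᵗ ψ_{lk}`. The proof is a continuous mapping
argument for the functional `x ↦ ‖L x‖_∞`, combined with the regularity of its law under the
Gaussian limit.

Continuity. Since `ψ_{lk}` is localised and has mean zero, `∫₀ᵗ ψ_{lk}` is small unless `k 2^{-l}`
is near `t`, `0` or `1`. Hence `∑_k |∫₀ᵗ ψ_{lk}| ≤ C 2^{-l/2}` uniformly in `t`, and `∑ w_l 2^{-l/2}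
< ∞` makes `L` bounded from `𝓜₀(w)` to `C([0,1])` (`primitiveCLM`). The band event then reads `‖L(√n
(f - T_n))‖ ≤ R_n` (`inBand_iff`).

Regularity of the limit. Both limits are images of an i.i.d. Gaussian sequence `g` (`gaussLaw`).
Shifting a single `g_q` keeps null sets null and translates the limit in a fixed direction `h_q`. If
`‖L x‖ = r > 0` is attained at `t` and `L h_q(t) ≠ 0`, small or large shifts along `±h_q` push the
norm beyond `r`; uncountably many disjoint translates of such an event cannot all have positive
mass, so there are no atoms. If `L h_q(t) = 0` for all `q`, then `L x(t) = 0` almost surely.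
Continuity of `s ↦ ‖L(x + s h_q)‖` shows similarly that the distribution function is strictly
increasing where it is positive. So there is exactly one `(1-α)`-quantile (`exists_quantile_norm`).

Conclusion. The posterior laws of `‖L(√n (f - T_n))‖` converge weakly in probability, so their
quantiles `R_n` converge to the quantile `r` of the limit. The variable `‖L(√n (T_n - f₀))‖` has the
same limit law, and a sandwich around `r` gives the coverage (`coverage_of_random_laws`).

The limit law of the centring is exact for white noise and a hypothesis for efficient estimators.
For `P_n(j_n)` it is proved directly after applying `L`: finite-dimensional central limit theorem on
low levels, exponential moments on the levels up to `j_n`, and a Hölder bound for the bias. A bound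
of order `l` for the expected maximum over level `l` is enough there, as `∑ l 2^{-l/2} < ∞`. -/

section

/-! ### Coordinates, truncations and the Borel structure of `𝓜₀(w)` -/

namespace MZero

variable {J₀ : ℕ} {w : AdmissibleWeight J₀}

theorem abs_coord_le (x : MZero w) (p : Idx J₀) : |x.coord p| ≤ ‖x‖ * w.at p.1 :=
  (div_le_iff₀ (w.at_pos p.1)).1 (x.le_norm p)

theorem norm_le_of_abs_coord_le {x : MZero w} {C : ℝ}
    (h : ∀ p, |x.coord p| ≤ C * w.at p.1) : ‖x‖ ≤ C :=
  ciSup_le fun p => (div_le_iff₀ (w.at_pos p.1)).2 (h p)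

@[simp] theorem coord_sub (x y : MZero w) (p : Idx J₀) :
    (x - y).coord p = x.coord p - y.coord p := rfl

/-- A coordinate of `𝓜₀(w)`, as a continuous linear functional. -/
noncomputable def coordCLM (w : AdmissibleWeight J₀) (p : Idx J₀) : MZero w →L[ℝ] ℝ :=
  LinearMap.mkContinuous
    { toFun := fun x => x.coord p
      map_add' := fun _ _ => rfl
      map_smul' := fun _ _ => rfl } (w.at p.1) fun x =>
        (x.abs_coord_le p).trans_eq (mul_comm _ _)

theorem measurable_coord : Measurable (coord : MZero w → Idx J₀ → ℝ) :=
  measurable_pi_lambda _ fun p => (coordCLM w p).continuous.measurable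

end MZero

/-- The multiscale indices of the first `N` levels. -/
abbrev LowIdx (J₀ N : ℕ) : Type := {p : Idx J₀ // p.1 < N}

instance instFiniteLowIdx (J₀ N : ℕ) : Finite (LowIdx J₀ N) :=
  Finite.of_injective
    (fun p : LowIdx J₀ N => (⟨⟨p.1.1, p.2⟩, p.1.2⟩ : Σ i : Fin N, Fin (levelCard J₀ i))) (by
      rintro ⟨⟨i, k⟩, hi⟩ ⟨⟨j, l⟩, hj⟩ h
      simp only [Sigma.mk.injEq, Fin.mk.injEq] at h
      obtain ⟨rfl, h⟩ := h
      simpa using h)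

noncomputable instance instFintypeLowIdx (J₀ N : ℕ) : Fintype (LowIdx J₀ N) := Fintype.ofFinite _

namespace MZero

variable {J₀ : ℕ} {w : AdmissibleWeight J₀}

theorem levelMax_eq_zero {x : Idx J₀ → ℝ} {i : ℕ} (h : ∀ k, x ⟨i, k⟩ = 0) :
    levelMax w x i = 0 := by
  simp [levelMax, h]

/-- The element of `𝓜₀(w)` with given coordinates. -/
def ofSeq (x : Idx J₀ → ℝ) (hx : Tendsto (levelMax w x) atTop (𝓝 0)) : MZero w := ⟨x, hx⟩

@[simp] theorem coord_ofSeq (x : Idx J₀ → ℝ) (hx : Tendsto (levelMax w x) atTop (𝓝 0)) :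
    (ofSeq x hx).coord = x := rfl

/-- Extension by zero of coordinates on the first `N` levels to an element of `𝓜₀(w)`. -/
noncomputable def extendLow (w : AdmissibleWeight J₀) (N : ℕ) :
    (LowIdx J₀ N → ℝ) →ₗ[ℝ] MZero w where
  toFun y := ofSeq (fun p => if h : p.1 < N then y ⟨p, h⟩ else 0) <|
    tendsto_const_nhds.congr' <| (eventually_ge_atTop N).mono fun i hi =>
      (levelMax_eq_zero fun k => dif_neg (not_lt.2 hi)).symm
  map_add' y z := by
    apply coord_injective; funext p
    simp only [coord_add, coord_ofSeq]
    split_ifs <;> simp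
  map_smul' c y := by
    apply coord_injective; funext p
    simp only [RingHom.id_apply, coord_smul, coord_ofSeq]
    split_ifs <;> simp

theorem coord_extendLow (N : ℕ) (y : LowIdx J₀ N → ℝ) (p : Idx J₀) :
    (extendLow w N y).coord p = if h : p.1 < N then y ⟨p, h⟩ else 0 := rfl

theorem continuous_extendLow (N : ℕ) : Continuous (extendLow w N) :=
  LinearMap.continuous_of_finiteDimensional _

/-- Restriction of a sequence to the first `N` levels. -/
noncomputable def trunc (w : AdmissibleWeight J₀) (N : ℕ) (x : Idx J₀ → ℝ) : MZero w :=
  extendLow w N fun p => x p.1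

theorem coord_trunc (N : ℕ) (x : Idx J₀ → ℝ) (p : Idx J₀) :
    (trunc w N x).coord p = if p.1 < N then x p else 0 := by
  simp [trunc, coord_extendLow]

theorem measurable_trunc (N : ℕ) : Measurable (trunc w N) :=
  (continuous_extendLow N).measurable.comp
    (measurable_pi_lambda _ fun p => measurable_pi_apply p.1)

theorem continuous_trunc (N : ℕ) : Continuous (trunc w N) :=
  (continuous_extendLow N).comp (continuous_pi fun p => continuous_apply p.1)

theorem tendsto_trunc (x : MZero w) :
    Tendsto (fun N => trunc w N x.coord) atTop (𝓝 x) := by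
  rw [tendsto_iff_norm_sub_tendsto_zero, Metric.tendsto_atTop]
  intro ε hε
  obtain ⟨N, hN⟩ := (Metric.tendsto_atTop.1 x.tendsto_levelMax) (ε / 2) (by positivity)
  refine ⟨N, fun n hn => ?_⟩
  rw [Real.dist_eq, sub_zero, abs_norm]
  refine lt_of_le_of_lt (norm_le_of_abs_coord_le (C := ε / 2) fun p => ?_) (half_lt_self hε)
  rw [coord_sub, coord_trunc]
  split_ifs with h
  · simpa using mul_nonneg (by positivity) (w.at_pos p.1).le
  · have h1 := hN p.1 (hn.trans (not_lt.1 h))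
    rw [Real.dist_eq, sub_zero, abs_of_nonneg (levelMax_nonneg w _ _)] at h1
    rw [zero_sub, abs_neg]
    exact (div_le_iff₀ (w.at_pos p.1)).1 ((le_levelMax w x.coord p).trans h1.le)

theorem range_coord :
    range (coord : MZero w → Idx J₀ → ℝ) = {x | Tendsto (levelMax w x) atTop (𝓝 0)} :=
  Subtype.range_coe_subtype

theorem measurable_levelMax (i : ℕ) : Measurable fun x : Idx J₀ → ℝ => levelMax w x i := by
  refine Measurable.iSup fun k => ?_
  exact ((measurable_pi_apply _).abs).div_const _

theorem measurableSet_range_coord : MeasurableSet (range (coord : MZero w → Idx J₀ → ℝ)) := by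
  rw [range_coord]
  exact measurableSet_tendsto _ measurable_levelMax

/-- The identity of `𝓜₀(w)` is the pointwise limit of truncations, each of which is a measurable
function of finitely many coordinates; so the Borel σ-algebra is generated by the coordinates. The
range is measurable as a set of convergence. This makes laws defined by `comap` along `coord`
tractable. -/
theorem measurableEmbedding_coord : MeasurableEmbedding (coord : MZero w → Idx J₀ → ℝ) := by
  refine ⟨coord_injective, measurable_coord, fun s hs => ?_⟩
  have key : @Measurable _ _ (MeasurableSpace.comap coord inferInstance) (instMeasurableSpace)
      (id : MZero w → MZero w) := by
    refine @measurable_of_tendsto_metrizable (MZero w) (MZero w)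
      (MeasurableSpace.comap coord inferInstance) _ _ _ _
      (fun (N : ℕ) (x : MZero w) => trunc w N x.coord) _ (fun N => ?_) ?_
    · exact (measurable_trunc N).comp (comap_measurable _)
    · exact tendsto_pi_nhds.2 tendsto_trunc
  obtain ⟨t, ht, hts⟩ := key hs
  rw [preimage_id] at hts
  rw [← hts, image_preimage_eq_inter_range]
  exact ht.inter measurableSet_range_coord

end MZero

namespace WaveletBasis

variable {J₀ : ℕ} (B : WaveletBasis J₀) {w : AdmissibleWeight J₀}

@[simp] theorem coord_embed (f : L2) (p : Idx J₀) : (B.embed w f).coord p = B.basis.repr f p := rfl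

/-- The embedding of `L²` into `𝓜₀(w)` as a continuous linear map. -/
noncomputable def embedCLM (w : AdmissibleWeight J₀) : L2 →L[ℝ] MZero w :=
  LinearMap.mkContinuous
    { toFun := B.embed w
      map_add' := fun f g => by apply MZero.coord_injective; funext p; simp
      map_smul' := fun c f => by apply MZero.coord_injective; funext p; simp } 1 fun f => by
        refine MZero.norm_le_of_abs_coord_le fun p => ?_
        have h1 : ‖B.basis.repr f p‖ ≤ ‖B.basis.repr f‖ := lp.norm_apply_le_norm (by simp) _ _
        rw [LinearIsometryEquiv.norm_map] at h1
        calc |B.basis.repr f p| ≤ ‖f‖ * 1 := by simpa using h1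
          _ ≤ 1 * ‖f‖ * w.at p.1 := by
            rw [one_mul]; exact mul_le_mul_of_nonneg_left (w.one_le_at _) (norm_nonneg _)

theorem continuous_embed : Continuous (B.embed w) := (B.embedCLM w).continuous

end WaveletBasis

end

/-! ### Decay of wavelet primitives: `∑_k |∫₀ᵗ ψ_{lk}| ≤ C 2^{-l/2}` -/

section

theorem exists_circDist_eq {x y : ℝ} (hx : x ∈ Icc (0 : ℝ) 1) (hy : y ∈ Icc (0 : ℝ) 1) :
    ∃ j : ℝ, (j = -1 ∨ j = 0 ∨ j = 1) ∧ circDist x y = |x - y - j| := by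
  refine ⟨(round (x - y) : ℤ), ?_, rfl⟩
  have h := abs_le.1 (abs_sub_round (x - y))
  have h1 : (-2 : ℝ) < (round (x - y) : ℤ) := by linarith [hx.1, hy.2]
  have h2 : ((round (x - y) : ℤ) : ℝ) < 2 := by linarith [hx.2, hy.1]
  have h1' : (-2 : ℤ) < round (x - y) := by exact_mod_cast h1
  have h2' : round (x - y) < (2 : ℤ) := by exact_mod_cast h2
  generalize round (x - y) = r at *
  have : r = -1 ∨ r = 0 ∨ r = 1 := by omega
  rcases this with rfl | rfl | rfl <;> simp

/-- The rescaled Cauchy kernel. -/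
noncomputable def cauchyKernel (a s : ℝ) : ℝ := (1 + (a * s) ^ 2)⁻¹

theorem cauchyKernel_pos (a s : ℝ) : 0 < cauchyKernel a s := by
  unfold cauchyKernel; positivity

theorem cauchyKernel_le_of_abs_le {a s t : ℝ} (h : |s| ≤ |t|) :
    cauchyKernel a t ≤ cauchyKernel a s := by
  unfold cauchyKernel
  refine inv_anti₀ (by positivity) ?_
  rw [mul_pow, mul_pow]
  have := sq_le_sq.2 h
  gcongr

theorem integrable_cauchyKernel {a : ℝ} (ha : 0 < a) (b : ℝ) :
    Integrable fun x => cauchyKernel a (x - b) :=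
  ((integrable_inv_one_add_sq.comp_mul_left' ha.ne').comp_sub_right b)

theorem integral_cauchyKernel {a : ℝ} (ha : 0 < a) (b : ℝ) :
    ∫ x, cauchyKernel a (x - b) = Real.pi / a := by
  rw [integral_sub_right_eq_self (cauchyKernel a)]
  have := Measure.integral_comp_mul_left (fun x : ℝ => (1 + x ^ 2)⁻¹) a
  rw [integral_univ_inv_one_add_sq] at this
  simpa [cauchyKernel, abs_of_pos ha, div_eq_inv_mul] using this

theorem summable_inv_one_add_int_sq : Summable fun j : ℤ => (1 + (j : ℝ) ^ 2)⁻¹ := by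
  refine Summable.of_nonneg_of_le (fun j => by positivity) (fun j => ?_)
    ((Real.summable_one_div_int_pow (p := 2)).2 one_lt_two |>.add
      (hasSum_ite_eq (0 : ℤ) (1 : ℝ)).summable)
  rcases eq_or_ne j 0 with rfl | hj
  · simp
  · have : (0 : ℝ) < (j : ℝ) ^ 2 := by positivity
    simp only [hj, if_false, add_zero, one_div]
    exact inv_anti₀ this (by linarith)

/-- A bound for `∑ k, (1 + (s - k)²)⁻¹` which is uniform in `s`. -/
noncomputable def cauchySumBound : ℝ := 3 * ∑' j : ℤ, (1 + (j : ℝ) ^ 2)⁻¹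

/-- Replacing `s` by its integer part costs a factor `3`, because `(u - v)² ≤ 2u² + 2v²` and the
fractional part is below `1`. What remains are distinct terms of one convergent series over `ℤ`. -/
theorem sum_inv_one_add_sub_sq_le (n : ℕ) (s : ℝ) :
    ∑ k : Fin n, (1 + (s - (k : ℕ)) ^ 2)⁻¹ ≤ cauchySumBound := by
  have h1 : ∀ k : Fin n, (1 + (s - (k : ℕ)) ^ 2)⁻¹
      ≤ 3 * (1 + ((⌊s⌋ - ((k : ℕ) : ℤ) : ℤ) : ℝ) ^ 2)⁻¹ := by
    intro k
    have h2 := Int.fract_nonneg s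
    have h3 := Int.fract_lt_one s
    have h4 : s = ⌊s⌋ + Int.fract s := (Int.floor_add_fract s).symm
    rw [← div_eq_mul_inv, le_div_iff₀ (by positivity), inv_mul_le_iff₀ (by positivity)]
    push_cast
    have h5 : (⌊s⌋ : ℝ) - (k : ℕ) = (s - (k : ℕ)) - Int.fract s := by linarith
    rw [h5]
    nlinarith [sq_nonneg ((s - (k : ℕ)) + Int.fract s)]
  refine (Finset.sum_le_sum fun k _ => h1 k).trans ?_
  rw [← Finset.mul_sum, cauchySumBound]
  refine mul_le_mul_of_nonneg_left ?_ (by norm_num)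
  have hinj : Function.Injective fun k : Fin n => ⌊s⌋ - ((k : ℕ) : ℤ) := fun a b h => by
    simp only at h; ext; omega
  have := summable_inv_one_add_int_sq.sum_le_tsum (Finset.univ.map ⟨_, hinj⟩)
    fun _ _ => by positivity
  rwa [Finset.sum_map] at this

theorem sum_cauchyKernel_le {n : ℕ} (hn : 0 < n) (t : ℝ) :
    ∑ k : Fin n, cauchyKernel n (t - (k : ℕ) / n) ≤ cauchySumBound := by
  have hn' : (n : ℝ) ≠ 0 := by positivity
  refine le_trans (le_of_eq (Finset.sum_congr rfl fun k _ => ?_))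
    (sum_inv_one_add_sub_sq_le n (n * t))
  rw [cauchyKernel, mul_sub, mul_div_cancel₀ _ hn']

/-- The fourth power leaves two Cauchy factors: one is to be summed over the locations `k`, the
other integrated in `x`. -/
theorem inv_one_add_mul_abs_pow_le {a s : ℝ} (ha : 0 ≤ a) :
    ((1 + a * |s|) ^ 4)⁻¹ ≤ cauchyKernel a s ^ 2 := by
  rw [cauchyKernel, inv_pow]
  refine inv_anti₀ (by positivity) ?_
  have h : 1 + (a * s) ^ 2 ≤ (1 + a * |s|) ^ 2 := by
    have h1 : (a * s) ^ 2 = (a * |s|) ^ 2 := by rw [mul_pow, mul_pow, sq_abs]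
    have h2 : 0 ≤ a * |s| := by positivity
    rw [h1]; nlinarith
  calc (1 + (a * s) ^ 2) ^ 2 ≤ ((1 + a * |s|) ^ 2) ^ 2 := by gcongr
    _ = _ := by ring

/-- The decay of a localised function away from its centre `y`, on the part of the circle cut at
`0` and `t` that does not contain `y`. -/
theorem inv_one_add_circDist_pow_le {a x y t : ℝ} (ha : 0 ≤ a) (hx : x ∈ Icc (0 : ℝ) 1)
    (hy : y ∈ Icc (0 : ℝ) 1) (h : x ≤ t ∧ t < y ∨ y ≤ t ∧ t ≤ x) :
    ((1 + a * circDist x y) ^ 4)⁻¹ ≤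
      (cauchyKernel a (t - y) + cauchyKernel a (0 - y) + cauchyKernel a (1 - y)) *
      (cauchyKernel a (x - (y - 1)) + cauchyKernel a (x - y) + cauchyKernel a (x - (y + 1))) := by
  obtain ⟨j, hj, hd⟩ := exists_circDist_eq hx hy
  rw [hd]
  refine (inv_one_add_mul_abs_pow_le ha).trans ?_
  have p1 := cauchyKernel_pos a
  rw [sq]
  refine mul_le_mul ?_ ?_ (p1 _).le (by linarith [p1 (t - y), p1 (0 - y), p1 (1 - y)])
  -- The way from `y` to `x` on the circle passes through `t` when `j = 0`, and through the cut
  -- point (reached as `1` or as `0`) when `j = ∓1`.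
  · have key : |t - y| ≤ |x - y - j| ∨ |0 - y| ≤ |x - y - j| ∨ |1 - y| ≤ |x - y - j| := by
      obtain ⟨hx0, hx1⟩ := hx
      obtain ⟨hy0, hy1⟩ := hy
      rw [zero_sub, abs_neg, abs_of_nonneg hy0, abs_of_nonneg (by linarith : 0 ≤ 1 - y)]
      rcases hj with rfl | rfl | rfl
      · right; right; rw [abs_of_nonneg (by linarith)]; linarith
      · left
        rcases h with ⟨h1, h2⟩ | ⟨h1, h2⟩
        · rw [abs_of_nonpos (by linarith), abs_of_nonpos (by linarith)]; linarith
        · rw [abs_of_nonneg (by linarith), abs_of_nonneg (by linarith)]; linarith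
      · right; left; rw [abs_of_nonpos (by linarith)]; linarith
    rcases key with h | h | h <;> linarith [cauchyKernel_le_of_abs_le (a := a) h, p1 (t - y),
      p1 (0 - y), p1 (1 - y)]
  · have q := p1 (x - (y - 1)); have q' := p1 (x - y); have q'' := p1 (x - (y + 1))
    rcases hj with rfl | rfl | rfl
    · rw [show x - y - -1 = x - (y - 1) by ring]; linarith
    · rw [sub_zero]; linarith
    · rw [show x - y - 1 = x - (y + 1) by ring]; linarith

/-- The factor `2^{-l/2}` at the `i`-th level. -/
noncomputable def levelRate (J₀ i : ℕ) : ℝ := (2 : ℝ) ^ (-(level J₀ i : ℝ) / 2)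

theorem levelRate_pos (J₀ i : ℕ) : 0 < levelRate J₀ i := by unfold levelRate; positivity

namespace WaveletBasis

variable {J₀ : ℕ} (B : WaveletBasis J₀) {w : AdmissibleWeight J₀}

theorem exists_abs_ψ_le : ∃ C : ℝ, 0 ≤ C ∧ ∀ p : Idx J₀, ∀ x ∈ Icc (0 : ℝ) 1,
    |B.ψ p x| ≤ C * (2 : ℝ) ^ ((p.lev : ℝ) / 2) := by
  obtain ⟨C, hC⟩ := B.localised 0
  refine ⟨|C|, abs_nonneg C, fun p x hx => ?_⟩
  have := hC p x hx
  rw [pow_zero, div_one] at this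
  exact this.trans (mul_le_mul_of_nonneg_right (le_abs_self C) (by positivity))

theorem integrable_ψ (p : Idx J₀) : Integrable (B.ψ p) unitVol := by
  obtain ⟨C, -, hC⟩ := B.exists_abs_ψ_le
  refine Integrable.mono' (integrable_const (C * (2 : ℝ) ^ ((p.lev : ℝ) / 2)))
    (B.measurable_ψ p).aestronglyMeasurable ?_
  filter_upwards [ae_restrict_mem measurableSet_Icc] with x hx
  exact hC p x hx

theorem intervalIntegrable_ψ (p : Idx J₀) {a b : ℝ} (ha : a ∈ Icc (0 : ℝ) 1)
    (hb : b ∈ Icc (0 : ℝ) 1) : IntervalIntegrable (B.ψ p) volume a b := by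
  rw [intervalIntegrable_iff]
  refine IntegrableOn.mono_set (t := Icc 0 1) (B.integrable_ψ p) ?_
  exact uIoc_subset_uIcc.trans (ordConnected_Icc.uIcc_subset ha hb)

/-- The primitive `∫₀ᵗ ψ_p`. -/
noncomputable def waveletPrimitive (p : Idx J₀) (t : ℝ) : ℝ := ∫ x in (0 : ℝ)..t, B.ψ p x

theorem continuousOn_waveletPrimitive (p : Idx J₀) :
    ContinuousOn (B.waveletPrimitive p) (Icc 0 1) := by
  have := intervalIntegral.continuousOn_primitive_interval (μ := volume) (f := B.ψ p) (a := 0)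
    (b := 1) (by rw [uIcc_of_le zero_le_one]; exact B.integrable_ψ p)
  rwa [uIcc_of_le zero_le_one] at this

theorem abs_waveletPrimitive_le_integral (p : Idx J₀) {t : ℝ} (ht : t ∈ Icc (0 : ℝ) 1) :
    |B.waveletPrimitive p t| ≤ ∫ x in Ioc 0 t, |B.ψ p x| := by
  rw [waveletPrimitive, intervalIntegral.integral_of_le ht.1]
  exact norm_integral_le_integral_norm (B.ψ p)

theorem abs_waveletPrimitive_le_integral' (p : Idx J₀) (hp : 1 ≤ p.1) {t : ℝ}
    (ht : t ∈ Icc (0 : ℝ) 1) :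
    |B.waveletPrimitive p t| ≤ ∫ x in Ioc t 1, |B.ψ p x| := by
  have h0 : (0 : ℝ) ∈ Icc (0 : ℝ) 1 := by simp
  have h1 : (1 : ℝ) ∈ Icc (0 : ℝ) 1 := by simp
  have := intervalIntegral.integral_add_adjacent_intervals (B.intervalIntegrable_ψ p h0 ht)
    (B.intervalIntegrable_ψ p ht h1)
  rw [B.integral_eq_zero p hp] at this
  have h2 : B.waveletPrimitive p t = -∫ x in t..1, B.ψ p x := by
    rw [waveletPrimitive]; linarith
  rw [h2, abs_neg, intervalIntegral.integral_of_le ht.2]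
  exact norm_integral_le_integral_norm (B.ψ p)

/-- With `n = 2^l`, the amplitude `2^{l/2}` times the integral `π / n` of a Cauchy factor gives
`2^{-l/2}`; the other Cauchy factor, taken at `t`, `0` and `1`, sums over `k` to a constant. -/
theorem exists_sum_abs_waveletPrimitive_le_succ : ∃ C : ℝ, 0 ≤ C ∧ ∀ i : ℕ, ∀ t ∈ Icc (0 : ℝ) 1,
    ∑ k, |B.waveletPrimitive ⟨i + 1, k⟩ t| ≤ C * levelRate J₀ (i + 1) := by
  obtain ⟨C, hC⟩ := B.localised 4
  have hS : 0 ≤ cauchySumBound := by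
    refine le_trans ?_ (sum_inv_one_add_sub_sq_le 0 0); simp
  refine ⟨|C| * (3 * cauchySumBound) * (3 * Real.pi), by positivity, fun i t ht => ?_⟩
  set n : ℕ := 2 ^ (J₀ + i) with hn
  have hn0 : 0 < n := by positivity
  have hna : (0 : ℝ) < n := by positivity
  have hlev : level J₀ (i + 1) = ((J₀ + i : ℕ) : ℤ) := by simp [level]
  have hz : (2 : ℝ) ^ (level J₀ (i + 1)) = n := by rw [hlev, zpow_natCast, hn]; norm_cast
  set r : ℝ := (2 : ℝ) ^ ((level J₀ (i + 1) : ℝ) / 2) with hr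
  have hr0 : 0 < r := by positivity
  have hrr : r / n = levelRate J₀ (i + 1) := by
    rw [← hz, levelRate, hr, ← Real.rpow_intCast, ← Real.rpow_sub two_pos]; congr 1; ring
  have hbound : ∀ k : Fin (levelCard J₀ (i + 1)),
      |B.waveletPrimitive ⟨i + 1, k⟩ t| ≤ |C| * r * (3 * Real.pi / n) *
        (cauchyKernel n (t - (k : ℕ) / n) + cauchyKernel n (0 - (k : ℕ) / n) +
          cauchyKernel n (1 - (k : ℕ) / n)) := by
    intro k
    set y : ℝ := (k : ℕ) / n with hy
    have hk : ((k : ℕ) : ℝ) < n := by exact_mod_cast k.2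
    have hy1 : y ∈ Icc (0 : ℝ) 1 := ⟨by positivity, by rw [hy, div_le_one hna]; exact hk.le⟩
    set A := cauchyKernel n (t - y) + cauchyKernel n (0 - y) + cauchyKernel n (1 - y) with hA
    set g : ℝ → ℝ := fun x => |C| * r * A * (cauchyKernel n (x - (y - 1)) +
      cauchyKernel n (x - y) + cauchyKernel n (x - (y + 1))) with hg
    have hA0 : 0 ≤ A := by
      have := cauchyKernel_pos n; rw [hA]; linarith [this (t - y), this (0 - y), this (1 - y)]
    have hg0 : ∀ x, 0 ≤ g x := fun x => by
      have := cauchyKernel_pos n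
      exact mul_nonneg (by positivity) (by
        linarith [this (x - (y - 1)), this (x - y), this (x - (y + 1))])
    have hi := integrable_cauchyKernel hna
    have hi2 : Integrable fun x => cauchyKernel n (x - (y - 1)) + cauchyKernel n (x - y) :=
      (hi _).add (hi _)
    have hgi : Integrable g := (hi2.add (hi _)).const_mul _
    have hgv : ∫ x, g x = |C| * r * (3 * Real.pi / n) * A := by
      rw [hg, integral_const_mul, integral_add hi2 (hi _), integral_add (hi _) (hi _),
        integral_cauchyKernel hna, integral_cauchyKernel hna, integral_cauchyKernel hna]
      ring
    have hpt : ∀ x ∈ Icc (0 : ℝ) 1, (x ≤ t ∧ t < y ∨ y ≤ t ∧ t ≤ x) →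
        |B.ψ ⟨i + 1, k⟩ x| ≤ g x := by
      intro x hx hxt
      refine (hC ⟨i + 1, k⟩ x hx).trans ?_
      have h1 := inv_one_add_circDist_pow_le hna.le hx hy1 hxt
      simp only [Idx.lev]
      rw [hz, ← hr, ← hy, div_eq_mul_inv, hg]
      simp only
      rw [mul_assoc (|C| * r)]
      have h2 : C * r ≤ |C| * r := mul_le_mul_of_nonneg_right (le_abs_self C) hr0.le
      have h3 : 0 ≤ ((1 + (n : ℝ) * circDist x y) ^ 4)⁻¹ := by
        have : 0 ≤ circDist x y := abs_nonneg _
        positivity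
      exact mul_le_mul h2 h1 h3 (by positivity)
    have hset : ∀ s : Set ℝ, MeasurableSet s → s ⊆ Icc 0 1 →
        (∀ x ∈ s, |B.ψ ⟨i + 1, k⟩ x| ≤ g x) →
        ∫ x in s, |B.ψ ⟨i + 1, k⟩ x| ≤ |C| * r * (3 * Real.pi / n) * A := by
      intro s hs hs1 hs2
      rw [← hgv]
      refine (setIntegral_mono_on ?_ hgi.integrableOn hs hs2).trans
        (setIntegral_le_integral hgi (Eventually.of_forall hg0))
      exact (IntegrableOn.mono_set (t := Icc 0 1) (B.integrable_ψ _) hs1).abs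
    -- By mean zero, `∫₀ᵗ ψ` equals `-∫ₜ¹ ψ`, so the integral can be taken on the side of `t` that
    -- does not contain the centre `y`.
    rcases lt_or_ge t y with hty | hty
    · refine (B.abs_waveletPrimitive_le_integral _ ht).trans
        (hset _ measurableSet_Ioc (fun x hx => ⟨hx.1.le, hx.2.trans ht.2⟩) fun x hx => ?_)
      exact hpt x ⟨hx.1.le, hx.2.trans ht.2⟩ (Or.inl ⟨hx.2, hty⟩)
    · refine (B.abs_waveletPrimitive_le_integral' _ (by simp) ht).trans
        (hset _ measurableSet_Ioc (fun x hx => ⟨ht.1.trans hx.1.le, hx.2⟩) fun x hx => ?_)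
      exact hpt x ⟨ht.1.trans hx.1.le, hx.2⟩ (Or.inr ⟨hty, hx.1.le⟩)
  refine (Finset.sum_le_sum fun k _ => hbound k).trans ?_
  rw [← Finset.mul_sum, Finset.sum_add_distrib, Finset.sum_add_distrib, ← hrr]
  have hs : ∀ s : ℝ, ∑ k : Fin (levelCard J₀ (i + 1)), cauchyKernel n (s - (k : ℕ) / n)
      ≤ cauchySumBound := fun s => sum_cauchyKernel_le hn0 s
  calc _ ≤ |C| * r * (3 * Real.pi / n) * (3 * cauchySumBound) := by
        refine mul_le_mul_of_nonneg_left ?_ (by positivity)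
        linarith [hs t, hs 0, hs 1]
    _ = _ := by ring

/-- Scaling functions need not have mean zero, but they form a single finite level, where continuity
on a compact interval gives a bound. -/
theorem exists_sum_abs_waveletPrimitive_le : ∃ C : ℝ, 0 ≤ C ∧ ∀ i : ℕ, ∀ t ∈ Icc (0 : ℝ) 1,
    ∑ k, |B.waveletPrimitive ⟨i, k⟩ t| ≤ C * levelRate J₀ i := by
  obtain ⟨C, hC0, hC⟩ := B.exists_sum_abs_waveletPrimitive_le_succ
  obtain ⟨M, hM⟩ : ∃ M : ℝ, ∀ t ∈ Icc (0 : ℝ) 1,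
      ∑ k, |B.waveletPrimitive ⟨0, k⟩ t| ≤ M := by
    have hcont : ContinuousOn (fun t => ∑ k, |B.waveletPrimitive ⟨0, k⟩ t|) (Icc 0 1) :=
      continuousOn_finsetSum _ fun k _ => (B.continuousOn_waveletPrimitive _).abs
    obtain ⟨M, hM⟩ := (isCompact_Icc.image_of_continuousOn hcont).bddAbove
    exact ⟨M, fun t ht => hM ⟨t, ht, rfl⟩⟩
  have h0 := levelRate_pos J₀ 0
  refine ⟨max C (M / levelRate J₀ 0), le_max_of_le_left hC0, fun i t ht => ?_⟩
  cases i with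
  | zero =>
    refine (hM t ht).trans ?_
    rw [← div_le_iff₀ h0]
    exact le_max_right _ _
  | succ i =>
    exact (hC i t ht).trans (mul_le_mul_of_nonneg_right (le_max_left _ _) (levelRate_pos _ _).le)

end WaveletBasis

end

/-! ### The primitive map as a bounded operator into `C([0,1])` -/

section

namespace WaveletBasis

variable {J₀ : ℕ} (B : WaveletBasis J₀) {w : AdmissibleWeight J₀}

/-- A constant `C` with `∑ k, |∫₀ᵗ ψ_{lk}| ≤ C 2^{-l/2}`. -/
noncomputable def primitiveConst : ℝ := B.exists_sum_abs_waveletPrimitive_le.choose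

theorem primitiveConst_nonneg : 0 ≤ B.primitiveConst :=
  B.exists_sum_abs_waveletPrimitive_le.choose_spec.1

theorem sum_abs_waveletPrimitive_le (i : ℕ) {t : ℝ} (ht : t ∈ Icc (0 : ℝ) 1) :
    ∑ k, |B.waveletPrimitive ⟨i, k⟩ t| ≤ B.primitiveConst * levelRate J₀ i :=
  B.exists_sum_abs_waveletPrimitive_le.choose_spec.2 i t ht

theorem sum_abs_mul_waveletPrimitive_le {x : Idx J₀ → ℝ} {i : ℕ} {b : ℝ} (hb : 0 ≤ b)
    (hx : ∀ k, |x ⟨i, k⟩| ≤ b) {t : ℝ} (ht : t ∈ Icc (0 : ℝ) 1) :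
    ∑ k, |x ⟨i, k⟩ * B.waveletPrimitive ⟨i, k⟩ t| ≤ B.primitiveConst * (b * levelRate J₀ i) := by
  calc ∑ k, |x ⟨i, k⟩ * B.waveletPrimitive ⟨i, k⟩ t|
      ≤ ∑ k, b * |B.waveletPrimitive ⟨i, k⟩ t| := by
        refine Finset.sum_le_sum fun k _ => ?_
        rw [abs_mul]
        exact mul_le_mul_of_nonneg_right (hx k) (abs_nonneg _)
    _ ≤ b * (B.primitiveConst * levelRate J₀ i) := by
        rw [← Finset.mul_sum]
        exact mul_le_mul_of_nonneg_left (B.sum_abs_waveletPrimitive_le i ht) hb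
    _ = _ := by ring

theorem sum_abs_coord_mul_le (x : MZero w) (i : ℕ) {t : ℝ} (ht : t ∈ Icc (0 : ℝ) 1) :
    ∑ k, |x.coord ⟨i, k⟩ * B.waveletPrimitive ⟨i, k⟩ t|
      ≤ B.primitiveConst * ‖x‖ * (w.at i * levelRate J₀ i) := by
  refine (B.sum_abs_mul_waveletPrimitive_le (mul_nonneg (norm_nonneg x) (w.at_pos i).le)
    (fun k => x.abs_coord_le ⟨i, k⟩) ht).trans_eq ?_
  ring

variable (hw : Summable fun i : ℕ => w.at i * levelRate J₀ i)

include hw in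
theorem summable_waveletPrimitive {x : Idx J₀ → ℝ} {D : ℝ} (hD : 0 ≤ D)
    (hx : ∀ p, |x p| ≤ D * w.at p.1) {t : ℝ} (ht : t ∈ Icc (0 : ℝ) 1) :
    Summable fun p : Idx J₀ => x p * B.waveletPrimitive p t := by
  refine Summable.of_abs ?_
  rw [summable_sigma_of_nonneg fun _ => abs_nonneg _]
  refine ⟨fun i => (hasSum_fintype _).summable, ?_⟩
  refine Summable.of_nonneg_of_le (fun i => tsum_nonneg fun _ => abs_nonneg _) (fun i => ?_)
    (hw.mul_left (B.primitiveConst * D))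
  rw [tsum_fintype]
  refine (B.sum_abs_mul_waveletPrimitive_le (mul_nonneg hD (w.at_pos i).le)
    (fun k => hx ⟨i, k⟩) ht).trans_eq ?_
  ring

include hw in
theorem summable_coord_mul (x : MZero w) {t : ℝ} (ht : t ∈ Icc (0 : ℝ) 1) :
    Summable fun p : Idx J₀ => x.coord p * B.waveletPrimitive p t :=
  B.summable_waveletPrimitive hw (norm_nonneg x) x.abs_coord_le ht

include hw in
theorem primitiveMap_eq_tsum_level (x : MZero w) {t : ℝ} (ht : t ∈ Icc (0 : ℝ) 1) :
    B.primitiveMap x t = ∑' i, ∑ k, x.coord ⟨i, k⟩ * B.waveletPrimitive ⟨i, k⟩ t := by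
  have := (B.summable_coord_mul hw x ht).tsum_sigma
  simp only [tsum_fintype] at this
  exact this

include hw in
theorem continuousOn_primitiveMap (x : MZero w) :
    ContinuousOn (B.primitiveMap x) (Icc 0 1) := by
  refine ContinuousOn.congr (f := fun t => ∑' i, ∑ k, x.coord ⟨i, k⟩ *
    B.waveletPrimitive ⟨i, k⟩ t) ?_ fun t ht => B.primitiveMap_eq_tsum_level hw x ht
  refine continuousOn_tsum (fun i => continuousOn_finsetSum _ fun k _ =>
    continuousOn_const.mul (B.continuousOn_waveletPrimitive _))
    (hw.mul_left (B.primitiveConst * ‖x‖)) fun i t ht => ?_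
  exact (Finset.abs_sum_le_sum_abs _ _).trans (B.sum_abs_coord_mul_le x i ht)

include hw in
theorem abs_primitiveMap_le (x : MZero w) {t : ℝ} (ht : t ∈ Icc (0 : ℝ) 1) :
    |B.primitiveMap x t| ≤ B.primitiveConst * (∑' i, w.at i * levelRate J₀ i) * ‖x‖ := by
  rw [B.primitiveMap_eq_tsum_level hw x ht]
  have h := hw.mul_left (B.primitiveConst * ‖x‖)
  refine (tsum_of_norm_bounded (f := fun i => ∑ k, x.coord ⟨i, k⟩ *
    B.waveletPrimitive ⟨i, k⟩ t) h.hasSum fun i => (Finset.abs_sum_le_sum_abs _ _).trans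
    (B.sum_abs_coord_mul_le x i ht)).trans_eq ?_
  rw [tsum_mul_left]; ring

/-- The primitive map as a bounded operator from `𝓜₀(w)` to `C([0,1])`. -/
noncomputable def primitiveCLM : MZero w →L[ℝ] C(Icc (0 : ℝ) 1, ℝ) :=
  LinearMap.mkContinuous
    { toFun := fun x => ⟨fun t => B.primitiveMap x t,
        (B.continuousOn_primitiveMap hw x).domRestrict⟩
      map_add' := fun x y => by
        ext t
        change B.primitiveMap (x + y) t = B.primitiveMap x t + B.primitiveMap y t
        simp only [primitiveMap, MZero.coord_add, add_mul]
        exact (B.summable_coord_mul hw x t.2).tsum_add (B.summable_coord_mul hw y t.2)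
      map_smul' := fun c x => by
        ext t
        change B.primitiveMap (c • x) t = c * B.primitiveMap x t
        simp only [primitiveMap, MZero.coord_smul, mul_assoc, tsum_mul_left] }
    (B.primitiveConst * ∑' i, w.at i * levelRate J₀ i) fun x => by
      rw [ContinuousMap.norm_le_of_nonempty]
      exact fun t => B.abs_primitiveMap_le hw x t.2

@[simp] theorem primitiveCLM_apply (x : MZero w) (t : Icc (0 : ℝ) 1) :
    B.primitiveCLM hw x t = B.primitiveMap x t := rfl

/-- A bound for the primitive of a sequence supported on finitely many levels. -/
theorem norm_primitiveCLM_le_sum {x : MZero w} {F : Finset ℕ}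
    (hF : ∀ p : Idx J₀, p.1 ∉ F → x.coord p = 0) {b : ℕ → ℝ} (hb : ∀ i, 0 ≤ b i)
    (hx : ∀ p, |x.coord p| ≤ b p.1) :
    ‖B.primitiveCLM hw x‖ ≤ B.primitiveConst * ∑ i ∈ F, b i * levelRate J₀ i := by
  rw [ContinuousMap.norm_le_of_nonempty]
  intro t
  rw [primitiveCLM_apply, B.primitiveMap_eq_tsum_level hw x t.2, tsum_eq_sum (s := F) fun i hi =>
    Finset.sum_eq_zero fun k _ => by rw [hF ⟨i, k⟩ hi, zero_mul], Finset.mul_sum]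
  refine (Finset.abs_sum_le_sum_abs _ _).trans (Finset.sum_le_sum fun i _ => ?_)
  exact (Finset.abs_sum_le_sum_abs _ _).trans
    (B.sum_abs_mul_waveletPrimitive_le (hb i) (fun k => hx ⟨i, k⟩) t.2)

theorem repr_apply_eq_integral (f : L2) (p : Idx J₀) :
    B.basis.repr f p = ∫ x, B.ψ p x * f x ∂unitVol := by
  rw [HilbertBasis.repr_apply_apply, L2.inner_def]
  refine integral_congr_ae ?_
  filter_upwards [B.basis_ae_eq p] with x hx
  simp [hx, mul_comm]

/-- The indicator function of `(0, t]` in `L²([0,1])`. -/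
noncomputable def _root_.iocIndicator (t : ℝ) : L2 :=
  indicatorConstLp 2 (measurableSet_Ioc (a := (0 : ℝ)) (b := t)) (measure_ne_top unitVol _) 1

theorem _root_.inner_iocIndicator (f : L2) {t : ℝ} (ht : t ∈ Icc (0 : ℝ) 1) :
    inner ℝ (iocIndicator t) f = primitive f t := by
  rw [iocIndicator, L2.inner_indicatorConstLp_one, primitive,
    intervalIntegral.integral_of_le ht.1, Measure.restrict_restrict measurableSet_Ioc]
  congr 2
  exact inter_eq_left.2 fun x hx => ⟨hx.1.le, hx.2.trans ht.2⟩

theorem inner_iocIndicator_basis (p : Idx J₀) {t : ℝ} (ht : t ∈ Icc (0 : ℝ) 1) :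
    inner ℝ (iocIndicator t) (B.basis p) = B.waveletPrimitive p t := by
  have hsub : Ioc 0 t ⊆ Icc (0 : ℝ) 1 := fun x hx => ⟨hx.1.le, hx.2.trans ht.2⟩
  rw [iocIndicator, L2.inner_indicatorConstLp_one, waveletPrimitive,
    intervalIntegral.integral_of_le ht.1, Measure.restrict_restrict measurableSet_Ioc,
    inter_eq_left.2 hsub]
  exact integral_congr_ae (ae_mono (Measure.restrict_mono hsub le_rfl) (B.basis_ae_eq p))

/-- Parseval's identity for `f` and the indicator of `(0, t]`. -/
theorem hasSum_primitive (f : L2) {t : ℝ} (ht : t ∈ Icc (0 : ℝ) 1) :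
    HasSum (fun p => B.basis.repr f p * B.waveletPrimitive p t) (primitive f t) := by
  have := B.basis.hasSum_inner_mul_inner (iocIndicator t) f
  rw [inner_iocIndicator f ht] at this
  simpa only [B.inner_iocIndicator_basis _ ht, ← HilbertBasis.repr_apply_apply, mul_comm]
    using this

theorem primitiveMap_embed (w : AdmissibleWeight J₀) (f : L2) {t : ℝ} (ht : t ∈ Icc (0 : ℝ) 1) :
    B.primitiveMap (B.embed w f) t = primitive f t :=
  (B.hasSum_primitive f ht).tsum_eq

/-- The only place where bands enter: from here on a credible band is a sublevel set of `‖L ·‖`. -/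
theorem inBand_iff (x y : MZero w) {n : ℕ} (hn : 0 < n) (r : ℝ) :
    InBand (B.primitiveMap y) (r / √(n : ℝ)) (B.primitiveMap x) ↔
      ‖B.primitiveCLM hw (√(n : ℝ) • (x - y))‖ ≤ r := by
  have hn' : 0 < √(n : ℝ) := by positivity
  rw [ContinuousMap.norm_le_of_nonempty, InBand, Subtype.forall]
  refine forall₂_congr fun t ht => ?_
  rw [map_smul, map_sub, ContinuousMap.smul_apply, ContinuousMap.sub_apply, primitiveCLM_apply,
    primitiveCLM_apply, smul_eq_mul, Real.norm_eq_abs, abs_mul, abs_of_pos hn', le_div_iff₀ hn',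
    mul_comm]

end WaveletBasis

theorem inBand_congr {c c' F F' : ℝ → ℝ} {r : ℝ} (hc : ∀ t ∈ Icc (0 : ℝ) 1, c t = c' t)
    (hF : ∀ t ∈ Icc (0 : ℝ) 1, F t = F' t) : InBand c r F ↔ InBand c' r F' :=
  forall₂_congr fun t ht => by rw [hc t ht, hF t ht]

end

/-! ### The isonormal process and shifts of one Gaussian coordinate -/

section

/-- The space `ℓ²` over the multiscale indices. -/
abbrev SeqL2 (J₀ : ℕ) : Type := lp (fun _ : Idx J₀ => ℝ) 2

variable {J₀ : ℕ}

instance instIsProbabilityMeasureGaussSeq : IsProbabilityMeasure (gaussSeq J₀) := by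
  unfold gaussSeq; infer_instance

theorem gaussSeq_map_eval (q : Idx J₀) :
    (gaussSeq J₀).map (fun g => g q) = gaussianReal 0 1 :=
  Measure.infinitePi_map_eval _ q

theorem iIndepFun_gaussSeq : iIndepFun (fun (q : Idx J₀) (g : Idx J₀ → ℝ) => g q) (gaussSeq J₀) :=
  iIndepFun_infinitePi (P := fun _ : Idx J₀ => gaussianReal 0 1) (X := fun _ x => x)
    fun _ => measurable_id

theorem integral_eval_gaussSeq (q : Idx J₀) : ∫ g, g q ∂(gaussSeq J₀) = 0 := by
  have := integral_map (μ := gaussSeq J₀) (φ := fun g => g q)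
    (measurable_pi_apply q).aemeasurable (f := id) aestronglyMeasurable_id
  rw [gaussSeq_map_eval] at this
  simpa using this.symm

theorem integral_eval_sq_gaussSeq (q : Idx J₀) : ∫ g, g q * g q ∂(gaussSeq J₀) = 1 := by
  have := integral_map (μ := gaussSeq J₀) (φ := fun g => g q)
    (measurable_pi_apply q).aemeasurable (f := fun x => x ^ 2)
    (by fun_prop)
  rw [gaussSeq_map_eval] at this
  have h2 := variance_eq_integral (μ := gaussianReal 0 1) (X := id) aemeasurable_id
  rw [variance_id_gaussianReal] at h2
  simp only [id, integral_id_gaussianReal, sub_zero, NNReal.coe_one] at h2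
  simp only [← sq]
  rw [← this, ← h2]

/-- The coordinates `g_q`, as elements of `L²`. -/
noncomputable def evalLp (q : Idx J₀) : Lp ℝ 2 (gaussSeq J₀) :=
  (memLp_gaussSeq q).toLp (fun g : Idx J₀ → ℝ => g q)

theorem evalLp_ae_eq (q : Idx J₀) : evalLp q =ᵐ[gaussSeq J₀] fun g => g q := MemLp.coeFn_toLp _

theorem inner_evalLp (p q : Idx J₀) :
    inner ℝ (evalLp p) (evalLp q) = ∫ g, g q * g p ∂(gaussSeq J₀) := by
  rw [L2.inner_def]
  refine integral_congr_ae ?_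
  filter_upwards [evalLp_ae_eq p, evalLp_ae_eq q] with g hp hq
  simp [hp, hq]

theorem orthonormal_evalLp : Orthonormal ℝ (evalLp : Idx J₀ → Lp ℝ 2 (gaussSeq J₀)) := by
  classical
  rw [orthonormal_iff_ite]
  intro p q
  rw [inner_evalLp]
  split_ifs with h
  · subst h; exact integral_eval_sq_gaussSeq p
  · rw [(iIndepFun_gaussSeq.indepFun (Ne.symm h)).integral_fun_mul_eq_mul_integral
      (measurable_pi_apply _).aestronglyMeasurable (measurable_pi_apply _).aestronglyMeasurable,
      integral_eval_gaussSeq, zero_mul]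

/-- The isonormal process as a linear isometry from `ℓ²`. -/
noncomputable def isonormalIsometry (J₀ : ℕ) : SeqL2 J₀ →ₗᵢ[ℝ] Lp ℝ 2 (gaussSeq J₀) :=
  (orthonormal_evalLp (J₀ := J₀)).orthogonalFamily.linearIsometry

theorem isonormalIsometry_apply (a : SeqL2 J₀) : isonormalIsometry J₀ a = isonormal a := rfl

theorem hasSum_isonormal (a : SeqL2 J₀) :
    HasSum (fun q => a q • evalLp q) (isonormal (a : Idx J₀ → ℝ)) :=
  (orthonormal_evalLp (J₀ := J₀)).orthogonalFamily.hasSum_linearIsometry a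

theorem sum_smul_evalLp_ae_eq (a : Idx J₀ → ℝ) (F : Finset (Idx J₀)) :
    (↑(∑ q ∈ F, a q • evalLp q : Lp ℝ 2 (gaussSeq J₀)) : (Idx J₀ → ℝ) → ℝ)
      =ᵐ[gaussSeq J₀] fun g => ∑ q ∈ F, a q * g q := by
  have h : ∀ᵐ g ∂(gaussSeq J₀), ∀ q, evalLp q g = g q := ae_all_iff.2 evalLp_ae_eq
  have h' : ∀ᵐ g ∂(gaussSeq J₀), ∀ q, (a q • evalLp q : Lp ℝ 2 (gaussSeq J₀)) g
      = a q * evalLp q g := ae_all_iff.2 fun q => by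
    filter_upwards [Lp.coeFn_smul (a q) (evalLp q)] with g hg
    simp [hg]
  filter_upwards [h, h', Lp.coeFn_finsetSum F fun q => a q • evalLp q] with g h1 h2 h3
  rw [h3, Finset.sum_apply]
  exact Finset.sum_congr rfl fun q _ => by rw [h2, h1]

/-- Convergence in `L²` along finite sets implies convergence in measure, hence almost sure
convergence along a sequence. This gives pathwise access to an object defined only as an `L²` limit.
-/
theorem exists_seq_tendsto_isonormal (a : SeqL2 J₀) : ∃ F : ℕ → Finset (Idx J₀),
    Tendsto F atTop atTop ∧ ∀ᵐ g ∂(gaussSeq J₀),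
      Tendsto (fun n => ∑ q ∈ F n, a q * g q) atTop (𝓝 (isonormal (a : Idx J₀ → ℝ) g)) := by
  have h := tendstoInMeasure_of_tendsto_Lp (hasSum_isonormal a)
  obtain ⟨F, hF, hlim⟩ := h.exists_seq_tendsto_ae'
  refine ⟨F, hF, ?_⟩
  filter_upwards [hlim, ae_all_iff.2 fun n => sum_smul_evalLp_ae_eq (a : Idx J₀ → ℝ) (F n)]
    with g h1 h2
  simpa only [h2] using h1

theorem charFun_map_sum_gaussSeq (a : Idx J₀ → ℝ) (F : Finset (Idx J₀)) (t : ℝ) :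
    charFun ((gaussSeq J₀).map fun g => ∑ q ∈ F, a q * g q) t
      = Complex.exp (-((∑ q ∈ F, a q ^ 2 : ℝ) * t ^ 2 / 2)) := by
  have hind : iIndepFun (fun (q : F) (g : Idx J₀ → ℝ) => a q * g q) (gaussSeq J₀) :=
    (iIndepFun_gaussSeq.comp (fun q x => a q * x) fun q => by fun_prop).precomp
      Subtype.val_injective
  have hme : ∀ q : F, AEMeasurable (fun g : Idx J₀ → ℝ => a q * g q) (gaussSeq J₀) := fun q =>
    have h : Measurable fun g : Idx J₀ → ℝ => g q.1 := measurable_pi_apply q.1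
    (h.const_mul (a q.1)).aemeasurable
  have h1 : (fun g : Idx J₀ → ℝ => ∑ q ∈ F, a q * g q) =
      fun g => ∑ q : F, a q * g q := by
    funext g; rw [Finset.sum_coe_sort F fun q => a q * g q]
  rw [h1, hind.charFun_map_fun_sum_eq_prod hme, Finset.prod_apply]
  have h2 : ∀ q : F, charFun ((gaussSeq J₀).map fun g => a q * g q) t =
      Complex.exp (-((a q ^ 2 : ℝ) * t ^ 2 / 2)) := by
    intro q
    have h3 := Measure.map_map (μ := gaussSeq J₀) (measurable_const_mul (a q))
      (measurable_pi_apply (q : Idx J₀))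
    rw [Function.comp_def] at h3
    rw [← h3]
    change charFun (((gaussSeq J₀).map fun g => g q).map _) t = _
    rw [gaussSeq_map_eval, gaussianReal_map_const_mul,
      charFun_gaussianReal]
    congr 1
    push_cast
    simp
  simp_rw [h2]
  rw [← Complex.exp_sum, Finset.sum_neg_distrib, Finset.sum_coe_sort F fun q =>
    (((a q ^ 2 : ℝ) : ℂ) * t ^ 2 / 2), ← Finset.sum_div, ← Finset.sum_mul]
  push_cast
  rfl

/-- The characteristic functions of the finite partial sums are explicit; dominated convergence
passes to the limit on both sides. -/
theorem map_isonormal (a : SeqL2 J₀) :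
    (gaussSeq J₀).map (isonormal (a : Idx J₀ → ℝ)) = gaussianReal 0 (‖a‖₊ ^ 2) := by
  have hm : ∀ a : Idx J₀ → ℝ, Measurable (isonormal a) := fun a =>
    (Lp.stronglyMeasurable _).measurable
  have := Measure.isProbabilityMeasure_map (μ := gaussSeq J₀) (hm a).aemeasurable
  refine Measure.ext_of_charFun ?_
  funext t
  obtain ⟨F, hF, hlim⟩ := exists_seq_tendsto_isonormal a
  have h1 : Tendsto (fun n => charFun ((gaussSeq J₀).map fun g => ∑ q ∈ F n, a q * g q) t) atTop
      (𝓝 (charFun ((gaussSeq J₀).map (isonormal (a : Idx J₀ → ℝ))) t)) := by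
    have hmm : ∀ n, AEMeasurable (fun g : Idx J₀ → ℝ => ∑ q ∈ F n, a q * g q) (gaussSeq J₀) :=
      fun n => (Finset.measurable_fun_sum _ fun q _ =>
        (measurable_pi_apply q).const_mul _).aemeasurable
    simp_rw [charFun_apply_real]
    rw [integral_map (hm a).aemeasurable (by fun_prop)]
    simp_rw [fun n => integral_map (μ := gaussSeq J₀) (hmm n)
      (f := fun x : ℝ => Complex.exp (t * x * Complex.I)) (by fun_prop)]
    refine tendsto_integral_of_dominated_convergence (fun _ => 1) (fun n => ?_)
      (integrable_const _) (fun n => Eventually.of_forall fun g => ?_) ?_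
    · have hc : Measurable fun x : ℝ => Complex.exp (t * x * Complex.I) := by fun_prop
      exact (hc.comp_aemeasurable (hmm n)).aestronglyMeasurable
    · rw [← Complex.ofReal_mul, Complex.norm_exp_ofReal_mul_I]
    · filter_upwards [hlim] with g hg
      have hc : Continuous fun x : ℝ => Complex.exp (t * x * Complex.I) := by fun_prop
      exact (hc.tendsto _).comp hg
  refine tendsto_nhds_unique h1 ?_
  simp_rw [charFun_map_sum_gaussSeq]
  have h2 : HasSum (fun q => a q ^ 2) (‖a‖ ^ 2) := by
    have := lp.hasSum_norm (p := 2) (by norm_num) a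
    simpa using this
  have h3 : Tendsto (fun n => ∑ q ∈ F n, a q ^ 2) atTop (𝓝 (‖a‖ ^ 2)) := h2.comp hF
  rw [charFun_gaussianReal]
  have hc : Continuous fun x : ℝ => Complex.exp (-((x : ℂ) * t ^ 2 / 2)) := by fun_prop
  have h4 : Complex.exp (t * (0 : ℝ) * Complex.I - ((‖a‖₊ ^ 2 : NNReal) : ℝ) * t ^ 2 / 2) =
      Complex.exp (-(((‖a‖ ^ 2 : ℝ) : ℂ) * t ^ 2 / 2)) := by
    congr 1
    simp
  rw [h4]
  exact (hc.tendsto _).comp h3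

/-- Translation of a sequence in the direction of one coordinate. -/
noncomputable def shiftSeq (q : Idx J₀) (s : ℝ) (g : Idx J₀ → ℝ) : Idx J₀ → ℝ :=
  open Classical in g + Pi.single q s

theorem measurable_shiftSeq (q : Idx J₀) (s : ℝ) : Measurable (shiftSeq q s) := by
  unfold shiftSeq; fun_prop

theorem measurable_update_prod [DecidableEq (Idx J₀)] (q : Idx J₀) :
    Measurable fun z : ℝ × (Idx J₀ → ℝ) => Function.update z.2 q z.1 := by
  refine measurable_pi_lambda _ fun p => ?_
  by_cases h : p = q
  · subst h; simpa using measurable_fst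
  · simp only [Function.update_of_ne h]
    exact (measurable_pi_apply p).comp measurable_snd

/-- Resampling one coordinate independently does not change an i.i.d. law. This isolates coordinate
`q` as a product factor. -/
theorem gaussSeq_eq_map_update [DecidableEq (Idx J₀)] (q : Idx J₀) :
    gaussSeq J₀ = ((gaussianReal 0 1).prod (gaussSeq J₀)).map
      fun z => Function.update z.2 q z.1 := by
  symm
  refine Measure.eq_infinitePi _ fun s t ht => ?_
  have hm := measurable_update_prod q
  rw [Measure.map_apply hm (MeasurableSet.pi s.countable_toSet fun i _ => ht i)]
  have h1 : (fun z : ℝ × (Idx J₀ → ℝ) => Function.update z.2 q z.1) ⁻¹' (Set.pi s t) =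
      (if q ∈ s then t q else univ) ×ˢ (Set.pi (s.erase q) t) := by
    ext ⟨x, g⟩
    simp only [mem_preimage, Set.mem_pi, Finset.mem_coe, mem_prod, Finset.mem_erase]
    constructor
    · intro h
      refine ⟨?_, fun p hp => by simpa [Function.update_of_ne hp.1] using h p hp.2⟩
      split_ifs with hq
      · simpa using h q hq
      · trivial
    · rintro ⟨h1, h2⟩ p hp
      by_cases hpq : p = q
      · subst hpq; simpa [hp] using h1
      · simpa [Function.update_of_ne hpq] using h2 p ⟨hpq, hp⟩
  rw [h1, Measure.prod_prod, gaussSeq, Measure.infinitePi_pi _ fun i _ => ht i]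
  split_ifs with hq
  · rw [Finset.mul_prod_erase s (fun i => gaussianReal 0 1 (t i)) hq]
  · rw [Finset.erase_eq_of_notMem hq]; simp

/-- Cameron–Martin in a single coordinate: only null sets matter, and `N(s, 1)` and `N(0, 1)` are
both equivalent to Lebesgue measure. -/
theorem quasiMeasurePreserving_shiftSeq (q : Idx J₀) (s : ℝ) :
    Measure.QuasiMeasurePreserving (shiftSeq q s) (gaussSeq J₀) (gaussSeq J₀) := by
  classical
  refine ⟨measurable_shiftSeq q s, ?_⟩
  have hm := measurable_update_prod q
  conv_lhs => rw [gaussSeq_eq_map_update q]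
  conv_rhs => rw [gaussSeq_eq_map_update q]
  rw [Measure.map_map (measurable_shiftSeq q s) hm]
  have hcomp : (shiftSeq q s ∘ fun z : ℝ × (Idx J₀ → ℝ) => Function.update z.2 q z.1) =
      (fun z : ℝ × (Idx J₀ → ℝ) => Function.update z.2 q z.1) ∘ Prod.map (· + s) id := by
    funext z
    funext p
    by_cases h : p = q
    · subst h; simp [shiftSeq]
    · simp [shiftSeq, h]
  rw [hcomp, ← Measure.map_map hm (by fun_prop), ← Measure.map_prod_map _ _ (by fun_prop)
    measurable_id, gaussianReal_map_add_const, Measure.map_id]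
  refine Measure.AbsolutelyContinuous.map ?_ hm
  exact ((gaussianReal_absolutelyContinuous _ one_ne_zero).trans
    (gaussianReal_absolutelyContinuous' _ one_ne_zero)).prod Measure.AbsolutelyContinuous.rfl

/-- The almost sure convergence of the partial sums also holds at the shifted sequence, since the
shift preserves null sets. Once `F n` contains `q`, the partial sums differ by exactly `s * a q`. -/
theorem isonormal_shiftSeq (a : SeqL2 J₀) (q : Idx J₀) (s : ℝ) :
    ∀ᵐ g ∂(gaussSeq J₀), isonormal (a : Idx J₀ → ℝ) (shiftSeq q s g)
      = isonormal (a : Idx J₀ → ℝ) g + s * a q := by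
  classical
  obtain ⟨F, hF, hlim⟩ := exists_seq_tendsto_isonormal a
  filter_upwards [hlim, (quasiMeasurePreserving_shiftSeq q s).ae hlim] with g h1 h2
  refine tendsto_nhds_unique h2 ((h1.add_const (s * a q)).congr' ?_)
  filter_upwards [hF.eventually_ge_atTop {q}] with n hn
  have hq : q ∈ F n := hn (Finset.mem_singleton_self q)
  simp only [shiftSeq, Pi.add_apply, mul_add, Finset.sum_add_distrib, add_right_inj]
  rw [Finset.sum_eq_single_of_mem q hq fun p _ hp => by simp [hp]]
  simp [mul_comm]

end

/-! ### Gaussian laws on `𝓜₀(w)`: existence, quasi-invariance, degenerate times -/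

section

variable {J₀ : ℕ} {w : AdmissibleWeight J₀}

theorem tendsto_level (J₀ : ℕ) : Tendsto (level J₀) atTop atTop := by
  unfold level
  exact tendsto_atTop_add_const_left _ _ tendsto_natCast_atTop_atTop

theorem AdmissibleWeight.eventually_mul_level_le_sq (w : AdmissibleWeight J₀) {K : ℝ}
    (hK : 0 ≤ K) : ∀ᶠ i : ℕ in atTop, K * (level J₀ i : ℝ) ≤ w.at i ^ 2 := by
  have h1 := (w.ratio_tendsto.comp (tendsto_level J₀)).eventually_ge_atTop (√K)
  filter_upwards [h1, (tendsto_level J₀).eventually_ge_atTop 1] with i h2 h3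
  have h4 : (0 : ℝ) < level J₀ i := by exact_mod_cast lt_of_lt_of_le zero_lt_one h3
  simp only [Function.comp_apply] at h2
  rw [le_div_iff₀ (Real.sqrt_pos.2 h4), ← Real.sqrt_mul hK] at h2
  rw [← Real.sq_sqrt (mul_nonneg hK h4.le)]
  exact pow_le_pow_left₀ (Real.sqrt_nonneg _) h2 2

theorem AdmissibleWeight.tendsto_at (w : AdmissibleWeight J₀) : Tendsto w.at atTop atTop := by
  refine tendsto_atTop.2 fun b => ?_
  filter_upwards [w.eventually_mul_level_le_sq (sq_nonneg b),
    (tendsto_level J₀).eventually_ge_atTop 1] with i h1 h2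
  have h3 : (1 : ℝ) ≤ level J₀ i := by exact_mod_cast h2
  exact abs_le_of_sq_le_sq' (by nlinarith [sq_nonneg b]) (w.at_pos i).le |>.2

theorem measurable_isonormal (a : Idx J₀ → ℝ) : Measurable (isonormal a) :=
  (Lp.stronglyMeasurable _).measurable

theorem measurable_isonormal_family (a : Idx J₀ → SeqL2 J₀) :
    Measurable fun (g : Idx J₀ → ℝ) (p : Idx J₀) => isonormal (a p : Idx J₀ → ℝ) g :=
  measurable_pi_lambda _ fun _ => measurable_isonormal _

theorem hasSubgaussianMGF_isonormal {a : SeqL2 J₀} {D : NNReal} (h : ‖a‖₊ ≤ D) :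
    HasSubgaussianMGF (isonormal (a : Idx J₀ → ℝ)) (D ^ 2) (gaussSeq J₀) where
  integrable_exp_mul t := by
    have h1 : Integrable (fun x : ℝ => Real.exp (t * x))
        ((gaussSeq J₀).map (isonormal (a : Idx J₀ → ℝ))) := by
      rw [map_isonormal]; exact integrable_exp_mul_gaussianReal t
    exact h1.comp_measurable (measurable_isonormal _)
  mgf_le t := by
    rw [mgf_gaussianReal (map_isonormal a)]
    refine Real.exp_le_exp.2 ?_
    have h2 : ((‖a‖₊ ^ 2 : NNReal) : ℝ) ≤ ((D ^ 2 : NNReal) : ℝ) := by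
      exact_mod_cast pow_le_pow_left₀ zero_le h 2
    have := mul_le_mul_of_nonneg_right h2 (sq_nonneg t)
    linarith

theorem measure_le_abs_isonormal_le {a : SeqL2 J₀} {D : NNReal} (h : ‖a‖₊ ≤ D) {r : ℝ}
    (hr : 0 ≤ r) : gaussSeq J₀ {g | r ≤ |isonormal (a : Idx J₀ → ℝ) g|}
      ≤ ENNReal.ofReal (2 * Real.exp (-r ^ 2 / (2 * D ^ 2))) := by
  have h1 := (hasSubgaussianMGF_isonormal h).measure_ge_le hr
  have h2 := (hasSubgaussianMGF_isonormal h).neg.measure_ge_le hr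
  have h3 : {g | r ≤ |isonormal (a : Idx J₀ → ℝ) g|} ⊆
      {g | r ≤ isonormal (a : Idx J₀ → ℝ) g} ∪ {g | r ≤ -isonormal (a : Idx J₀ → ℝ) g} := by
    intro g hg
    have hg' : r ≤ |isonormal (a : Idx J₀ → ℝ) g| := hg
    exact (le_abs.1 hg').imp id id
  rw [← ofReal_measureReal]
  refine ENNReal.ofReal_le_ofReal ?_
  refine (measureReal_mono h3).trans ((measureReal_union_le _ _).trans ?_)
  simp only [Pi.neg_apply, NNReal.coe_pow] at h1 h2
  linarith

theorem tendsto_levelMax_of_finite {x : Idx J₀ → ℝ}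
    (h : ∀ m : ℕ, {p : Idx J₀ | 1 / ((m : ℝ) + 1) * w.at p.1 ≤ |x p|}.Finite) :
    Tendsto (levelMax w x) atTop (𝓝 0) := by
  rw [Metric.tendsto_atTop]
  intro ε hε
  obtain ⟨m, hm⟩ := exists_nat_one_div_lt hε
  obtain ⟨N, hN⟩ := ((h m).image Sigma.fst).bddAbove
  refine ⟨N + 1, fun i hi => ?_⟩
  rw [Real.dist_eq, sub_zero, abs_of_nonneg (levelMax_nonneg w _ i)]
  refine lt_of_le_of_lt (ciSup_le fun k => ?_) hm
  rw [div_le_iff₀ (w.at_pos i)]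
  by_contra hcon
  have : i ≤ N := hN ⟨⟨i, k⟩, (not_le.1 hcon).le, rfl⟩
  omega

/-- Because `w_l² / l → ∞`, the Gaussian tail at `ε w_l` is eventually below `2 · 2^{-2l}`, which
beats the `2^l` coordinates of level `l`. -/
theorem tsum_measure_isonormal_ne_top (w : AdmissibleWeight J₀) {a : Idx J₀ → SeqL2 J₀}
    {D : NNReal} (hD : 0 < D) (ha : ∀ p, ‖a p‖₊ ≤ D) {ε : ℝ} (hε : 0 < ε) :
    ∑' p : Idx J₀, gaussSeq J₀ {g | ε * w.at p.1 ≤ |isonormal (a p : Idx J₀ → ℝ) g|} ≠ ⊤ := by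
  have hD' : (0 : ℝ) < D := hD
  set b : ℕ → ℝ := fun i => 2 * Real.exp (-(ε * w.at i) ^ 2 / (2 * D ^ 2)) with hb
  have hb0 : ∀ i, 0 ≤ b i := fun i => by positivity
  have hsum : Summable fun i => (levelCard J₀ i : ℝ) * b i := by
    have hgeo : Summable fun i : ℕ => 4 * (1 / 2 : ℝ) ^ i := summable_geometric_two.mul_left 4
    refine hgeo.of_norm_bounded_eventually_nat ?_
    -- This `K` turns `exp(-(ε w_l)² / (2D²))` into at most `exp(-2 l log 2)`.
    filter_upwards [w.eventually_mul_level_le_sq (K := 4 * D ^ 2 * Real.log 2 / ε ^ 2)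
      (by positivity), eventually_ge_atTop 1] with i h1 hi
    obtain ⟨i, rfl⟩ : ∃ j, i = j + 1 := ⟨i - 1, by omega⟩
    rw [Real.norm_of_nonneg (mul_nonneg (Nat.cast_nonneg _) (hb0 _))]
    have hl : (level J₀ (i + 1) : ℝ) = ((J₀ + i : ℕ) : ℝ) := by simp [level]
    rw [hl] at h1
    have h2 : -(ε * w.at (i + 1)) ^ 2 / (2 * D ^ 2) ≤ -(2 * ((J₀ + i : ℕ) : ℝ)) * Real.log 2 := by
      rw [div_le_iff₀ (by positivity)]
      rw [div_mul_eq_mul_div, div_le_iff₀ (by positivity)] at h1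
      nlinarith
    have h3 : Real.exp (-(ε * w.at (i + 1)) ^ 2 / (2 * D ^ 2))
        ≤ ((1 / 2 : ℝ) ^ (J₀ + i)) ^ 2 := by
      refine (Real.exp_le_exp.2 h2).trans_eq ?_
      rw [← pow_mul, one_div, inv_pow, ← Real.rpow_natCast, ← Real.rpow_neg two_pos.le,
        Real.rpow_def_of_pos two_pos]
      congr 1
      push_cast; ring
    have h4 : ((levelCard J₀ (i + 1) : ℕ) : ℝ) * (1 / 2 : ℝ) ^ (J₀ + i) = 1 := by
      simp [levelCard]
    calc (levelCard J₀ (i + 1) : ℝ) * b (i + 1)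
        ≤ (levelCard J₀ (i + 1) : ℝ) * (2 * ((1 / 2 : ℝ) ^ (J₀ + i)) ^ 2) := by
          refine mul_le_mul_of_nonneg_left ?_ (Nat.cast_nonneg _)
          exact mul_le_mul_of_nonneg_left h3 two_pos.le
      _ = 2 * ((levelCard J₀ (i + 1) : ℝ) * (1 / 2 : ℝ) ^ (J₀ + i)) * (1 / 2 : ℝ) ^ (J₀ + i) := by
          ring
      _ = 2 * (1 / 2 : ℝ) ^ (J₀ + i) := by rw [h4, mul_one]
      _ ≤ 2 * (1 / 2 : ℝ) ^ i := by
          refine mul_le_mul_of_nonneg_left ?_ two_pos.le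
          exact pow_le_pow_of_le_one (by norm_num) (by norm_num) (by omega)
      _ = 4 * (1 / 2 : ℝ) ^ (i + 1) := by rw [pow_succ]; ring
  rw [ENNReal.tsum_sigma']
  refine ne_top_of_le_ne_top hsum.tsum_ofReal_ne_top (ENNReal.tsum_le_tsum fun i => ?_)
  calc ∑' k : Fin (levelCard J₀ i),
        gaussSeq J₀ {g | ε * w.at i ≤ |isonormal (a ⟨i, k⟩ : Idx J₀ → ℝ) g|}
      ≤ ∑' _k : Fin (levelCard J₀ i), ENNReal.ofReal (b i) :=
        ENNReal.tsum_le_tsum fun k =>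
          measure_le_abs_isonormal_le (ha _) (mul_nonneg hε.le (w.at_pos i).le)
    _ = ENNReal.ofReal ((levelCard J₀ i : ℝ) * b i) := by
        rw [tsum_fintype, Finset.sum_const, Finset.card_univ, Fintype.card_fin, nsmul_eq_mul,
          ENNReal.ofReal_mul (Nat.cast_nonneg _), ENNReal.ofReal_natCast]

/-- Borel–Cantelli at the countably many thresholds `1 / (m + 1)`. Hence the Gaussian sequence lies
in `𝓜₀(w)` almost surely and `gaussLaw` loses no mass. -/
theorem ae_tendsto_levelMax_isonormal (w : AdmissibleWeight J₀) {a : Idx J₀ → SeqL2 J₀}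
    {D : NNReal} (ha : ∀ p, ‖a p‖₊ ≤ D) : ∀ᵐ g ∂(gaussSeq J₀),
      Tendsto (levelMax w fun p => isonormal (a p : Idx J₀ → ℝ) g) atTop (𝓝 0) := by
  have h : ∀ᵐ g ∂(gaussSeq J₀), ∀ m : ℕ,
      {p : Idx J₀ | 1 / ((m : ℝ) + 1) * w.at p.1 ≤ |isonormal (a p : Idx J₀ → ℝ) g|}.Finite :=
    ae_all_iff.2 fun m => ae_finite_setOfPred_mem (tsum_measure_isonormal_ne_top w (D := D + 1)
      (by positivity) (fun p => (ha p).trans (le_add_of_nonneg_right zero_le_one))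
      (by positivity))
  exact h.mono fun g hg => tendsto_levelMax_of_finite hg

/-- The law in `𝓜₀(w)` of the Gaussian sequence `(∑_q a_{pq} g_q)_p`. -/
noncomputable def gaussLaw (w : AdmissibleWeight J₀) (a : Idx J₀ → SeqL2 J₀) : Measure (MZero w) :=
  ((gaussSeq J₀).map fun g p => isonormal (a p : Idx J₀ → ℝ) g).comap MZero.coord

section

variable {a : Idx J₀ → SeqL2 J₀} {D : NNReal}

theorem map_coord_gaussLaw (ha : ∀ p, ‖a p‖₊ ≤ D) :
    (gaussLaw w a).map MZero.coord
      = (gaussSeq J₀).map fun g p => isonormal (a p : Idx J₀ → ℝ) g := by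
  rw [gaussLaw, MZero.measurableEmbedding_coord.map_comap, Measure.restrict_eq_self_of_ae_mem]
  rw [MZero.range_coord]
  refine (ae_map_iff (measurable_isonormal_family a).aemeasurable ?_).2
    (ae_tendsto_levelMax_isonormal w ha)
  rw [← MZero.range_coord]
  exact MZero.measurableSet_range_coord

theorem isProbabilityMeasure_gaussLaw (ha : ∀ p, ‖a p‖₊ ≤ D) :
    IsProbabilityMeasure (gaussLaw w a) := by
  have h := Measure.isProbabilityMeasure_map (μ := gaussSeq J₀)
    (measurable_isonormal_family a).aemeasurable
  rw [← map_coord_gaussLaw (w := w) ha] at h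
  exact (Measure.isProbabilityMeasure_map_iff MZero.measurable_coord.aemeasurable).1 h

theorem ae_gaussLaw {S : Set (MZero w)} (hS : MeasurableSet S)
    (h : ∀ᵐ g ∂(gaussSeq J₀), ∀ x : MZero w,
      (x.coord = fun p => isonormal (a p : Idx J₀ → ℝ) g) → x ∈ S) :
    ∀ᵐ x ∂(gaussLaw w a), x ∈ S := by
  have hm := MZero.measurableEmbedding_coord.measurableSet_image' hS.compl
  rw [ae_iff]
  change gaussLaw w a Sᶜ = 0
  rw [gaussLaw, MZero.measurableEmbedding_coord.comap_apply,
    Measure.map_apply (measurable_isonormal_family a) hm]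
  refine measure_eq_zero_iff_ae_notMem.2 (h.mono fun g hcon hg => ?_)
  obtain ⟨x, hx, hxg⟩ := hg
  exact hx (hcon x hxg)

/-- The direction `(a_{pq})_p` in `𝓜₀(w)` in which a shift of `g_q` moves the sequence
`(∑_q a_{pq} g_q)_p`. -/
noncomputable def gaussDirection (w : AdmissibleWeight J₀) (ha : ∀ p, ‖a p‖₊ ≤ D) (q : Idx J₀) :
    MZero w :=
  MZero.ofSeq (fun p => a p q) <| by
    -- The coordinates are bounded by `D` and `w_l → ∞`, so a bounded sequence belongs to `𝓜₀(w)`.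
    refine squeeze_zero (levelMax_nonneg w _) (fun i => ciSup_le fun k => ?_)
      (tendsto_const_nhds.div_atTop w.tendsto_at : Tendsto (fun i => (D : ℝ) / w.at i) _ _)
    refine div_le_div_of_nonneg_right ?_ (w.at_pos i).le
    exact (lp.norm_apply_le_norm (by simp) (a ⟨i, k⟩) q).trans (ha ⟨i, k⟩)

@[simp] theorem coord_gaussDirection (ha : ∀ p, ‖a p‖₊ ≤ D) (q p : Idx J₀) :
    (gaussDirection w ha q).coord p = a p q := rfl

/-- Translating `x` by `s` times the direction is the same as shifting `g_q` by `s`, simultaneously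
in all countably many coordinates; null sets are then pulled back through the shift of `g`. -/
theorem quasiMeasurePreserving_gaussLaw (ha : ∀ p, ‖a p‖₊ ≤ D) (q : Idx J₀) (s : ℝ) :
    Measure.QuasiMeasurePreserving (fun x : MZero w => x + s • gaussDirection w ha q)
      (gaussLaw w a) (gaussLaw w a) := by
  have hmeas : Measurable fun x : MZero w => x + s • gaussDirection w ha q :=
    (continuous_add_const _).measurable
  refine ⟨hmeas, ?_⟩
  refine Measure.AbsolutelyContinuous.mk fun E hE hE0 => ?_
  rw [Measure.map_apply hmeas hE]
  have hmE := MZero.measurableEmbedding_coord.measurableSet_image' hE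
  rw [gaussLaw, MZero.measurableEmbedding_coord.comap_apply,
    Measure.map_apply (measurable_isonormal_family a) hmE] at hE0
  have h1 := (quasiMeasurePreserving_shiftSeq q s).preimage_null hE0
  have h2 : ∀ᵐ g ∂(gaussSeq J₀), ∀ p, isonormal (a p : Idx J₀ → ℝ) (shiftSeq q s g)
      = isonormal (a p : Idx J₀ → ℝ) g + s * a p q :=
    ae_all_iff.2 fun p => isonormal_shiftSeq (a p) q s
  have key : ∀ᵐ x ∂(gaussLaw w a), x ∈ ((fun x : MZero w => x + s • gaussDirection w ha q) ⁻¹' E)ᶜ := by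
    refine ae_gaussLaw (hmeas hE).compl ?_
    filter_upwards [h2, measure_eq_zero_iff_ae_notMem.1 h1] with g hg hgE x hx hxE
    refine hgE ⟨_, hxE, ?_⟩
    funext p
    simp only [MZero.coord_add, MZero.coord_smul, coord_gaussDirection, hg p, hx]
  exact measure_eq_zero_iff_ae_notMem.2 key

theorem map_sum_coord_gaussLaw (ha : ∀ p, ‖a p‖₊ ≤ D) (F : Finset (Idx J₀)) (u : Idx J₀ → ℝ) :
    (gaussLaw w a).map (fun x => ∑ p ∈ F, u p * x.coord p)
      = gaussianReal 0 (‖∑ p ∈ F, u p • a p‖₊ ^ 2) := by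
  have hm : Measurable fun y : Idx J₀ → ℝ => ∑ p ∈ F, u p * y p :=
    Finset.measurable_fun_sum _ fun p _ => (measurable_pi_apply p).const_mul _
  have h1 := Measure.map_map (μ := gaussLaw w a) hm MZero.measurable_coord
  rw [map_coord_gaussLaw ha, Measure.map_map hm (measurable_isonormal_family a)] at h1
  rw [Function.comp_def, Function.comp_def] at h1
  rw [← h1, ← map_isonormal]
  refine Measure.map_congr ?_
  have h2 : isonormal ((∑ p ∈ F, u p • a p : SeqL2 J₀) : Idx J₀ → ℝ)
      = ∑ p ∈ F, u p • isonormal (a p : Idx J₀ → ℝ) := by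
    rw [← isonormalIsometry_apply, map_sum]
    simp only [map_smul, isonormalIsometry_apply]
  rw [h2]
  have h3 : ∀ᵐ g ∂(gaussSeq J₀), ∀ p, (u p • isonormal (a p : Idx J₀ → ℝ) : Lp ℝ 2 _) g
      = u p * isonormal (a p : Idx J₀ → ℝ) g := ae_all_iff.2 fun p => by
    filter_upwards [Lp.coeFn_smul (u p) (isonormal (a p : Idx J₀ → ℝ))] with g hg
    simp [hg]
  filter_upwards [h3, Lp.coeFn_finsetSum F fun p => u p • isonormal (a p : Idx J₀ → ℝ)]
    with g h4 h5
  rw [h5, Finset.sum_apply]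
  exact Finset.sum_congr rfl fun p _ => (h4 p).symm

end

namespace WaveletBasis

variable (B : WaveletBasis J₀) (hw : Summable fun i : ℕ => w.at i * levelRate J₀ i)
  {a : Idx J₀ → SeqL2 J₀} {D : NNReal}

theorem measurable_primitiveMap (hw : Summable fun i : ℕ => w.at i * levelRate J₀ i)
    {t : ℝ} (ht : t ∈ Icc (0 : ℝ) 1) : Measurable fun x : MZero w => B.primitiveMap x t :=
  ((continuous_eval_const (⟨t, ht⟩ : Icc (0 : ℝ) 1)).comp
    (B.primitiveCLM hw).continuous).measurable

/-- If no shift of the coordinates moves the value at `t` of the primitive, it vanishes. -/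
theorem ae_primitiveMap_eq_zero (hw : Summable fun i : ℕ => w.at i * levelRate J₀ i)
    (ha : ∀ p, ‖a p‖₊ ≤ D) {t : ℝ} (ht : t ∈ Icc (0 : ℝ) 1)
    (h0 : ∀ q, B.primitiveMap (gaussDirection w ha q) t = 0) :
    ∀ᵐ x ∂(gaussLaw w a), B.primitiveMap x t = 0 := by
  -- The series converges absolutely in `ℓ²`: the constant sequence `D` is dominated by `D * w`,
  -- since `w ≥ 1`.
  have hsum : Summable fun p => B.waveletPrimitive p t • a p := by
    refine Summable.of_norm_bounded ((B.summable_waveletPrimitive hw (x := fun _ => (D : ℝ))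
      D.coe_nonneg (fun p => ?_) ht).abs) fun p => ?_
    · rw [abs_of_nonneg D.coe_nonneg]
      exact le_mul_of_one_le_right D.coe_nonneg (w.one_le_at _)
    · rw [norm_smul, abs_mul, mul_comm, abs_of_nonneg D.coe_nonneg]
      exact mul_le_mul_of_nonneg_right (ha p) (abs_nonneg _)
  -- The `q`-th entry of this vector is the value at `t` of the primitive of the `q`-th direction,
  -- zero by `h0`. The value of the random primitive at `t` is the isonormal process at this vector.
  have hzero : ∑' p, B.waveletPrimitive p t • a p = 0 := by
    ext q
    have h1 := hsum.hasSum.map (lp.evalCLM ℝ (fun _ : Idx J₀ => ℝ) 2 q)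
      (lp.evalCLM ℝ (fun _ : Idx J₀ => ℝ) 2 q).continuous
    have h2 := h1.tsum_eq
    have h3 := h0 q
    simp only [primitiveMap, coord_gaussDirection] at h3
    rw [show ∑' p, (⇑(lp.evalCLM ℝ (fun _ : Idx J₀ => ℝ) 2 q) ∘
      fun p => B.waveletPrimitive p t • a p) p = ∑' p, a p q * ∫ x in (0 : ℝ)..t, B.ψ p x from
      tsum_congr fun p => mul_comm _ _, h3] at h2
    exact h2.symm
  have hI := hsum.hasSum.map (isonormalIsometry J₀) (isonormalIsometry J₀).continuous
  rw [hzero, map_zero] at hI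
  obtain ⟨F, hF, hlim⟩ := (tendstoInMeasure_of_tendsto_Lp hI).exists_seq_tendsto_ae'
  refine ae_gaussLaw (S := {x | B.primitiveMap x t = 0})
    (B.measurable_primitiveMap hw ht (measurableSet_singleton 0)) ?_
  have h3 : ∀ᵐ g ∂(gaussSeq J₀), ∀ p, (isonormalIsometry J₀ (B.waveletPrimitive p t • a p)) g
      = isonormal (a p : Idx J₀ → ℝ) g * B.waveletPrimitive p t := ae_all_iff.2 fun p => by
    rw [map_smul, isonormalIsometry_apply]
    filter_upwards [Lp.coeFn_smul (B.waveletPrimitive p t) (isonormal (a p : Idx J₀ → ℝ))]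
      with g hg
    simp [hg, mul_comm]
  filter_upwards [hlim, h3, ae_all_iff.2 fun n => Lp.coeFn_finsetSum (F n) fun p =>
    isonormalIsometry J₀ (B.waveletPrimitive p t • a p), Lp.coeFn_zero ℝ 2 (gaussSeq J₀)]
    with g h4 h5 h6 h7 x hx
  have h8 : Tendsto (fun n => ∑ p ∈ F n, x.coord p * B.waveletPrimitive p t) atTop
      (𝓝 (B.primitiveMap x t)) := (B.summable_coord_mul hw x ht).hasSum.comp hF
  refine tendsto_nhds_unique h8 ?_
  rw [h7] at h4
  refine h4.congr fun n => ?_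
  have h9 := h6 n
  simp only [Function.comp_apply]
  rw [h9, Finset.sum_apply]
  exact Finset.sum_congr rfl fun p _ => by rw [h5 p, hx]

end WaveletBasis

end

/-! ### No atoms and unique quantiles from quasi-invariant directions -/

section

section ShiftInvariance

variable {X : Type*} [NormedAddCommGroup X] [NormedSpace ℝ X]
  {T : Type*} [MetricSpace T] [CompactSpace T]

theorem continuous_eval_clm (L : X →L[ℝ] C(T, ℝ)) : Continuous fun z : T × X => L z.2 z.1 := by
  have h : Continuous fun z : T × X => ((L z.2 : C(T, ℝ)), z.1) :=
    (L.continuous.comp continuous_snd).prodMk continuous_fst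
  exact continuous_eval.comp h

variable [MeasurableSpace X] {N : Measure X}

theorem MeasureTheory.Measure.QuasiMeasurePreserving.shift_smul {h : X}
    (hq : ∀ s : ℝ, Measure.QuasiMeasurePreserving (fun x => x + s • h) N N) (c s : ℝ) :
    Measure.QuasiMeasurePreserving (fun x => x + s • (c • h)) N N := by
  simpa only [smul_smul] using hq (s * c)

/-- Along the line `x + s • h` the norm is continuous and unbounded, so starting below `b` it spends
an open set of `s` in `(a, b)`. If the event were null, almost every `x` would avoid it for all
rational `s`, which meet every such open set. -/
theorem measure_norm_mem_Ioo_pos (L : X →L[ℝ] C(T, ℝ)) {h : X}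
    (hq : ∀ s : ℝ, Measure.QuasiMeasurePreserving (fun x => x + s • h) N N) (hL : L h ≠ 0)
    {a b : ℝ} (hab : a < b) (hb : 0 < N {x | ‖L x‖ < b}) : 0 < N {x | ‖L x‖ ∈ Ioo a b} := by
  refine pos_iff_ne_zero.2 fun hS => hb.ne' ?_
  have h1 : ∀ᵐ x ∂N, ∀ s : ℚ, ‖L (x + (s : ℝ) • h)‖ ∉ Ioo a b :=
    ae_all_iff.2 fun s => (hq s).ae (measure_eq_zero_iff_ae_notMem.1 hS)
  refine measure_eq_zero_iff_ae_notMem.2 (h1.mono fun x hx hxb => ?_)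
  have hxb' : ‖L x‖ < b := hxb
  set φ : ℝ → ℝ := fun s => ‖L (x + s • h)‖ with hφ
  have hcont : Continuous φ := by
    have : Continuous fun s : ℝ => x + s • h := by fun_prop
    exact (L.continuous.comp this).norm
  have hopen : IsOpen (φ ⁻¹' Ioo a b) := isOpen_Ioo.preimage hcont
  have hφ0 : φ 0 = ‖L x‖ := by simp [hφ]
  have hne : (φ ⁻¹' Ioo a b).Nonempty := by
    by_cases hxa : a < ‖L x‖
    · exact ⟨0, by rw [mem_preimage, hφ0]; exact ⟨hxa, hxb'⟩⟩
    · have hpos : 0 < ‖L h‖ := norm_pos_iff.2 hL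
      have h3 : (a + b) / 2 ∈ range φ := by
        -- The second witness makes `s ‖L h‖ - ‖L x‖` equal to `|(a + b) / 2|`, a lower bound for
        -- the norm by the reverse triangle inequality.
        refine mem_range_of_exists_le_of_exists_ge hcont ⟨0, by rw [hφ0]; linarith⟩
          ⟨(|(a + b) / 2| + ‖L x‖) / ‖L h‖, ?_⟩
        have h4 := norm_sub_norm_le (((|(a + b) / 2| + ‖L x‖) / ‖L h‖) • L h) (-L x)
        rw [norm_smul, norm_neg, sub_neg_eq_add, Real.norm_of_nonneg (by positivity),
          div_mul_cancel₀ _ hpos.ne', add_sub_cancel_right] at h4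
        simp only [hφ, map_add, map_smul]
        rw [add_comm (L x)]
        exact (le_abs_self _).trans h4
      obtain ⟨s, hs⟩ := h3
      exact ⟨s, by rw [mem_preimage, hs]; constructor <;> linarith⟩
  obtain ⟨s, hs⟩ := Rat.isDenseEmbedding_coe_real.dense.exists_mem_open hopen hne
  exact hx s hs

variable [IsProbabilityMeasure N]

/-- A set that is left by every positive shift in a quasi-invariant direction is null. -/
theorem measure_eq_zero_of_shift_notMem {h : X}
    (hq : ∀ s : ℝ, Measure.QuasiMeasurePreserving (fun x => x + s • h) N N) {E : Set X}
    (hE : MeasurableSet E) (hs : ∀ x ∈ E, ∀ s : ℝ, 0 < s → x + s • h ∉ E) : N E = 0 := by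
  by_contra hne
  -- The translates `A s` are pairwise disjoint by `hs` and all of positive measure by
  -- quasi-invariance. A finite measure admits only countably many such sets, while `s` ranges over
  -- `ℝ`.
  set A : ℝ → Set X := fun s => (fun x => x + s • h) ⁻¹' E with hA
  have hpos : ∀ s, 0 < N (A s) := by
    intro s
    refine pos_iff_ne_zero.2 fun h0 => hne ?_
    have h1 := (hq (-s)).preimage_null h0
    have h2 : (fun x => x + (-s) • h) ⁻¹' (A s) = E := by
      ext x
      simp [hA]
    rwa [h2] at h1
  have hlt : ∀ s s' : ℝ, s < s' → Disjoint (A s) (A s') := by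
    intro s s' hss
    refine Set.disjoint_left.2 fun x hx hx' => ?_
    have hx1 : x + s • h ∈ E := hx
    have hx2 : x + s' • h ∈ E := hx'
    refine hs _ hx1 (s' - s) (sub_pos.2 hss) ?_
    have h3 : x + s • h + (s' - s) • h = x + s' • h := by
      rw [sub_smul]; abel
    rwa [h3]
  have hdisj : Pairwise (Function.onFun Disjoint A) := by
    intro s s' hss
    rcases lt_or_gt_of_ne hss with h1 | h1
    · exact hlt s s' h1
    · exact (hlt s' s h1).symm
  have hcount := Measure.countable_meas_pos_of_disjoint_iUnion (μ := N)
    (fun s => (hq s).measurable hE) hdisj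
  have huniv : {s : ℝ | 0 < N (A s)} = univ := eq_univ_of_forall hpos
  rw [huniv] at hcount
  exact not_countable_univ hcount

variable [BorelSpace X]

/-- A shift by `s > 0` raises the value at the maximiser `t` by at least `s * δ`, hence above `r`.
The uniform lower bound `δ` keeps the event closed, its second condition being a projection along
the compact space `T`. -/
theorem measure_max_attained_eq_zero (L : X →L[ℝ] C(T, ℝ)) {h : X}
    (hq : ∀ s : ℝ, Measure.QuasiMeasurePreserving (fun x => x + s • h) N N) {δ : ℝ} (hδ : 0 < δ)
    (r : ℝ) : N {x | (∀ t, L x t ≤ r) ∧ ∃ t, δ ≤ L h t ∧ L x t = r} = 0 := by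
  refine measure_eq_zero_of_shift_notMem hq ?_ ?_
  · refine (IsClosed.and ?_ ?_).measurableSet
    · have hall : {x : X | ∀ t, L x t ≤ r} = ⋂ t, {x | L x t ≤ r} := by ext; simp
      rw [hall]
      exact isClosed_iInter fun t => isClosed_le ((continuous_eval_clm L).comp (Continuous.prodMk_right t))
        continuous_const
    · have hc : IsClosed {z : T × X | δ ≤ L h z.1 ∧ L z.2 z.1 = r} :=
        (isClosed_le continuous_const ((L h).continuous.comp continuous_fst)).and
          (isClosed_eq (continuous_eval_clm L) continuous_const)
      have := isClosedMap_snd_of_compactSpace _ hc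
      convert this using 1
      ext x
      simp
  · rintro x ⟨-, t, ht, hxt⟩ s hs ⟨h1, -⟩
    have h2 := h1 t
    rw [map_add, map_smul, ContinuousMap.add_apply, ContinuousMap.smul_apply, hxt,
      smul_eq_mul] at h2
    have := mul_pos hs (lt_of_lt_of_le hδ ht)
    linarith

variable {ι : Type*} [Countable ι] {h : ι → X}

/-- The norm is attained at some `t` with `|L x t| = r > 0`. Almost surely `t` is not degenerate, so
some direction moves the value at `t`, and `x` lies in one of countably many null events of
`measure_max_attained_eq_zero`. -/
theorem measure_norm_eq_pos_eq_zero (L : X →L[ℝ] C(T, ℝ))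
    (hq : ∀ i, ∀ s : ℝ, Measure.QuasiMeasurePreserving (fun x => x + s • h i) N N)
    (h0 : ∀ t, (∀ i, L (h i) t = 0) → ∀ᵐ x ∂N, L x t = 0) {r : ℝ} (hr : 0 < r) :
    N {x | ‖L x‖ = r} = 0 := by
  -- The exceptional null set in `h0` depends on `t`; a countable dense set of degenerate times and
  -- continuity of `L x` make it uniform.
  have hT0 : ∀ᵐ x ∂N, ∀ t, (∀ i, L (h i) t = 0) → L x t = 0 := by
    obtain ⟨D, hDc, hDd⟩ := TopologicalSpace.exists_countable_dense
      {t : T // ∀ i, L (h i) t = 0}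
    have h1 : ∀ᵐ x ∂N, ∀ t ∈ D, L x t.1 = 0 :=
      (ae_ball_iff hDc).2 fun t _ => h0 t.1 t.2
    filter_upwards [h1] with x hx t ht
    have hcont : Continuous fun u : {t : T // ∀ i, L (h i) t = 0} => L x u.1 :=
      (L x).continuous.comp continuous_subtype_val
    exact congrFun (Continuous.ext_on hDd hcont continuous_const hx) ⟨t, ht⟩
  have hnull : ∀ᵐ x ∂N, ∀ (i : ι) (c d : ℤˣ) (m : ℕ),
      ¬ ((∀ t, ((c : ℤ) : ℝ) * L x t ≤ r) ∧
        ∃ t, 1 / ((m : ℝ) + 1) ≤ ((d : ℤ) : ℝ) * L (h i) t ∧ ((c : ℤ) : ℝ) * L x t = r) := by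
    refine ae_all_iff.2 fun i => ae_all_iff.2 fun c => ae_all_iff.2 fun d => ae_all_iff.2
      fun m => ?_
    -- The signs `c` and `d` are those of `L x t` and `L (h i) t`. With direction `(c d) h i` the
    -- operator `c L` takes the value `c² d L (h i) = d L (h i)`.
    have h1 := measure_max_attained_eq_zero (N := N) (((c : ℤ) : ℝ) • L)
      (h := ((c : ℤ) * (d : ℤ) : ℝ) • h i) (Measure.QuasiMeasurePreserving.shift_smul (hq i) _)
      (δ := 1 / ((m : ℝ) + 1)) (by positivity) r
    refine (measure_eq_zero_iff_ae_notMem.1 h1).mono fun x hx hcon => hx ⟨hcon.1, ?_⟩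
    obtain ⟨t, ht, hxt⟩ := hcon.2
    refine ⟨t, ht.trans_eq ?_, hxt⟩
    have hcc : ((c : ℤ) : ℝ) * ((c : ℤ) : ℝ) = 1 := by
      rcases Int.units_eq_one_or c with rfl | rfl <;> simp
    rw [_root_.smul_apply, map_smul, ContinuousMap.smul_apply,
      ContinuousMap.smul_apply, smul_eq_mul, smul_eq_mul, ← mul_assoc, ← mul_assoc, hcc, one_mul]
  refine measure_eq_zero_iff_ae_notMem.2 ?_
  filter_upwards [hT0, hnull] with x hx0 hx1 hxr
  have hxr' : ‖L x‖ = r := hxr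
  have hne : Nonempty T := by
    by_contra hcon
    rw [not_nonempty_iff] at hcon
    have : L x = 0 := ContinuousMap.ext fun t => hcon.elim t
    rw [this, norm_zero] at hxr'
    exact hr.ne hxr'
  obtain ⟨t, -, ht⟩ := isCompact_univ.exists_isMaxOn univ_nonempty
    (L x).continuous.norm.continuousOn
  have ht' : ‖L x t‖ = r := by
    refine le_antisymm (hxr' ▸ (L x).norm_coe_le_norm t) ?_
    rw [← hxr']
    exact (ContinuousMap.norm_le_of_nonempty _).2 fun u => ht (mem_univ u)
  have hle : ∀ u, |L x u| ≤ r := fun u => hxr' ▸ (L x).norm_coe_le_norm u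
  have hunit : ∀ y : ℝ, ∃ c : ℤˣ, ((c : ℤ) : ℝ) * y = |y| := fun y => by
    rcases abs_choice y with h | h
    · exact ⟨1, by simp [h]⟩
    · exact ⟨-1, by simp [h]⟩
  have hunit' : ∀ (c : ℤˣ) (y : ℝ), ((c : ℤ) : ℝ) * y ≤ |y| := fun c y => by
    rcases Int.units_eq_one_or c with rfl | rfl
    · simpa using le_abs_self y
    · simpa using neg_le_abs y
  obtain ⟨i, hi⟩ : ∃ i, L (h i) t ≠ 0 := by
    by_contra! hcon
    rw [hx0 t hcon, norm_zero] at ht'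
    exact hr.ne ht'
  obtain ⟨m, hm⟩ := exists_nat_one_div_lt (abs_pos.2 hi)
  obtain ⟨c, hc⟩ := hunit (L x t)
  obtain ⟨d, hd⟩ := hunit (L (h i) t)
  exact hx1 i c d m ⟨fun u => (hunit' c _).trans (hle u), t, hd ▸ hm.le, hc.trans ht'⟩

theorem measure_norm_eq_eq_zero (L : X →L[ℝ] C(T, ℝ))
    (hq : ∀ i, ∀ s : ℝ, Measure.QuasiMeasurePreserving (fun x => x + s • h i) N N)
    (h0 : ∀ t, (∀ i, L (h i) t = 0) → ∀ᵐ x ∂N, L x t = 0) (hL : ∃ i, L (h i) ≠ 0) (r : ℝ) :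
    N {x | ‖L x‖ = r} = 0 := by
  rcases lt_trichotomy r 0 with hr | rfl | hr
  · refine measure_mono_null (fun x hx => ?_) (measure_empty (μ := N))
    have hx' : ‖L x‖ = r := hx
    exact absurd (norm_nonneg (L x)) (by rw [hx']; exact not_le.2 hr)
  -- At `r = 0` the event is the kernel of `L`, which every nonzero shift along a direction outside
  -- the kernel leaves.
  · obtain ⟨i, hi⟩ := hL
    refine measure_eq_zero_of_shift_notMem (hq i)
      (isClosed_eq L.continuous.norm continuous_const).measurableSet fun x hx s hs hxs => hi ?_
    have hx' : ‖L x‖ = 0 := hx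
    have hxs' : ‖L (x + s • h i)‖ = 0 := hxs
    rw [norm_eq_zero] at hx' hxs'
    rw [map_add, map_smul, hx', zero_add] at hxs'
    exact (smul_eq_zero.1 hxs').resolve_left hs.ne'
  · exact measure_norm_eq_pos_eq_zero L hq h0 hr

/-- The norm of `L` has a unique quantile of each order under a measure with enough
quasi-invariant directions. -/
theorem exists_quantile_norm (L : X →L[ℝ] C(T, ℝ))
    (hq : ∀ i, ∀ s : ℝ, Measure.QuasiMeasurePreserving (fun x => x + s • h i) N N)
    (h0 : ∀ t, (∀ i, L (h i) t = 0) → ∀ᵐ x ∂N, L x t = 0) (hL : ∃ i, L (h i) ≠ 0)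
    {β : ℝ} (hβ0 : 0 < β) (hβ1 : β < 1) :
    ∃ r : ℝ, Continuous (fun u => (N.map fun x => ‖L x‖).real (Iic u)) ∧
      (N.map fun x => ‖L x‖).real (Iic r) = β ∧
      (∀ u < r, (N.map fun x => ‖L x‖).real (Iic u) < β) ∧
      ∀ u, r < u → β < (N.map fun x => ‖L x‖).real (Iic u) := by
  have hm : Measurable fun x : X => ‖L x‖ := L.continuous.norm.measurable
  set μ : Measure ℝ := N.map fun x => ‖L x‖ with hμ
  have hprob : IsProbabilityMeasure μ := Measure.isProbabilityMeasure_map hm.aemeasurable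
  have hatom : ∀ r, μ {r} = 0 := fun r => by
    rw [hμ, Measure.map_apply hm (measurableSet_singleton r)]
    exact measure_norm_eq_eq_zero L hq h0 hL r
  have hcdf : ∀ u, μ.real (Iic u) = cdf μ u := fun u => (cdf_eq_real μ u).symm
  have hcont : Continuous (cdf μ) := by
    refine continuous_iff_continuousAt.2 fun u => ?_
    have h1 := (cdf μ).measure_singleton u
    rw [measure_cdf, hatom] at h1
    have h2 : cdf μ u ≤ Function.leftLim (cdf μ) u := by
      have := ENNReal.ofReal_eq_zero.1 h1.symm
      linarith
    rw [(monotone_cdf μ).continuousAt_iff_leftLim_eq_rightLim, (cdf μ).rightLim_eq]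
    exact le_antisymm ((monotone_cdf μ).leftLim_le le_rfl) h2
  obtain ⟨r, hr⟩ : β ∈ range (cdf μ) := by
    refine mem_range_of_exists_le_of_exists_ge hcont ?_ ?_
    · exact ((tendsto_cdf_atBot μ).eventually_le_const hβ0).exists
    · exact ((tendsto_cdf_atTop μ).eventually_const_le hβ1).exists
  obtain ⟨i, hi⟩ := hL
  have hIio : ∀ u, N {x | ‖L x‖ < u} = μ (Iic u) := fun u => by
    have h1 : μ (Iio u) = μ (Iic u) := measure_congr (Iio_ae_eq_Iic' (hatom u))
    rw [← h1, hμ, Measure.map_apply hm measurableSet_Iio]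
    rfl
  -- Below the support the distribution function may be constantly zero, hence the positivity
  -- condition; it holds to the right of any quantile of order `β > 0`.
  have hstrict : ∀ u v, u < v → 0 < cdf μ v → cdf μ u < cdf μ v := by
    intro u v huv hv
    rw [← hcdf] at hv
    have h2 : 0 < N {x | ‖L x‖ < v} := by
      rw [hIio]
      exact (ENNReal.toReal_pos_iff.1 hv).1
    have h3 := measure_norm_mem_Ioo_pos L (hq i) hi huv h2
    have h4 : 0 < μ.real (Ioo u v) := by
      refine ENNReal.toReal_pos ?_ (measure_ne_top _ _)
      rw [hμ, Measure.map_apply hm measurableSet_Ioo]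
      exact h3.ne'
    rw [← hcdf, ← hcdf]
    have h5 : Iic u ∪ Ioo u v ⊆ Iic v := by
      rintro y (hy | hy)
      · exact le_trans hy huv.le
      · exact hy.2.le
    have h6 := measureReal_mono (μ := μ) h5
    have h7 : Disjoint (Iic u) (Ioo u v) :=
      Set.disjoint_left.2 fun y (hy : y ≤ u) hy' => not_lt.2 hy hy'.1
    rw [measureReal_union h7 measurableSet_Ioo] at h6
    linarith
  simp_rw [hcdf]
  refine ⟨r, hcont, hr, fun u hu => ?_, fun u hu => ?_⟩
  · rw [← hr]; exact hstrict u r hu (by rw [hr]; exact hβ0)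
  · rw [← hr]
    refine hstrict r u hu ?_
    have := monotone_cdf μ hu.le
    rw [hr] at this
    linarith

end ShiftInvariance

end

/-! ### From weak convergence of random laws to quantiles and coverage -/

section

/-- The piecewise linear function that is `1` on `(-∞, r]` and `0` on `[r + δ, ∞)`. -/
noncomputable def rampDown (r δ z : ℝ) : ℝ := max 0 (min 1 (1 - (z - r) / δ))

theorem rampDown_nonneg (r δ z : ℝ) : 0 ≤ rampDown r δ z := le_max_left _ _

theorem rampDown_le_one (r δ z : ℝ) : rampDown r δ z ≤ 1 :=
  max_le zero_le_one (min_le_left _ _)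

theorem abs_rampDown_le_one (r δ z : ℝ) : |rampDown r δ z| ≤ 1 := by
  rw [abs_of_nonneg (rampDown_nonneg r δ z)]; exact rampDown_le_one r δ z

theorem rampDown_eq_one {r δ z : ℝ} (hδ : 0 < δ) (hz : z ≤ r) : rampDown r δ z = 1 := by
  have h : (z - r) / δ ≤ 0 := div_nonpos_of_nonpos_of_nonneg (by linarith) hδ.le
  rw [rampDown, min_eq_left (by linarith), max_eq_right zero_le_one]

theorem rampDown_eq_zero {r δ z : ℝ} (hδ : 0 < δ) (hz : r + δ ≤ z) : rampDown r δ z = 0 := by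
  have h : 1 ≤ (z - r) / δ := by rw [le_div_iff₀ hδ]; linarith
  rw [rampDown, max_eq_left]
  exact (min_le_right _ _).trans (by linarith)

theorem abs_rampDown_sub_le {r δ : ℝ} (hδ : 0 < δ) (y z : ℝ) :
    |rampDown r δ y - rampDown r δ z| ≤ δ⁻¹ * |y - z| := by
  have h1 : |rampDown r δ y - rampDown r δ z| ≤
      |min 1 (1 - (y - r) / δ) - min 1 (1 - (z - r) / δ)| :=
    (abs_max_sub_max_le_max _ _ _ _).trans_eq
      (by rw [sub_self, abs_zero, max_eq_right (abs_nonneg _)])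
  have h2 := abs_min_sub_min_le_max (1 : ℝ) (1 - (y - r) / δ) 1 (1 - (z - r) / δ)
  rw [sub_self, abs_zero, max_eq_right (abs_nonneg _)] at h2
  refine (h1.trans h2).trans_eq ?_
  rw [show 1 - (y - r) / δ - (1 - (z - r) / δ) = δ⁻¹ * (z - y) by field_simp; ring, abs_mul,
    abs_of_pos (inv_pos.2 hδ), abs_sub_comm]

theorem continuous_rampDown (r δ : ℝ) : Continuous (rampDown r δ) := by
  unfold rampDown; fun_prop

theorem integrable_rampDown (μ : Measure ℝ) [IsFiniteMeasure μ] (r δ : ℝ) :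
    Integrable (rampDown r δ) μ :=
  Integrable.mono' (integrable_const 1) (continuous_rampDown r δ).aestronglyMeasurable
    (Eventually.of_forall fun z => abs_rampDown_le_one r δ z)

theorem measureReal_Iic_le_integral_rampDown (μ : Measure ℝ) [IsFiniteMeasure μ] {r δ : ℝ}
    (hδ : 0 < δ) : μ.real (Iic r) ≤ ∫ z, rampDown r δ z ∂μ := by
  rw [← integral_indicator_one measurableSet_Iic]
  refine integral_mono ((integrable_const (1 : ℝ)).indicator measurableSet_Iic)
    (integrable_rampDown μ r δ) fun z => ?_
  by_cases hz : z ≤ r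
  · rw [indicator_of_mem (by exact hz), rampDown_eq_one hδ hz]; rfl
  · rw [indicator_of_notMem (by exact hz)]; exact rampDown_nonneg _ _ _

theorem integral_rampDown_le_measureReal_Iic (μ : Measure ℝ) [IsFiniteMeasure μ] {r δ : ℝ}
    (hδ : 0 < δ) : ∫ z, rampDown r δ z ∂μ ≤ μ.real (Iic (r + δ)) := by
  rw [← integral_indicator_one measurableSet_Iic]
  refine integral_mono (integrable_rampDown μ r δ)
    ((integrable_const (1 : ℝ)).indicator measurableSet_Iic) fun z => ?_
  by_cases hz : z ≤ r + δ
  · rw [indicator_of_mem (by exact hz)]; exact rampDown_le_one _ _ _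
  · rw [rampDown_eq_zero hδ (not_le.1 hz).le]
    exact indicator_nonneg (fun _ _ => zero_le_one) _

/-- `φ` is bounded by `1` and Lipschitz. -/
def IsBoundedLipschitz (φ : ℝ → ℝ) : Prop :=
  (∀ z, |φ z| ≤ 1) ∧ ∃ K : ℝ, 0 ≤ K ∧ ∀ y z, |φ y - φ z| ≤ K * |y - z|

theorem isBoundedLipschitz_rampDown {r δ : ℝ} (hδ : 0 < δ) : IsBoundedLipschitz (rampDown r δ) :=
  ⟨abs_rampDown_le_one r δ, δ⁻¹, (inv_pos.2 hδ).le, abs_rampDown_sub_le hδ⟩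

theorem IsBoundedLipschitz.continuous {φ : ℝ → ℝ} (h : IsBoundedLipschitz φ) : Continuous φ := by
  obtain ⟨-, K, hK, hl⟩ := h
  refine (LipschitzWith.of_dist_le_mul (K := ⟨K, hK⟩) fun y z => ?_).continuous
  rw [Real.dist_eq, Real.dist_eq]
  exact hl y z

section Band

variable {D : ℕ → Type*} [∀ n, MeasurableSpace (D n)] {P : ∀ n, Measure (D n)}

theorem TendstoInProb.tendsto_measureReal {Y : ∀ n, D n → ℝ} {c : ℝ}
    (h : TendstoInProb P Y c) {ε : ℝ} (hε : 0 < ε) :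
    Tendsto (fun n => (P n).real {x | ε ≤ |Y n x - c|}) atTop (𝓝 0) := by
  have := (ENNReal.tendsto_toReal ENNReal.zero_ne_top).comp (h ε hε)
  simpa using! this

variable [∀ n, IsProbabilityMeasure (P n)]

theorem tendstoInProb_of_measureReal {Y : ∀ n, D n → ℝ} {c : ℝ}
    (h : ∀ ε : ℝ, 0 < ε → Tendsto (fun n => (P n).real {x | ε ≤ |Y n x - c|}) atTop (𝓝 0)) :
    TendstoInProb P Y c := fun ε hε => by
  have := ENNReal.tendsto_ofReal (h ε hε)
  rw [ENNReal.ofReal_zero] at this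
  exact this.congr fun n => ofReal_measureReal

/-- Convergence in probability of empirical quantiles, and coverage of the corresponding
bands: `Q n x` are random laws that converge weakly in probability to `μ`, `Z n` converges in law
to `μ`, and `R n` is the `β`-quantile of `Q n`. -/
theorem coverage_of_random_laws {μ : Measure ℝ} [IsProbabilityMeasure μ]
    {Q : ∀ n, D n → Measure ℝ} (hQp : ∀ n x, IsProbabilityMeasure (Q n x))
    (hQ : ∀ φ, IsBoundedLipschitz φ →
      TendstoInProb P (fun n x => ∫ z, φ z ∂(Q n x)) (∫ z, φ z ∂μ))
    {Z : ∀ n, D n → ℝ} (hZm : ∀ n, AEMeasurable (Z n) (P n))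
    (hZ : ∀ φ, IsBoundedLipschitz φ →
      Tendsto (fun n => ∫ x, φ (Z n x) ∂(P n)) atTop (𝓝 (∫ z, φ z ∂μ)))
    {β r : ℝ} (hcont : Continuous fun u => μ.real (Iic u)) (hr : μ.real (Iic r) = β)
    (hlt : ∀ u < r, μ.real (Iic u) < β) (hgt : ∀ u, r < u → β < μ.real (Iic u))
    {R : ∀ n, D n → ℝ}
    (hR : ∀ᶠ n in atTop, ∀ᵐ x ∂(P n), (Q n x).real (Iic (R n x)) = β) :
    Tendsto (fun n => (P n).real {x | Z n x ≤ R n x}) atTop (𝓝 β) ∧ TendstoInProb P R r := by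
  have hRr : TendstoInProb P R r := by
    refine tendstoInProb_of_measureReal fun ε hε => ?_
    have hε2 : 0 < ε / 2 := by positivity
    -- The ramps descend on `[r - ε, r - ε/2]` and on `[r + ε/2, r + ε]`, so their limit integrals
    -- lie strictly below and above `β`. If `R` is `ε` away from `r`, one of the integrals against
    -- `Q` misses its limit by at least that fixed gap.
    set φ₁ := rampDown (r - ε) (ε / 2) with hφ₁
    set φ₂ := rampDown (r + ε / 2) (ε / 2) with hφ₂
    have h1 : ∫ z, φ₁ z ∂μ < β :=
      (integral_rampDown_le_measureReal_Iic μ hε2).trans_lt (hlt _ (by linarith))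
    have h2 : β < ∫ z, φ₂ z ∂μ :=
      (hgt _ (by linarith)).trans_le (measureReal_Iic_le_integral_rampDown μ hε2)
    have t1 := (hQ φ₁ (isBoundedLipschitz_rampDown hε2)).tendsto_measureReal (sub_pos.2 h1)
    have t2 := (hQ φ₂ (isBoundedLipschitz_rampDown hε2)).tendsto_measureReal (sub_pos.2 h2)
    have t3 := t1.add t2
    rw [add_zero] at t3
    refine squeeze_zero' (Eventually.of_forall fun n => measureReal_nonneg) ?_ t3
    filter_upwards [hR] with n hn
    refine le_trans ?_ (measureReal_union_le _ _)
    refine ENNReal.toReal_mono (measure_ne_top _ _) (measure_mono_ae ?_)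
    filter_upwards [hn] with x hx hxR
    have hxR' : ε ≤ |R n x - r| := hxR
    have := hQp n x
    rcases le_abs.1 hxR' with h | h
    · right
      have h3 : ∫ z, φ₂ z ∂(Q n x) ≤ β := by
        refine (integral_rampDown_le_measureReal_Iic (Q n x) hε2).trans ?_
        rw [← hx]
        exact measureReal_mono (Iic_subset_Iic.2 (by linarith))
      change ∫ z, φ₂ z ∂μ - β ≤ |∫ z, φ₂ z ∂(Q n x) - ∫ z, φ₂ z ∂μ|
      rw [abs_sub_comm]
      exact le_trans (by linarith) (le_abs_self _)
    · left
      have h3 : β ≤ ∫ z, φ₁ z ∂(Q n x) := by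
        refine le_trans ?_ (measureReal_Iic_le_integral_rampDown (Q n x) hε2)
        rw [← hx]
        exact measureReal_mono (Iic_subset_Iic.2 (by linarith))
      change β - ∫ z, φ₁ z ∂μ ≤ |∫ z, φ₁ z ∂(Q n x) - ∫ z, φ₁ z ∂μ|
      exact le_trans (by linarith) (le_abs_self _)
  refine ⟨?_, hRr⟩
  rw [Metric.tendsto_atTop']
  intro η hη
  have hη4 : 0 < η / 4 := by positivity
  obtain ⟨ε', hε', hH⟩ := Metric.continuousAt_iff.1 hcont.continuousAt (η / 4) hη4
  -- The ramps below reach to distance `2ε` from `r`, which must be less than `ε'`.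
  set ε := ε' / 4 with hεdef
  have hε : 0 < ε := by positivity
  have hH1 : |μ.real (Iic (r + ε + ε)) - β| < η / 4 := by
    have := @hH (r + ε + ε) (by
      rw [Real.dist_eq, add_assoc, add_sub_cancel_left, abs_of_pos (by linarith)]
      linarith)
    rwa [hr, Real.dist_eq] at this
  have hH2 : |μ.real (Iic (r - ε - ε)) - β| < η / 4 := by
    have := @hH (r - ε - ε) (by
      rw [Real.dist_eq, abs_of_neg (by linarith)]
      linarith)
    rwa [hr, Real.dist_eq] at this
  have hZ1 := Metric.tendsto_atTop.1 (hZ _ (isBoundedLipschitz_rampDown (r := r + ε) hε)) _ hη4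
  have hZ2 := Metric.tendsto_atTop.1 (hZ _ (isBoundedLipschitz_rampDown (r := r - ε - ε) hε)) _ hη4
  have hR1 := Metric.tendsto_atTop.1 (hRr.tendsto_measureReal hε) _ hη4
  obtain ⟨n₁, hn₁⟩ := hZ1
  obtain ⟨n₂, hn₂⟩ := hZ2
  obtain ⟨n₃, hn₃⟩ := hR1
  refine ⟨max n₁ (max n₂ n₃), fun n hn => ?_⟩
  have e1 := hn₁ n (le_trans (le_max_left _ _) hn.le)
  have e2 := hn₂ n (le_trans (le_trans (le_max_left _ _) (le_max_right _ _)) hn.le)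
  have e3 := hn₃ n (le_trans (le_trans (le_max_right _ _) (le_max_right _ _)) hn.le)
  rw [Real.dist_eq] at e1 e2 e3 ⊢
  rw [sub_zero, abs_of_nonneg measureReal_nonneg] at e3
  have hmap := Measure.isProbabilityMeasure_map (hZm n)
  have hint : ∀ s δ : ℝ, ∫ x, rampDown s δ (Z n x) ∂(P n)
      = ∫ z, rampDown s δ z ∂((P n).map (Z n)) := fun s δ =>
    (integral_map (hZm n) (continuous_rampDown s δ).aestronglyMeasurable).symm
  have hreal : ∀ u, ((P n).map (Z n)).real (Iic u) = (P n).real {x | Z n x ≤ u} := fun u => by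
    rw [measureReal_def, Measure.map_apply_of_aemeasurable (hZm n) measurableSet_Iic]
    rfl
  -- Outside the event `ε ≤ |R - r|` the random threshold can be replaced by `r + ε` from above and
  -- by `r - ε` from below.
  have up1 : (P n).real {x | Z n x ≤ R n x}
      ≤ (P n).real {x | Z n x ≤ r + ε} + (P n).real {x | ε ≤ |R n x - r|} := by
    refine (measureReal_mono fun x hx => ?_).trans (measureReal_union_le _ _)
    have hx' : Z n x ≤ R n x := hx
    by_cases h : ε ≤ |R n x - r|
    · exact Or.inr h
    · left
      change Z n x ≤ r + ε
      have := (abs_lt.1 (not_le.1 h)).2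
      linarith
  have up2 : (P n).real {x | Z n x ≤ r - ε}
      ≤ (P n).real {x | Z n x ≤ R n x} + (P n).real {x | ε ≤ |R n x - r|} := by
    refine (measureReal_mono fun x hx => ?_).trans (measureReal_union_le _ _)
    have hx' : Z n x ≤ r - ε := hx
    by_cases h : ε ≤ |R n x - r|
    · exact Or.inr h
    · left
      change Z n x ≤ R n x
      have := (abs_lt.1 (not_le.1 h)).1
      linarith
  have i1 := measureReal_Iic_le_integral_rampDown ((P n).map (Z n)) (r := r + ε) hε
  have i2 := integral_rampDown_le_measureReal_Iic ((P n).map (Z n)) (r := r - ε - ε) hε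
  rw [hreal, ← hint] at i1
  rw [hreal, ← hint, sub_add_cancel] at i2
  have j1 := integral_rampDown_le_measureReal_Iic μ (r := r + ε) hε
  have j2 := measureReal_Iic_le_integral_rampDown μ (r := r - ε - ε) hε
  have a1 := abs_lt.1 e1
  have a2 := abs_lt.1 e2
  have b1 := abs_lt.1 hH1
  have b2 := abs_lt.1 hH2
  rw [abs_lt]
  constructor <;> linarith [a1.1, a1.2, a2.1, a2.2, b1.1, b1.2, b2.1, b2.2]

end Band

/-- Integrals of bounded Lipschitz functions are controlled by the bounded-Lipschitz distance. -/
theorem abs_integral_sub_le_blDist {S : Type*} [MetricSpace S] [MeasurableSpace S]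
    (μ ν : Measure S) [IsProbabilityMeasure μ] [IsProbabilityMeasure ν] {F : S → ℝ} {K : ℝ}
    (hK : 0 ≤ K) (hF : ∀ x, |F x| ≤ 1) (hl : ∀ x y, |F x - F y| ≤ K * dist x y) :
    |∫ x, F x ∂μ - ∫ x, F x ∂ν| ≤ (1 + K) * blDist μ ν := by
  have hC : 0 < 1 + K := by linarith
  -- An unbounded set of reals would have `sSup` equal to the default value `0`, so boundedness has
  -- to be checked.
  have hbdd : BddAbove {r : ℝ | ∃ (F : S → ℝ) (a b : ℝ), 0 ≤ a ∧ 0 ≤ b ∧ a + b ≤ 1 ∧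
      (∀ x, |F x| ≤ a) ∧ (∀ x y, |F x - F y| ≤ b * dist x y) ∧
      r = |∫ x, F x ∂μ - ∫ x, F x ∂ν|} := by
    refine ⟨2, ?_⟩
    rintro _ ⟨G, a, b, ha, hb, hab, hG, -, rfl⟩
    have h1 : ∀ (ρ : Measure S) [IsProbabilityMeasure ρ], |∫ x, G x ∂ρ| ≤ 1 := fun ρ _ => by
      have := norm_integral_le_of_norm_le_const (μ := ρ) (f := G) (C := a)
        (Eventually.of_forall hG)
      rw [Real.norm_eq_abs, probReal_univ, mul_one] at this
      linarith
    have h2 := h1 μ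
    have h3 := h1 ν
    rw [abs_le] at h2 h3 ⊢
    constructor <;> linarith [h2.1, h2.2, h3.1, h3.2]
  -- Division by `1 + K` normalises the sum of sup-norm and Lipschitz constant to `1`.
  have hmem := le_csSup hbdd ⟨fun x => (1 + K)⁻¹ * F x, (1 + K)⁻¹, (1 + K)⁻¹ * K,
    (inv_pos.2 hC).le, mul_nonneg (inv_pos.2 hC).le hK, by
      rw [← mul_one_add, inv_mul_cancel₀ hC.ne'], fun x => by
      rw [abs_mul, abs_of_pos (inv_pos.2 hC)]
      exact mul_le_of_le_one_right (inv_pos.2 hC).le (hF x), fun x y => by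
      rw [← mul_sub, abs_mul, abs_of_pos (inv_pos.2 hC), mul_assoc]
      exact mul_le_mul_of_nonneg_left (hl x y) (inv_pos.2 hC).le, rfl⟩
  rw [integral_const_mul, integral_const_mul, ← mul_sub, abs_mul, abs_of_pos (inv_pos.2 hC),
    inv_mul_le_iff₀ hC] at hmem
  exact hmem

namespace WaveletBasis

variable {J₀ : ℕ} (B : WaveletBasis J₀) {w : AdmissibleWeight J₀}
  (hw : Summable fun i : ℕ => w.at i * levelRate J₀ i)

/-- Continuous mapping in quantitative form: `φ ∘ ‖L ·‖` is Lipschitz with constant `K ‖L‖`. The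
constant does not depend on the laws, so it applies to random posterior laws. -/
theorem abs_integral_norm_primitiveCLM_sub_le {φ : ℝ → ℝ} (hφ : IsBoundedLipschitz φ) : ∃ C : ℝ, 0 < C ∧
    ∀ (μ ν : Measure (MZero w)) [IsProbabilityMeasure μ] [IsProbabilityMeasure ν],
    |∫ x, φ ‖B.primitiveCLM hw x‖ ∂μ - ∫ x, φ ‖B.primitiveCLM hw x‖ ∂ν| ≤ C * blDist μ ν := by
  obtain ⟨h1, K, hK, hl⟩ := hφ
  refine ⟨1 + K * ‖B.primitiveCLM hw‖, by positivity, fun μ ν _ _ => ?_⟩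
  refine abs_integral_sub_le_blDist μ ν (by positivity) (fun x => h1 _) fun x y => ?_
  refine (hl _ _).trans ?_
  rw [mul_assoc]
  refine mul_le_mul_of_nonneg_left ?_ hK
  refine (abs_norm_sub_norm_le _ _).trans ?_
  rw [← map_sub, dist_eq_norm]
  exact (B.primitiveCLM hw).le_opNorm _

variable {D : ℕ → Type*} [∀ n, MeasurableSpace (D n)] {P : ∀ n, Measure (D n)}
  [∀ n, IsProbabilityMeasure (P n)] {post : ∀ n, Kernel (D n) L2} [∀ n, IsMarkovKernel (post n)]
  {T : ∀ n, D n → MZero w} {a : Idx J₀ → SeqL2 J₀} {M : NNReal} {f₀ : L2} {α : ℝ}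

theorem measurable_smul_embed_sub (n : ℕ) (y : MZero w) :
    Measurable fun f : L2 => √(n : ℝ) • (B.embed w f - y) :=
  have h : Continuous fun f : L2 => B.embed w f - y := B.continuous_embed.sub continuous_const
  (h.fun_const_smul _).measurable

/-- Coverage of credible bands for the primitive, for a Gaussian limit. -/
theorem bandConclusion_of_weakBvM (ha : ∀ p, ‖a p‖₊ ≤ M)
    (hne : ∃ q, B.primitiveCLM hw (gaussDirection w ha q) ≠ 0)
    (hT : ∀ n, Measurable (T n))
    (hlim : ∀ φ, IsBoundedLipschitz φ → Tendsto (fun n : ℕ => ∫ x,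
      φ ‖B.primitiveCLM hw (√(n : ℝ) • (T n x - B.embed w f₀))‖ ∂(P n)) atTop
      (𝓝 (∫ x, φ ‖B.primitiveCLM hw x‖ ∂(gaussLaw w a))))
    (hbvm : B.WeakBvM w P post T (gaussLaw w a)) (hα₀ : 0 < α) (hα₁ : α < 1)
    {c : ∀ n, D n → ℝ → ℝ} (hc : ∀ n x, ∀ t ∈ Icc (0 : ℝ) 1, c n x t = B.primitiveMap (T n x) t)
    {R : ∀ n, D n → ℝ} (hR : IsCredibleBand P post c R α) : BandConclusion P f₀ c R α := by
  set L := B.primitiveCLM hw with hL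
  have hN : IsProbabilityMeasure (gaussLaw w a) := isProbabilityMeasure_gaussLaw ha
  have hnm : Measurable fun x : MZero w => ‖L x‖ := L.continuous.norm.measurable
  obtain ⟨r, hcont, hr, hlt, hgt⟩ := exists_quantile_norm (N := gaussLaw w a) L
    (quasiMeasurePreserving_gaussLaw ha)
    (fun t ht => B.ae_primitiveMap_eq_zero hw ha t.2 ht) hne (β := 1 - α) (by linarith)
    (by linarith)
  have hband : ∀ n, 0 < n → ∀ x f, InBand (c n x) (R n x / √(n : ℝ)) (primitive f) ↔
      ‖L (√(n : ℝ) • (B.embed w f - T n x))‖ ≤ R n x := fun n hn x f => by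
    rw [← B.inBand_iff hw (B.embed w f) (T n x) hn]
    exact inBand_congr (hc n x) fun t ht => (B.primitiveMap_embed w f ht).symm
  set Q : ∀ n, D n → Measure ℝ := fun n x =>
    ((post n x).map fun f => √(n : ℝ) • (B.embed w f - T n x)).map fun x => ‖L x‖ with hQ
  have hmp : ∀ n x, IsProbabilityMeasure
      ((post n x).map fun f => √(n : ℝ) • (B.embed w f - T n x)) := fun n x =>
    Measure.isProbabilityMeasure_map (B.measurable_smul_embed_sub n _).aemeasurable
  have hQp : ∀ n x, IsProbabilityMeasure (Q n x) := fun n x =>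
    Measure.isProbabilityMeasure_map hnm.aemeasurable
  have hmu : IsProbabilityMeasure ((gaussLaw w a).map fun x => ‖L x‖) :=
    Measure.isProbabilityMeasure_map hnm.aemeasurable
  have hQR : ∀ᶠ n in atTop, ∀ᵐ x ∂(P n), (Q n x).real (Iic (R n x)) = 1 - α := by
    filter_upwards [hR, eventually_gt_atTop 0] with n hn hn0
    filter_upwards [hn] with x hx
    rw [measureReal_def, hQ, Measure.map_apply hnm measurableSet_Iic,
      Measure.map_apply (B.measurable_smul_embed_sub n _) (hnm measurableSet_Iic)]
    have hset : (fun f => √(n : ℝ) • (B.embed w f - T n x)) ⁻¹'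
        ((fun x => ‖L x‖) ⁻¹' Iic (R n x))
        = {f | InBand (c n x) (R n x / √(n : ℝ)) (primitive f)} := by
      ext f
      exact (hband n hn0 x f).symm
    rw [hset, hx, ENNReal.toReal_ofReal (by linarith)]
  have hQlim : ∀ φ, IsBoundedLipschitz φ → TendstoInProb P (fun n x => ∫ z, φ z ∂(Q n x))
      (∫ z, φ z ∂((gaussLaw w a).map fun x => ‖L x‖)) := by
    intro φ hφ ε hε
    obtain ⟨C, hC, hbd⟩ := B.abs_integral_norm_primitiveCLM_sub_le hw hφ
    refine tendsto_of_tendsto_of_tendsto_of_le_of_le tendsto_const_nhds (hbvm (ε / C) (by positivity))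
      (fun n => zero_le) fun n => measure_mono fun x hx => ?_
    have hx' : ε ≤ |∫ z, φ z ∂(Q n x) - ∫ z, φ z ∂((gaussLaw w a).map fun x => ‖L x‖)| := hx
    have h1 := hbd ((post n x).map fun f => √(n : ℝ) • (B.embed w f - T n x)) (gaussLaw w a)
    rw [hQ, integral_map hnm.aemeasurable hφ.continuous.aestronglyMeasurable,
      integral_map hnm.aemeasurable hφ.continuous.aestronglyMeasurable] at hx'
    change ε / C ≤ |_ - 0|
    rw [sub_zero, div_le_iff₀ hC, mul_comm]
    refine (hx'.trans h1).trans (mul_le_mul_of_nonneg_left (le_abs_self _) hC.le)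
  have hZm : ∀ n : ℕ, Measurable fun x => ‖L (√(n : ℝ) • (T n x - B.embed w f₀))‖ := fun n => by
    have h1 : Continuous fun y : MZero w => y - B.embed w f₀ := continuous_id.sub continuous_const
    have h2 : Continuous fun y : MZero w => √(n : ℝ) • (y - B.embed w f₀) := h1.fun_const_smul _
    have h3 : Continuous fun y : MZero w => ‖L (√(n : ℝ) • (y - B.embed w f₀))‖ :=
      (L.continuous.comp h2).norm
    exact h3.measurable.comp (hT n)
  obtain ⟨h1, h2⟩ := coverage_of_random_laws (P := P) hQp hQlim
    (Z := fun (n : ℕ) x => ‖L (√(n : ℝ) • (T n x - B.embed w f₀))‖) (fun n => (hZm n).aemeasurable)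
    (fun φ hφ => by
      rw [integral_map hnm.aemeasurable hφ.continuous.aestronglyMeasurable]
      exact hlim φ hφ) hcont hr hlt hgt hQR
  refine ⟨?_, r, h2⟩
  have h3 := ENNReal.tendsto_ofReal h1
  refine h3.congr' ?_
  filter_upwards [eventually_gt_atTop 0] with n hn
  rw [ofReal_measureReal]
  congr 1
  ext x
  have h4 := hband n hn x f₀
  -- The posterior is centred as `f - T`, the estimator as `T - f₀`; the norm does not see the sign.
  rw [← norm_neg, ← map_neg, ← smul_neg, neg_sub] at h4
  exact h4.symm

end WaveletBasis

end

/-! ### The white bridge: covariance and nondegeneracy -/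

section

section Density

variable {f : L2}

theorem integral_densityLaw (hf : ∀ᵐ x ∂unitVol, 0 ≤ f x) (g : ℝ → ℝ) :
    ∫ x, g x ∂(densityLaw f) = ∫ x, f x * g x ∂unitVol := by
  rw [densityLaw, integral_withDensity_eq_integral_toReal_smul₀
    (Lp.stronglyMeasurable f).measurable.ennreal_ofReal.aemeasurable
    (Eventually.of_forall fun x => ENNReal.ofReal_lt_top)]
  refine integral_congr_ae ?_
  filter_upwards [hf] with x hx
  rw [ENNReal.toReal_ofReal hx, smul_eq_mul]

theorem integrable_L2 (f : L2) : Integrable f unitVol :=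
  (Lp.memLp f).integrable one_le_two

theorem IsDensity.isProbabilityMeasure (hf : IsDensity f) :
    IsProbabilityMeasure (densityLaw f) := by
  constructor
  rw [densityLaw, withDensity_apply _ MeasurableSet.univ, Measure.restrict_univ,
    ← ofReal_integral_eq_lintegral_ofReal (integrable_L2 f) hf.1, hf.2, ENNReal.ofReal_one]

theorem ae_densityLaw_mem_Icc (f : L2) : ∀ᵐ x ∂(densityLaw f), x ∈ Icc (0 : ℝ) 1 :=
  (withDensity_absolutelyContinuous _ _).ae_le (ae_restrict_mem measurableSet_Icc)

theorem memLp_sqrt (hf : ∀ᵐ x ∂unitVol, 0 ≤ f x) : MemLp (fun x => √(f x)) 2 unitVol := by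
  have hm : Measurable fun x => √(f x) := (Lp.stronglyMeasurable f).measurable.sqrt
  rw [memLp_two_iff_integrable_sq hm.aestronglyMeasurable]
  refine (integrable_L2 f).congr ?_
  filter_upwards [hf] with x hx
  rw [Real.sq_sqrt hx]

theorem memLp_mul_sqrt (hf : ∀ᵐ x ∂unitVol, 0 ≤ f x) {g : ℝ → ℝ} (hg : Measurable g) {K : ℝ}
    (hK : ∀ x ∈ Icc (0 : ℝ) 1, |g x| ≤ K) : MemLp (fun x => g x * √(f x)) 2 unitVol := by
  refine (memLp_sqrt hf).of_le_mul (c := K)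
    (hg.mul (Lp.stronglyMeasurable f).measurable.sqrt).aestronglyMeasurable ?_
  filter_upwards [ae_restrict_mem measurableSet_Icc] with x hx
  rw [norm_mul]
  exact mul_le_mul_of_nonneg_right (hK x hx) (norm_nonneg _)

end Density

namespace WaveletBasis

variable {J₀ : ℕ} (B : WaveletBasis J₀) {f : L2}

/-- The centred wavelet `ψ_p - P ψ_p`, where `P` has density `f`. -/
noncomputable def centred (f : L2) (p : Idx J₀) (x : ℝ) : ℝ :=
  B.ψ p x - ∫ y, B.ψ p y ∂(densityLaw f)

theorem measurable_centred (f : L2) (p : Idx J₀) : Measurable (B.centred f p) :=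
  (B.measurable_ψ p).sub_const _

theorem integral_ψ_densityLaw (hf : ∀ᵐ x ∂unitVol, 0 ≤ f x) (p : Idx J₀) :
    ∫ y, B.ψ p y ∂(densityLaw f) = B.basis.repr f p := by
  rw [integral_densityLaw hf, B.repr_apply_eq_integral]
  simp_rw [mul_comm]

/-- A constant `C` with `|ψ_{lk}| ≤ C 2^{l/2}`. -/
noncomputable def supConst : ℝ := B.exists_abs_ψ_le.choose

theorem supConst_nonneg : 0 ≤ B.supConst := B.exists_abs_ψ_le.choose_spec.1

theorem abs_ψ_le (p : Idx J₀) {x : ℝ} (hx : x ∈ Icc (0 : ℝ) 1) :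
    |B.ψ p x| ≤ B.supConst * (2 : ℝ) ^ ((p.lev : ℝ) / 2) :=
  B.exists_abs_ψ_le.choose_spec.2 p x hx

theorem abs_centred_le (hf : IsDensity f) (p : Idx J₀) {x : ℝ} (hx : x ∈ Icc (0 : ℝ) 1) :
    |B.centred f p x| ≤ 2 * B.supConst * (2 : ℝ) ^ ((p.lev : ℝ) / 2) := by
  have := hf.isProbabilityMeasure
  have h1 : |∫ y, B.ψ p y ∂(densityLaw f)| ≤ B.supConst * (2 : ℝ) ^ ((p.lev : ℝ) / 2) := by
    have := norm_integral_le_of_norm_le_const (μ := densityLaw f) (f := B.ψ p)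
      ((ae_densityLaw_mem_Icc f).mono fun y hy => B.abs_ψ_le p hy)
    rwa [probReal_univ, mul_one] at this
  have h2 := B.abs_ψ_le p hx
  refine (abs_sub _ _).trans ?_
  linarith

theorem memLp_centred (hf : IsDensity f) (p : Idx J₀) (q : ENNReal) :
    MemLp (B.centred f p) q (densityLaw f) := by
  have := hf.isProbabilityMeasure
  refine MemLp.of_bound (B.measurable_centred f p).aestronglyMeasurable
    (2 * B.supConst * (2 : ℝ) ^ ((p.lev : ℝ) / 2)) ?_
  exact (ae_densityLaw_mem_Icc f).mono fun x hx => B.abs_centred_le hf p hx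

theorem memLp_ψ_densityLaw (hf : IsDensity f) (p : Idx J₀) (q : ENNReal) :
    MemLp (B.ψ p) q (densityLaw f) := by
  have := hf.isProbabilityMeasure
  refine MemLp.of_bound (B.measurable_ψ p).aestronglyMeasurable
    (B.supConst * (2 : ℝ) ^ ((p.lev : ℝ) / 2)) ?_
  exact (ae_densityLaw_mem_Icc f).mono fun x hx => B.abs_ψ_le p hx

theorem integral_centred (hf : IsDensity f) (p : Idx J₀) :
    ∫ x, B.centred f p x ∂(densityLaw f) = 0 := by
  have := hf.isProbabilityMeasure
  unfold centred
  rw [integral_sub ((B.memLp_ψ_densityLaw hf p 1).integrable le_rfl) (integrable_const _)]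
  simp

theorem integral_ψ_sq (p : Idx J₀) : ∫ x, B.ψ p x ^ 2 ∂unitVol = 1 := by
  have h1 : inner ℝ (B.basis p) (B.basis p) = (1 : ℝ) := by
    rw [real_inner_self_eq_norm_sq, B.basis.orthonormal.1 p, one_pow]
  rw [L2.inner_def] at h1
  rw [← h1]
  refine integral_congr_ae ?_
  filter_upwards [B.basis_ae_eq p] with x hx
  simp [hx, sq]

theorem integrable_ψ_sq (p : Idx J₀) : Integrable (fun x => B.ψ p x ^ 2) unitVol := by
  refine (((Lp.memLp (B.basis p)).ae_eq (B.basis_ae_eq p)).integrable_sq)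

/-- The variance is at most the second moment, which is at most `D ∫ ψ_p² = D`. Boundedness of the
density thus makes the variances uniform over all levels. -/
theorem integral_centred_sq_le (hf : IsDensity f) {D : ℝ} (hD : ∀ᵐ x ∂unitVol, f x ≤ D)
    (p : Idx J₀) : ∫ x, B.centred f p x ^ 2 ∂(densityLaw f) ≤ D := by
  have := hf.isProbabilityMeasure
  have h1 := variance_eq_integral (μ := densityLaw f) (B.measurable_ψ p).aemeasurable
  have h2 := variance_le_expectation_sq (μ := densityLaw f) (X := B.ψ p)
    (B.measurable_ψ p).aestronglyMeasurable
  rw [h1] at h2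
  refine h2.trans ?_
  simp only [Pi.pow_apply]
  rw [integral_densityLaw hf.1]
  calc ∫ x, f x * B.ψ p x ^ 2 ∂unitVol ≤ ∫ x, D * B.ψ p x ^ 2 ∂unitVol := by
        refine integral_mono_of_nonneg ?_ ((B.integrable_ψ_sq p).const_mul D) ?_
        · filter_upwards [hf.1] with x hx
          exact mul_nonneg hx (sq_nonneg _)
        · filter_upwards [hD] with x hx
          exact mul_le_mul_of_nonneg_right hx (sq_nonneg _)
    _ = D := by rw [integral_const_mul, B.integral_ψ_sq, mul_one]

/-- The function `(ψ_p - Pψ_p) √f` in `L²`. -/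
noncomputable def bridgeVec (hf : IsDensity f) (p : Idx J₀) : L2 :=
  (memLp_mul_sqrt hf.1 (B.measurable_centred f p) fun _ hx => B.abs_centred_le hf p hx).toLp _

theorem bridgeVec_ae_eq (hf : IsDensity f) (p : Idx J₀) :
    B.bridgeVec hf p =ᵐ[unitVol] fun x => B.centred f p x * √(f x) := MemLp.coeFn_toLp _

/-- The coefficients of `(ψ_p - Pψ_p) √f`. -/
noncomputable def bridgeSeq (hf : IsDensity f) (p : Idx J₀) : SeqL2 J₀ :=
  B.basis.repr (B.bridgeVec hf p)

theorem bridgeCoeff_eq (hf : IsDensity f) (p : Idx J₀) :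
    B.bridgeCoeff f p = (B.bridgeSeq hf p : Idx J₀ → ℝ) := by
  funext q
  rw [bridgeSeq, B.repr_apply_eq_integral, bridgeCoeff]
  refine integral_congr_ae ?_
  filter_upwards [B.bridgeVec_ae_eq hf p] with x hx
  rw [hx, centred, mul_comm]

theorem whiteBridgeLaw_eq (w : AdmissibleWeight J₀) (hf : IsDensity f) :
    B.whiteBridgeLaw w f = gaussLaw w (B.bridgeSeq hf) := by
  simp only [whiteBridgeLaw, gaussLaw, B.bridgeCoeff_eq hf]

/-- Coefficients in an orthonormal basis preserve norms and `(√f)² = f`. This identifies the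
variances of the bridge with those in the central limit theorem. -/
theorem norm_sum_bridgeSeq_sq (hf : IsDensity f) (F : Finset (Idx J₀)) (u : Idx J₀ → ℝ) :
    ‖∑ p ∈ F, u p • B.bridgeSeq hf p‖ ^ 2
      = ∫ x, (∑ p ∈ F, u p * B.centred f p x) ^ 2 ∂(densityLaw f) := by
  have h1 : ∑ p ∈ F, u p • B.bridgeSeq hf p = B.basis.repr (∑ p ∈ F, u p • B.bridgeVec hf p) := by
    simp only [bridgeSeq, map_sum, map_smul]
  rw [h1, LinearIsometryEquiv.norm_map, ← real_inner_self_eq_norm_sq, L2.inner_def,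
    integral_densityLaw hf.1]
  refine integral_congr_ae ?_
  have h2 : ∀ᵐ x ∂unitVol, ∀ p, (u p • B.bridgeVec hf p : L2) x
      = u p * (B.centred f p x * √(f x)) := ae_all_iff.2 fun p => by
    filter_upwards [Lp.coeFn_smul (u p) (B.bridgeVec hf p), B.bridgeVec_ae_eq hf p] with x h3 h4
    simp [h3, h4]
  filter_upwards [h2, Lp.coeFn_finsetSum F fun p => u p • B.bridgeVec hf p, hf.1] with x h3 h4 h5
  rw [h4, Finset.sum_apply]
  simp only [h3, ← mul_assoc, ← Finset.sum_mul]
  simp only [RCLike.inner_apply, conj_trivial]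
  calc _ = (∑ p ∈ F, u p * B.centred f p x) ^ 2 * (√(f x)) ^ 2 := by ring
    _ = _ := by rw [Real.sq_sqrt h5, mul_comm]

theorem nnnorm_bridgeSeq_le (hf : IsDensity f) {D : ℝ} (hD : ∀ᵐ x ∂unitVol, f x ≤ D)
    (p : Idx J₀) : ‖B.bridgeSeq hf p‖₊ ≤ (√D).toNNReal := by
  have h1 := B.norm_sum_bridgeSeq_sq hf {p} fun _ => 1
  simp only [Finset.sum_singleton, one_smul, one_mul] at h1
  have h2 := B.integral_centred_sq_le hf hD p
  rw [← h1] at h2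
  rw [← NNReal.coe_le_coe, coe_nnnorm, Real.coe_toNNReal _ (Real.sqrt_nonneg _)]
  exact Real.le_sqrt_of_sq_le h2

theorem exists_primitive_eq_half (hf : IsDensity f) :
    ∃ t ∈ Icc (0 : ℝ) 1, primitive f t = 1 / 2 := by
  have hint : IntegrableOn f (uIcc 0 1) volume := by
    rw [uIcc_of_le zero_le_one]; exact integrable_L2 f
  have hcont := intervalIntegral.continuousOn_primitive_interval (μ := volume) hint
  rw [uIcc_of_le zero_le_one] at hcont
  have h1 : primitive f 1 = 1 := by
    have h := hf.2
    rw [integral_Icc_eq_integral_Ioc] at h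
    rw [primitive, intervalIntegral.integral_of_le zero_le_one]
    exact h
  have h0 : primitive f 0 = 0 := intervalIntegral.integral_same
  have := intermediate_value_Icc zero_le_one hcont
  have h3 : (1 / 2 : ℝ) ∈ Icc (primitive f 0) (primitive f 1) := by
    rw [h0, h1]; constructor <;> norm_num
  obtain ⟨t, ht, htf⟩ := this h3
  exact ⟨t, ht, htf⟩

/-- Up to the isometry, the bridge at time `t` has coefficient vector `(1_{(0,t]} - F(t)) √f`. If
every direction had zero primitive, this function would be orthogonal to all `ψ_q`, hence zero. -/
theorem exists_primitiveCLM_bridge_ne_zero {w : AdmissibleWeight J₀}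
    (hw : Summable fun i : ℕ => w.at i * levelRate J₀ i) (hf : IsDensity f) {M : NNReal}
    (ha : ∀ p, ‖B.bridgeSeq hf p‖₊ ≤ M) :
    ∃ q, B.primitiveCLM hw (gaussDirection w ha q) ≠ 0 := by
  by_contra! hcon
  obtain ⟨t, ht, htf⟩ := exists_primitive_eq_half hf
  -- At a median `t` the centred indicator has modulus `1/2` everywhere, so `χ √f = 0` forces `f ≤
  -- 0` almost everywhere, against `∫ f = 1`.
  set χ : ℝ → ℝ := fun x => (Ioc 0 t).indicator 1 x - 1 / 2 with hχ
  have hχm : Measurable χ := (measurable_one.indicator measurableSet_Ioc).sub_const _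
  have hχb : ∀ x, |χ x| = 1 / 2 := fun x => by
    by_cases hx : x ∈ Ioc 0 t
    · simp only [hχ, indicator_of_mem hx, Pi.one_apply]; norm_num
    · simp only [hχ, indicator_of_notMem hx]; norm_num
  have hv := memLp_mul_sqrt hf.1 hχm fun x _ => (hχb x).le
  have hzero : hv.toLp _ = 0 := by
    rw [← B.basis.repr.map_eq_zero_iff]
    ext q
    rw [B.repr_apply_eq_integral]
    have hq := memLp_mul_sqrt hf.1 (B.measurable_ψ q) fun x hx => B.abs_ψ_le q hx
    set hL : L2 := hq.toLp _ with hLdef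
    have hLae : hL =ᵐ[unitVol] fun x => B.ψ q x * √(f x) := hq.coeFn_toLp
    have h1 : ∀ p, B.bridgeSeq hf p q = B.basis.repr hL p - B.basis.repr f p * ∫ x, hL x ∂unitVol := by
      intro p
      rw [← B.bridgeCoeff_eq hf p, bridgeCoeff, B.repr_apply_eq_integral hL,
        B.integral_ψ_densityLaw hf.1, ← integral_const_mul, ← integral_sub]
      · refine integral_congr_ae ?_
        filter_upwards [hLae] with x hx
        rw [hx]; ring
      · have : MemLp (B.ψ p) 2 unitVol := (Lp.memLp (B.basis p)).ae_eq (B.basis_ae_eq p)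
        exact this.integrable_mul (Lp.memLp hL)
      · exact (integrable_L2 hL).const_mul _
    have h2 : B.primitiveMap (gaussDirection w ha q) t = 0 := by
      have := congrArg (fun g : C(Icc (0 : ℝ) 1, ℝ) => g ⟨t, ht⟩) (hcon q)
      simpa using this
    have h3 := (B.hasSum_primitive hL ht).sub
      ((B.hasSum_primitive f ht).mul_right (∫ x, hL x ∂unitVol))
    have h4 : B.primitiveMap (gaussDirection w ha q) t
        = primitive hL t - primitive f t * ∫ x, hL x ∂unitVol := by
      rw [← h3.tsum_eq, primitiveMap]
      refine tsum_congr fun p => ?_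
      rw [coord_gaussDirection, h1 p]
      change (_ - _) * B.waveletPrimitive p t = _
      ring
    rw [h2, htf] at h4
    have h5 : ∫ x, B.ψ q x * (hv.toLp _ : L2) x ∂unitVol
        = primitive hL t - 1 / 2 * ∫ x, hL x ∂unitVol := by
      rw [← inner_iocIndicator hL ht, iocIndicator, L2.inner_indicatorConstLp_one,
        ← integral_indicator measurableSet_Ioc, ← integral_const_mul, ← integral_sub
        ((integrable_L2 hL).indicator measurableSet_Ioc) ((integrable_L2 hL).const_mul _)]
      refine integral_congr_ae ?_
      filter_upwards [hLae, hv.coeFn_toLp] with x hx hx'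
      rw [hx']
      by_cases hxt : x ∈ Ioc 0 t
      · simp only [hχ, indicator_of_mem hxt, Pi.one_apply, hx]; ring
      · simp only [hχ, indicator_of_notMem hxt, hx]; ring
    rw [h5, ← h4]
    rfl
  have h6 : ∀ᵐ x ∂unitVol, f x ≤ 0 := by
    have h7 := hv.coeFn_toLp
    rw [hzero] at h7
    filter_upwards [h7, Lp.coeFn_zero ℝ 2 unitVol] with x hx hx0
    rw [hx0, Pi.zero_apply] at hx
    have hne : χ x ≠ 0 := fun h => by
      have := hχb x
      rw [h, abs_zero] at this
      norm_num at this
    exact Real.sqrt_eq_zero'.1 ((mul_eq_zero.1 hx.symm).resolve_left hne)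
  have h8 : ∫ x, f x ∂unitVol ≤ 0 := integral_nonpos_of_ae h6
  rw [hf.2] at h8
  linarith

end WaveletBasis

end

/-! ### Normalized sums: characteristic functions and exponential moments -/

section

section NormalizedSum

/-- The normalized sum `n^{-1/2} ∑_m Y(x_m)`. -/
noncomputable def normSum (n : ℕ) (Y : ℝ → ℝ) (x : Fin n → ℝ) : ℝ :=
  (√(n : ℝ))⁻¹ * ∑ m, Y (x m)

theorem measurable_normSum (n : ℕ) {Y : ℝ → ℝ} (hY : Measurable Y) : Measurable (normSum n Y) :=
  (Finset.measurable_sum _ fun m _ => hY.comp (measurable_pi_apply m)).const_mul _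

theorem normSum_sum {ι : Type*} (n : ℕ) (F : Finset ι) (u : ι → ℝ) (Y : ι → ℝ → ℝ)
    (x : Fin n → ℝ) :
    normSum n (fun y => ∑ p ∈ F, u p * Y p y) x = ∑ p ∈ F, u p * normSum n (Y p) x := by
  simp only [normSum, Finset.mul_sum]
  rw [Finset.sum_comm]
  exact Finset.sum_congr rfl fun p _ => Finset.sum_congr rfl fun m _ => by ring

variable {μ : Measure ℝ} [IsProbabilityMeasure μ] {Y : ℝ → ℝ}

theorem integral_cexp_normSum (n : ℕ) (hY : Measurable Y) :
    ∫ x, Complex.exp (normSum n Y x * Complex.I) ∂(Measure.pi fun _ : Fin n => μ)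
      = charFun (μ.map Y) (√(n : ℝ))⁻¹ ^ n := by
  rw [charFun_apply_real, integral_map hY.aemeasurable (by fun_prop)]
  have h := integral_fintype_prod_eq_pow (𝕜 := ℂ) (ι := Fin n) (μ := μ)
    fun y => Complex.exp ((√(n : ℝ))⁻¹ * Y y * Complex.I)
  rw [Fintype.card_fin] at h
  rw [← h]
  refine integral_congr_ae (Eventually.of_forall fun x => ?_)
  simp only [normSum, ← Complex.exp_sum]
  push_cast
  rw [Finset.mul_sum, Finset.sum_mul]

theorem tendsto_integral_cexp_normSum (hY : Measurable Y) (h2 : MemLp Y 2 μ)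
    (h0 : ∫ x, Y x ∂μ = 0) :
    Tendsto (fun n : ℕ => ∫ x, Complex.exp (normSum n Y x * Complex.I)
      ∂(Measure.pi fun _ : Fin n => μ)) atTop
      (𝓝 (Complex.exp (-((∫ x, Y x ^ 2 ∂μ : ℝ) : ℂ) / 2))) := by
  simp only [integral_cexp_normSum _ hY]
  set v := ∫ x, Y x ^ 2 ∂μ with hv
  have hv0 : 0 ≤ v := integral_nonneg fun x => sq_nonneg _
  -- The central limit theorem used below needs unit variance; a degenerate summand vanishes almost
  -- surely and is treated separately.
  rcases hv0.eq_or_lt with hz | hpos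
  · have hY0 : Y =ᵐ[μ] 0 := by
      have := (integral_eq_zero_iff_of_nonneg (fun x => sq_nonneg (Y x)) h2.integrable_sq).1
        hz.symm
      filter_upwards [this] with x hx
      simpa using hx
    have h1 : ∀ t, charFun (μ.map Y) t = 1 := fun t => by
      rw [charFun_apply_real, integral_map hY.aemeasurable (by fun_prop)]
      have : (fun x => Complex.exp (t * Y x * Complex.I)) =ᵐ[μ] fun _ => 1 := by
        filter_upwards [hY0] with x hx
        simp [hx]
      rw [integral_congr_ae this]
      simp
    simp [h1, ← hz]
  · have hs : 0 < √v := Real.sqrt_pos.2 hpos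
    have hm : Measurable fun x => Y x / √v := hY.div_const _
    have h3 := tendsto_charFun_inv_sqrt_mul_pow (P := μ) (X := fun x => Y x / √v) hm.aemeasurable
      (by rw [integral_div, h0, zero_div])
      (by
        simp only [Pi.pow_apply, div_pow, Real.sq_sqrt hv0]
        rw [integral_div, ← hv, div_self hpos.ne']) (√v)
    have h4 : ∀ t, charFun (μ.map fun x => Y x / √v) (t * √v) = charFun (μ.map Y) t := fun t => by
      rw [charFun_apply_real, integral_map hm.aemeasurable (by fun_prop),
        charFun_apply_real, integral_map hY.aemeasurable (by fun_prop)]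
      refine integral_congr_ae (Eventually.of_forall fun x => ?_)
      have : ((√v : ℝ) : ℂ) ≠ 0 := by exact_mod_cast hs.ne'
      simp only
      push_cast
      congr 1
      field_simp
    simp only [h4] at h3
    rwa [← Complex.ofReal_pow, Real.sq_sqrt hv0] at h3

theorem integrable_exp_normSum (n : ℕ) (hY : Measurable Y) {K : ℝ} (hK : ∀ᵐ x ∂μ, |Y x| ≤ K)
    (s : ℝ) :
    Integrable (fun x => Real.exp (s * normSum n Y x)) (Measure.pi fun _ : Fin n => μ) := by
  have h := Integrable.fintype_prod (ι := Fin n) (𝕜 := ℝ) (μ := fun _ => μ)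
    (f := fun _ y => Real.exp (s * (√(n : ℝ))⁻¹ * Y y)) fun _ =>
    Integrable.of_bound (by fun_prop) (Real.exp (|s * (√(n : ℝ))⁻¹| * K)) (hK.mono fun x hx => by
      rw [Real.norm_eq_abs, Real.abs_exp, Real.exp_le_exp]
      exact (le_abs_self _).trans (by
        rw [abs_mul]; exact mul_le_mul_of_nonneg_left hx (abs_nonneg _)))
  refine h.congr (Eventually.of_forall fun x => ?_)
  simp only [normSum, ← Real.exp_sum, ← Finset.mul_sum]
  ring_nf

/-- A Bernstein-type bound for the exponential moment of a normalized sum. -/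
theorem integral_exp_normSum_le {n : ℕ} (hY : Measurable Y) {K D s : ℝ}
    (hK : ∀ᵐ x ∂μ, |Y x| ≤ K) (h0 : ∫ x, Y x ∂μ = 0) (hD : ∫ x, Y x ^ 2 ∂μ ≤ D)
    (hs : |s| * (√(n : ℝ))⁻¹ * K ≤ 1) :
    ∫ x, Real.exp (s * normSum n Y x) ∂(Measure.pi fun _ : Fin n => μ) ≤ Real.exp (s ^ 2 * D) := by
  have hD0 : 0 ≤ D := (integral_nonneg fun x => sq_nonneg _).trans hD
  rcases Nat.eq_zero_or_pos n with rfl | hn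
  · have h1 : ∀ x : Fin 0 → ℝ, Real.exp (s * normSum 0 Y x) = 1 := fun x => by simp [normSum]
    simp only [h1, integral_const, probReal_univ, one_smul]
    exact Real.one_le_exp (by positivity)
  have hn' : (0 : ℝ) < n := by exact_mod_cast hn
  set r := s * (√(n : ℝ))⁻¹ with hr
  have hr1 : ∀ᵐ x ∂μ, |r * Y x| ≤ 1 := hK.mono fun x hx => by
    rw [abs_mul, hr, abs_mul, abs_of_nonneg (inv_nonneg.2 (Real.sqrt_nonneg (n : ℝ)))]
    exact (mul_le_mul_of_nonneg_left hx (by positivity)).trans hs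
  have h2 : MemLp Y 2 μ := MemLp.of_bound hY.aestronglyMeasurable K hK
  have hint : Integrable Y μ := h2.integrable one_le_two
  have hsq : Integrable (fun x => Y x ^ 2) μ := h2.integrable_sq
  have i1 : Integrable (fun x => 1 + r * Y x) μ := (integrable_const _).add (hint.const_mul r)
  have h := integral_fintype_prod_eq_pow (𝕜 := ℝ) (ι := Fin n) (μ := μ)
    fun y => Real.exp (r * Y y)
  rw [Fintype.card_fin] at h
  have h3 : ∫ x, Real.exp (s * normSum n Y x) ∂(Measure.pi fun _ : Fin n => μ)
      = (∫ x, Real.exp (r * Y x) ∂μ) ^ n := by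
    rw [← h]
    refine integral_congr_ae (Eventually.of_forall fun x => ?_)
    simp only [normSum, ← Real.exp_sum, ← Finset.mul_sum, hr]
    ring_nf
  -- From `e^u ≤ 1 + u + u²` for `|u| ≤ 1`; the linear term integrates to zero. The `n`-th power
  -- then costs `n r² D = s² D`.
  have h4 : ∫ x, Real.exp (r * Y x) ∂μ ≤ 1 + r ^ 2 * D := by
    calc ∫ x, Real.exp (r * Y x) ∂μ ≤ ∫ x, (1 + r * Y x) + r ^ 2 * Y x ^ 2 ∂μ := by
          refine integral_mono_of_nonneg (Eventually.of_forall fun x => (Real.exp_pos _).le)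
            (i1.add (hsq.const_mul _)) ?_
          filter_upwards [hr1] with x hx
          have := (abs_le.1 (Real.abs_exp_sub_one_sub_id_le hx)).2
          nlinarith
      _ = 1 + r ^ 2 * ∫ x, Y x ^ 2 ∂μ := by
          rw [integral_add i1 (hsq.const_mul _),
            integral_add (integrable_const _) (hint.const_mul r), integral_const_mul,
            integral_const_mul, h0]
          simp
      _ ≤ _ := by gcongr
  have h5 : r ^ 2 * D * n = s ^ 2 * D := by
    rw [hr, mul_pow, inv_pow, Real.sq_sqrt hn'.le]
    field_simp
  rw [h3]
  calc (∫ x, Real.exp (r * Y x) ∂μ) ^ n ≤ Real.exp (r ^ 2 * D) ^ n := by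
        refine pow_le_pow_left₀ (integral_nonneg fun x => (Real.exp_pos _).le) (h4.trans ?_) n
        have := Real.add_one_le_exp (r ^ 2 * D)
        linarith
    _ = _ := by rw [← Real.exp_nat_mul, ← h5]; ring_nf

end NormalizedSum

end

/-! ### Finite-dimensional convergence of the empirical process -/

section

theorem IsDensity.isProbabilityMeasure_samplingModel {f : L2} (hf : IsDensity f) (n : ℕ) :
    IsProbabilityMeasure (samplingModel n f) := by
  have := hf.isProbabilityMeasure
  unfold samplingModel
  infer_instance

theorem sum_lowIdx_eq {J₀ N : ℕ} (u : LowIdx J₀ N → ℝ) (g : Idx J₀ → ℝ) :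
    ∑ p ∈ Finset.univ.map (Function.Embedding.subtype fun p : Idx J₀ => p.1 < N),
      (if h : p.1 < N then u ⟨p, h⟩ else 0) * g p = ∑ p, u p * g p.1 := by
  rw [Finset.sum_map]
  exact Finset.sum_congr rfl fun p _ => congrArg (· * g p.1) (dif_pos p.2)

/-- The logarithm of the number of locations grows linearly in the level, against the geometric
factor `2^{-l/2}`. -/
theorem summable_log_levelCard (J₀ : ℕ) (r c : ℝ) :
    Summable fun i : ℕ => r * (Real.log (levelCard J₀ i) + c) * levelRate J₀ i := by
  set q : ℝ := (2 : ℝ) ^ (-(1 / 2) : ℝ) with hq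
  have hq0 : 0 < q := by positivity
  have hq1 : q < 1 := Real.rpow_lt_one_of_one_lt_of_neg one_lt_two (by norm_num)
  have hrate : ∀ i, levelRate J₀ i = (2 : ℝ) ^ (-((J₀ : ℝ) - 1) / 2) * q ^ i := fun i => by
    rw [hq, ← Real.rpow_natCast, ← Real.rpow_mul zero_le_two, ← Real.rpow_add two_pos, levelRate,
      level]
    push_cast
    ring_nf
  have hlog : ∀ i, |Real.log (levelCard J₀ i)| ≤ J₀ + i := fun i => by
    have h1 : (1 : ℝ) ≤ levelCard J₀ i := by exact_mod_cast levelCard_pos J₀ i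
    have h2 : (levelCard J₀ i : ℝ) ≤ 2 ^ (J₀ + i) := by
      have : levelCard J₀ i ≤ 2 ^ (J₀ + i) := by
        cases i with
        | zero => simp [levelCard]
        | succ i => exact Nat.pow_le_pow_right two_pos (by omega)
      exact_mod_cast this
    rw [abs_of_nonneg (Real.log_nonneg h1)]
    refine (Real.log_le_log (by linarith) h2).trans ?_
    rw [Real.log_pow]
    push_cast
    have := Real.log_two_lt_d9
    have h3 : (0 : ℝ) ≤ J₀ + i := by positivity
    nlinarith
  have hs1 : Summable fun i : ℕ => (i : ℝ) ^ 1 * q ^ i :=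
    summable_pow_mul_geometric_of_norm_lt_one 1 (by rwa [Real.norm_of_nonneg hq0.le])
  have hs0 : Summable fun i : ℕ => q ^ i := summable_geometric_of_lt_one hq0.le hq1
  refine Summable.of_norm_bounded
    (g := fun i : ℕ => |r| * (2 : ℝ) ^ (-((J₀ : ℝ) - 1) / 2) * ((i : ℝ) ^ 1 * q ^ i)
      + |r| * (2 : ℝ) ^ (-((J₀ : ℝ) - 1) / 2) * (J₀ + |c|) * q ^ i)
    ((hs1.mul_left _).add (hs0.mul_left _)) fun i => ?_
  rw [hrate, norm_mul, norm_mul, Real.norm_eq_abs, Real.norm_eq_abs, Real.norm_of_nonneg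
    (by positivity : (0 : ℝ) ≤ (2 : ℝ) ^ (-((J₀ : ℝ) - 1) / 2) * q ^ i)]
  have h1 : |Real.log (levelCard J₀ i) + c| ≤ J₀ + i + |c| :=
    (abs_add_le _ _).trans (add_le_add (hlog i) le_rfl)
  calc _ ≤ |r| * (J₀ + i + |c|) * ((2 : ℝ) ^ (-((J₀ : ℝ) - 1) / 2) * q ^ i) := by gcongr
    _ = _ := by ring

namespace WaveletBasis

variable {J₀ : ℕ} (B : WaveletBasis J₀) {w : AdmissibleWeight J₀} {f : L2}

/-- The empirical process `√n (P_n - P) ψ_p` of the wavelets, where `P` has density `f`. -/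
noncomputable def empDeviation (f : L2) (n : ℕ) (x : Fin n → ℝ) (p : Idx J₀) : ℝ :=
  normSum n (B.centred f p) x

theorem measurable_empDeviation (f : L2) (n : ℕ) : Measurable (B.empDeviation f n) :=
  measurable_pi_lambda _ fun p => measurable_normSum n (B.measurable_centred f p)

/-- Cramér–Wold: a linear combination of coordinates is a normalized sum of one bounded centred
function, whose variance is that of the bridge. -/
theorem tendsto_charFun_empDeviation (hf : IsDensity f) {M : NNReal}
    (ha : ∀ p, ‖B.bridgeSeq hf p‖₊ ≤ M) (F : Finset (Idx J₀)) (u : Idx J₀ → ℝ) :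
    Tendsto (fun n : ℕ => ∫ x, Complex.exp ((∑ p ∈ F, u p * B.empDeviation f n x p : ℝ) * Complex.I)
      ∂(samplingModel n f)) atTop
      (𝓝 (∫ x, Complex.exp ((∑ p ∈ F, u p * x.coord p : ℝ) * Complex.I)
        ∂(gaussLaw w (B.bridgeSeq hf)))) := by
  have := hf.isProbabilityMeasure
  have hm : Measurable fun x : MZero w => ∑ p ∈ F, u p * x.coord p :=
    Finset.measurable_sum _ fun p _ => ((measurable_pi_apply p).comp MZero.measurable_coord).const_mul _
  have h1 : ∫ x, Complex.exp ((∑ p ∈ F, u p * x.coord p : ℝ) * Complex.I)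
        ∂(gaussLaw w (B.bridgeSeq hf))
      = Complex.exp (-((∫ x, (∑ p ∈ F, u p * B.centred f p x) ^ 2 ∂(densityLaw f) : ℝ) : ℂ) / 2) := by
    have h2 : charFun ((gaussLaw w (B.bridgeSeq hf)).map fun x => ∑ p ∈ F, u p * x.coord p) 1
        = ∫ x, Complex.exp ((∑ p ∈ F, u p * x.coord p : ℝ) * Complex.I)
          ∂(gaussLaw w (B.bridgeSeq hf)) := by
      rw [charFun_apply_real, integral_map hm.aemeasurable (by fun_prop)]
      simp
    rw [← h2, map_sum_coord_gaussLaw ha, charFun_gaussianReal, ← B.norm_sum_bridgeSeq_sq hf]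
    congr 1
    push_cast
    ring
  rw [h1]
  have h3 := tendsto_integral_cexp_normSum (μ := densityLaw f)
    (Y := fun x => ∑ p ∈ F, u p * B.centred f p x)
    (Finset.measurable_sum _ fun p _ => (B.measurable_centred f p).const_mul _)
    (memLp_finsetSum _ fun p _ => (B.memLp_centred hf p 2).const_mul _)
    (by
      rw [integral_finsetSum _ fun p _ =>
        ((B.memLp_centred hf p 1).integrable le_rfl).const_mul _]
      simp only [integral_const_mul, B.integral_centred hf, mul_zero, Finset.sum_const_zero])
  simp only [normSum_sum] at h3
  exact h3

theorem tendsto_integral_trunc_empDeviation (hf : IsDensity f) {M : NNReal}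
    (ha : ∀ p, ‖B.bridgeSeq hf p‖₊ ≤ M) {Φ : MZero w → ℝ} (hΦ : Continuous Φ)
    (hb : ∀ x, |Φ x| ≤ 1) (N : ℕ) :
    Tendsto (fun n : ℕ => ∫ x, Φ (MZero.trunc w N (B.empDeviation f n x)) ∂(samplingModel n f))
      atTop (𝓝 (∫ x, Φ (MZero.trunc w N x.coord) ∂(gaussLaw w (B.bridgeSeq hf)))) := by
  have := hf.isProbabilityMeasure_samplingModel
  have hg := isProbabilityMeasure_gaussLaw (w := w) ha
  let X : ∀ n : ℕ, (Fin n → ℝ) → EuclideanSpace ℝ (LowIdx J₀ N) := fun n x =>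
    WithLp.toLp 2 fun p => B.empDeviation f n x p.1
  let Z : MZero w → EuclideanSpace ℝ (LowIdx J₀ N) := fun x => WithLp.toLp 2 fun p => x.coord p.1
  have hX : ∀ n, Measurable (X n) := fun n =>
    (WithLp.measurable_toLp 2 _).comp
      (measurable_pi_lambda _ fun p => measurable_normSum n (B.measurable_centred f p.1))
  have hZ : Measurable Z := (WithLp.measurable_toLp 2 _).comp
    (measurable_pi_lambda _ fun p => (measurable_pi_apply p.1).comp MZero.measurable_coord)
  let μ : ℕ → ProbabilityMeasure (EuclideanSpace ℝ (LowIdx J₀ N)) := fun n =>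
    ⟨(samplingModel n f).map (X n), Measure.isProbabilityMeasure_map (hX n).aemeasurable⟩
  let ν : ProbabilityMeasure (EuclideanSpace ℝ (LowIdx J₀ N)) :=
    ⟨(gaussLaw w (B.bridgeSeq hf)).map Z, Measure.isProbabilityMeasure_map hZ.aemeasurable⟩
  have hlim : Tendsto μ atTop (𝓝 ν) := by
    refine ProbabilityMeasure.tendsto_of_tendsto_charFun fun u => ?_
    have h := B.tendsto_charFun_empDeviation (w := w) hf ha
      (Finset.univ.map (Function.Embedding.subtype fun p : Idx J₀ => p.1 < N))
      (fun p => if h : p.1 < N then u ⟨p, h⟩ else 0)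
    simp only [sum_lowIdx_eq] at h
    have h1 : charFun (ν : Measure (EuclideanSpace ℝ (LowIdx J₀ N))) u
        = ∫ x, Complex.exp ((∑ p, u p * x.coord p.1 : ℝ) * Complex.I)
          ∂(gaussLaw w (B.bridgeSeq hf)) := by
      change charFun ((gaussLaw w (B.bridgeSeq hf)).map Z) u = _
      rw [charFun_apply, integral_map hZ.aemeasurable (by fun_prop)]
      simp only [PiLp.inner_apply, RCLike.inner_apply, conj_trivial, Z]
    have h2 : ∀ n, charFun (μ n : Measure (EuclideanSpace ℝ (LowIdx J₀ N))) u
        = ∫ x, Complex.exp ((∑ p, u p * B.empDeviation f n x p.1 : ℝ) * Complex.I)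
          ∂(samplingModel n f) := fun n => by
      change charFun ((samplingModel n f).map (X n)) u = _
      rw [charFun_apply, integral_map (hX n).aemeasurable (by fun_prop)]
      simp only [PiLp.inner_apply, RCLike.inner_apply, conj_trivial, X]
    rw [h1]
    simpa only [h2] using h
  have hcont : Continuous fun y : EuclideanSpace ℝ (LowIdx J₀ N) =>
      Φ (MZero.extendLow w N y.ofLp) :=
    hΦ.comp ((MZero.continuous_extendLow N).comp (PiLp.continuous_ofLp 2 _))
  have h := ProbabilityMeasure.tendsto_iff_forall_integral_tendsto.1 hlim
    (BoundedContinuousFunction.ofNormedAddCommGroup _ hcont 1 fun y => hb _)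
  have h1 : ∫ y, Φ (MZero.extendLow w N y.ofLp) ∂(ν : Measure (EuclideanSpace ℝ (LowIdx J₀ N)))
      = ∫ x, Φ (MZero.trunc w N x.coord) ∂(gaussLaw w (B.bridgeSeq hf)) :=
    integral_map hZ.aemeasurable hcont.aestronglyMeasurable
  have h2 : ∀ n, ∫ y, Φ (MZero.extendLow w N y.ofLp)
        ∂(μ n : Measure (EuclideanSpace ℝ (LowIdx J₀ N)))
      = ∫ x, Φ (MZero.trunc w N (B.empDeviation f n x)) ∂(samplingModel n f) := fun n =>
    integral_map (hX n).aemeasurable hcont.aestronglyMeasurable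
  rw [← h1]
  simp only [← h2]
  exact h

end WaveletBasis

end

/-! ### Maximal bounds on high levels and the bias of the empirical centring -/

section

namespace WaveletBasis

variable {J₀ : ℕ} (B : WaveletBasis J₀) {w : AdmissibleWeight J₀} {f : L2}

/-- A soft-max bound for the empirical process on the `i`-th level. -/
noncomputable def softMax (f : L2) (s : ℝ) (n i : ℕ) (x : Fin n → ℝ) : ℝ :=
  s⁻¹ * (Real.log (levelCard J₀ i) + (levelCard J₀ i : ℝ)⁻¹ *
    ∑ k : Fin (levelCard J₀ i), (Real.exp (s * B.empDeviation f n x ⟨i, k⟩)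
      + Real.exp (-s * B.empDeviation f n x ⟨i, k⟩)))

theorem softMax_nonneg (f : L2) {s : ℝ} (hs : 0 < s) (n i : ℕ) (x : Fin n → ℝ) :
    0 ≤ B.softMax f s n i x := by
  have : (1 : ℝ) ≤ levelCard J₀ i := by exact_mod_cast levelCard_pos J₀ i
  have := Real.log_nonneg this
  unfold softMax
  positivity

/-- Apply `y + 1 ≤ e^y` to `y = s |U| - log m`, with `m` the number of locations, and bound
`e^{s|U|}` by the sum over the level. The result is linear in exponential moments, so its
expectation is immediate. -/
theorem abs_empDeviation_le_softMax (f : L2) {s : ℝ} (hs : 0 < s) (n : ℕ) (x : Fin n → ℝ)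
    (p : Idx J₀) : |B.empDeviation f n x p| ≤ B.softMax f s n p.1 x := by
  obtain ⟨i, k⟩ := p
  have hc : (0 : ℝ) < levelCard J₀ i := by exact_mod_cast levelCard_pos J₀ i
  rw [softMax, ← div_eq_inv_mul, le_div_iff₀ hs]
  set U := B.empDeviation f n x ⟨i, k⟩ with hU
  have h1 : Real.exp (|U| * s) ≤ Real.exp (s * U) + Real.exp (-s * U) := by
    rcases abs_choice U with h | h <;> rw [h]
    · rw [mul_comm]; linarith [Real.exp_pos (-s * U)]
    · rw [show -U * s = -s * U by ring]; linarith [Real.exp_pos (s * U)]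
  have h2 := Finset.single_le_sum (f := fun k => Real.exp (s * B.empDeviation f n x ⟨i, k⟩)
      + Real.exp (-s * B.empDeviation f n x ⟨i, k⟩)) (fun k _ => by positivity) (Finset.mem_univ k)
  have h3 := Real.add_one_le_exp (|U| * s - Real.log (levelCard J₀ i))
  rw [Real.exp_sub, Real.exp_log hc, div_eq_inv_mul] at h3
  have h4 := mul_le_mul_of_nonneg_left (h1.trans h2) (inv_nonneg.2 hc.le)
  simp only at h4 ⊢
  linarith

/-- Bound for the expectation of `softMax`. -/
noncomputable def softMaxBound (J₀ : ℕ) (D s : ℝ) (i : ℕ) : ℝ :=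
  s⁻¹ * (Real.log (levelCard J₀ i) + 2 * Real.exp (s ^ 2 * D))

theorem softMaxBound_nonneg (D : ℝ) {s : ℝ} (hs : 0 < s) (i : ℕ) : 0 ≤ softMaxBound J₀ D s i := by
  have : (1 : ℝ) ≤ levelCard J₀ i := by exact_mod_cast levelCard_pos J₀ i
  have := Real.log_nonneg this
  unfold softMaxBound
  positivity

theorem integrable_exp_empDeviation (hf : IsDensity f) (n : ℕ) (s : ℝ) (p : Idx J₀) :
    Integrable (fun x => Real.exp (s * B.empDeviation f n x p)) (samplingModel n f) := by
  have := hf.isProbabilityMeasure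
  exact integrable_exp_normSum n (B.measurable_centred f p)
    ((ae_densityLaw_mem_Icc f).mono fun x hx => B.abs_centred_le hf p hx) s

theorem integral_exp_empDeviation_le (hf : IsDensity f) {D : ℝ} (hD : ∀ᵐ x ∂unitVol, f x ≤ D)
    {n : ℕ} {s : ℝ} {p : Idx J₀}
    (hs : |s| * (√(n : ℝ))⁻¹ * (2 * B.supConst * (2 : ℝ) ^ ((p.lev : ℝ) / 2)) ≤ 1) :
    ∫ x, Real.exp (s * B.empDeviation f n x p) ∂(samplingModel n f) ≤ Real.exp (s ^ 2 * D) := by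
  have := hf.isProbabilityMeasure
  exact integral_exp_normSum_le (B.measurable_centred f p)
    ((ae_densityLaw_mem_Icc f).mono fun x hx => B.abs_centred_le hf p hx)
    (B.integral_centred hf p) (B.integral_centred_sq_le hf hD p) hs

theorem integrable_softMax (hf : IsDensity f) (s : ℝ) (n i : ℕ) :
    Integrable (B.softMax f s n i) (samplingModel n f) := by
  have := hf.isProbabilityMeasure_samplingModel n
  refine ((integrable_const _).add (Integrable.const_mul (integrable_finsetSum _ fun k _ => ?_)
    _)).const_mul _
  exact (B.integrable_exp_empDeviation hf n s _).add (B.integrable_exp_empDeviation hf n (-s) _)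

theorem integral_softMax_le (hf : IsDensity f) {D : ℝ} (hD : ∀ᵐ x ∂unitVol, f x ≤ D)
    {n i : ℕ} {s : ℝ} (hs0 : 0 < s)
    (hs : s * (√(n : ℝ))⁻¹ * (2 * B.supConst * (2 : ℝ) ^ ((level J₀ i : ℝ) / 2)) ≤ 1) :
    ∫ x, B.softMax f s n i x ∂(samplingModel n f) ≤ softMaxBound J₀ D s i := by
  have := hf.isProbabilityMeasure_samplingModel n
  have hc : (0 : ℝ) < levelCard J₀ i := by exact_mod_cast levelCard_pos J₀ i
  have hint : ∀ k : Fin (levelCard J₀ i), Integrable (fun x =>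
      Real.exp (s * B.empDeviation f n x ⟨i, k⟩) + Real.exp (-s * B.empDeviation f n x ⟨i, k⟩))
      (samplingModel n f) := fun k =>
    (B.integrable_exp_empDeviation hf n s _).add (B.integrable_exp_empDeviation hf n (-s) _)
  have h1 : ∀ k : Fin (levelCard J₀ i), ∫ x, (Real.exp (s * B.empDeviation f n x ⟨i, k⟩)
      + Real.exp (-s * B.empDeviation f n x ⟨i, k⟩)) ∂(samplingModel n f)
      ≤ 2 * Real.exp (s ^ 2 * D) := fun k => by
    rw [integral_add (B.integrable_exp_empDeviation hf n s _)
      (B.integrable_exp_empDeviation hf n (-s) _), two_mul]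
    refine add_le_add (B.integral_exp_empDeviation_le hf hD ?_) ?_
    · rwa [abs_of_pos hs0]
    · have := B.integral_exp_empDeviation_le (n := n) (s := -s) (p := ⟨i, k⟩) hf hD
        (by rwa [abs_neg, abs_of_pos hs0])
      rwa [neg_sq] at this
  unfold softMax softMaxBound
  rw [integral_const_mul, integral_add (integrable_const _)
    ((integrable_finsetSum _ fun k _ => hint k).const_mul _), integral_const_mul,
    integral_finsetSum _ fun k _ => hint k, integral_const, probReal_univ, one_smul]
  refine mul_le_mul_of_nonneg_left (add_le_add le_rfl ?_) (inv_nonneg.2 hs0.le)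
  rw [inv_mul_le_iff₀ hc]
  refine (Finset.sum_le_sum fun k _ => h1 k).trans ?_
  simp

/-- Replaces tightness: the levels between `N` and `m` contribute to the primitive, in expected
sup-norm, no more than the corresponding piece of a convergent series. -/
theorem integral_norm_trunc_sub_trunc_le (hw : Summable fun i : ℕ => w.at i * levelRate J₀ i)
    (hf : IsDensity f) {D : ℝ} (hD : ∀ᵐ x ∂unitVol, f x ≤ D) {n N m : ℕ} (hNm : N ≤ m) {s : ℝ}
    (hs0 : 0 < s) (hs : ∀ i < m,
      s * (√(n : ℝ))⁻¹ * (2 * B.supConst * (2 : ℝ) ^ ((level J₀ i : ℝ) / 2)) ≤ 1) :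
    Integrable (fun x => ‖B.primitiveCLM hw (MZero.trunc w m (B.empDeviation f n x)
        - MZero.trunc w N (B.empDeviation f n x))‖) (samplingModel n f) ∧
      ∫ x, ‖B.primitiveCLM hw (MZero.trunc w m (B.empDeviation f n x)
        - MZero.trunc w N (B.empDeviation f n x))‖ ∂(samplingModel n f)
      ≤ B.primitiveConst * ∑ i ∈ Finset.Ico N m, softMaxBound J₀ D s i * levelRate J₀ i := by
  have := hf.isProbabilityMeasure_samplingModel n
  have hb : ∀ x, ‖B.primitiveCLM hw (MZero.trunc w m (B.empDeviation f n x)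
        - MZero.trunc w N (B.empDeviation f n x))‖
      ≤ B.primitiveConst * ∑ i ∈ Finset.Ico N m, B.softMax f s n i x * levelRate J₀ i := fun x => by
    refine B.norm_primitiveCLM_le_sum hw (fun p hp => ?_) (fun i => B.softMax_nonneg f hs0 n i x)
      fun p => ?_
    · rw [Finset.mem_Ico, not_and, not_lt] at hp
      rw [MZero.coord_sub, MZero.coord_trunc, MZero.coord_trunc]
      by_cases h : p.1 < N
      · rw [if_pos h, if_pos (h.trans_le hNm), sub_self]
      · rw [if_neg h, if_neg (not_lt.2 (hp (not_lt.1 h))), sub_zero]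
    · have h1 := B.abs_empDeviation_le_softMax f hs0 n x p
      have h2 := B.softMax_nonneg f hs0 n p.1 x
      rw [MZero.coord_sub, MZero.coord_trunc, MZero.coord_trunc]
      split_ifs <;> simp only [sub_self, sub_zero, zero_sub, abs_neg, abs_zero] <;> assumption
  have hint : ∀ i ∈ Finset.Ico N m, Integrable (fun x => B.softMax f s n i x * levelRate J₀ i)
      (samplingModel n f) := fun i _ => (B.integrable_softMax hf s n i).mul_const _
  have hint2 := (integrable_finsetSum _ hint).const_mul B.primitiveConst
  have hmeas : Measurable fun x => ‖B.primitiveCLM hw (MZero.trunc w m (B.empDeviation f n x)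
        - MZero.trunc w N (B.empDeviation f n x))‖ := by
    have hc : Continuous fun y : Idx J₀ → ℝ => ‖B.primitiveCLM hw (MZero.trunc w m y
        - MZero.trunc w N y)‖ :=
      ((B.primitiveCLM hw).continuous.comp
        ((MZero.continuous_trunc m).sub (MZero.continuous_trunc N))).norm
    exact hc.measurable.comp (B.measurable_empDeviation f n)
  refine ⟨hint2.mono' hmeas.aestronglyMeasurable (Eventually.of_forall fun x => ?_), ?_⟩
  · rw [norm_norm]; exact hb x
  · refine (integral_mono_of_nonneg (Eventually.of_forall fun x => norm_nonneg _) hint2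
      (Eventually.of_forall hb)).trans ?_
    rw [integral_const_mul, integral_finsetSum _ hint]
    refine mul_le_mul_of_nonneg_left (Finset.sum_le_sum fun i hi => ?_) B.primitiveConst_nonneg
    rw [integral_mul_const]
    exact mul_le_mul_of_nonneg_right
      (B.integral_softMax_le hf hD hs0 (hs i (Finset.mem_Ico.1 hi).2)) (levelRate_pos J₀ i).le

theorem repr_empiricalProj (j n : ℕ) (x : Fin n → ℝ) (p : Idx J₀) :
    B.basis.repr (B.empiricalProj j n x) p
      = if level J₀ p.1 ≤ (j : ℤ) then (n : ℝ)⁻¹ * ∑ m, B.ψ p (x m) else 0 := by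
  classical
  have h1 : ∀ q : Idx J₀, (B.basis.repr (B.basis q) : Idx J₀ → ℝ) p = if q = p then 1 else 0 :=
    fun q => by
      rw [B.basis.repr_self, lp.single_apply]
      by_cases h : q = p
      · subst h; simp
      · rw [if_neg h, Pi.single_eq_of_ne (Ne.symm h)]
  have h2 : B.empiricalProj j n x = ∑ q ∈ ((Finset.range (j + 2)).filter fun i =>
      level J₀ i ≤ (j : ℤ)).sigma fun i => (Finset.univ : Finset (Fin (levelCard J₀ i))),
      ((n : ℝ)⁻¹ * ∑ m, B.ψ q (x m)) • B.basis q := by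
    rw [Finset.sum_sigma]; rfl
  rw [h2, map_sum]
  simp only [map_smul, lp.coeFn_sum, Finset.sum_apply, lp.coeFn_smul, Pi.smul_apply, h1,
    smul_eq_mul, mul_ite, mul_one, mul_zero, Finset.sum_ite_eq', Finset.mem_sigma,
    Finset.mem_filter, Finset.mem_range, Finset.mem_univ, and_true]
  refine if_congr ⟨fun h => h.2, fun h => ⟨?_, h⟩⟩ rfl rfl
  unfold level at h
  omega

/-- The empirical centring is the truncated empirical process plus a bias. -/
theorem sqrt_smul_empiricalProj_sub (hf : IsDensity f) {n : ℕ} (hn : 0 < n) (j : ℕ)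
    (x : Fin n → ℝ) :
    √(n : ℝ) • (B.embed w (B.empiricalProj j n x) - B.embed w f)
      = MZero.trunc w (j + 2 - J₀) (B.empDeviation f n x)
        + √(n : ℝ) • (MZero.trunc w (j + 2 - J₀) (B.basis.repr f) - B.embed w f) := by
  apply MZero.coord_injective
  funext p
  -- The `i`-th level is `J₀ - 1 + i`, so levels up to `j` are the first `j + 2 - J₀`; truncated
  -- subtraction is harmless, since there are none when `j + 2 ≤ J₀`.
  have hlev : level J₀ p.1 ≤ (j : ℤ) ↔ p.1 < j + 2 - J₀ := by unfold level; omega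
  rw [MZero.coord_add, MZero.coord_smul, MZero.coord_smul, MZero.coord_sub, MZero.coord_sub,
    MZero.coord_trunc, MZero.coord_trunc, coord_embed, coord_embed, B.repr_empiricalProj,
    if_congr hlev rfl rfl]
  split_ifs
  · have hs : (0 : ℝ) < √(n : ℝ) := Real.sqrt_pos.2 (by exact_mod_cast hn)
    have hss : (n : ℝ) = √(n : ℝ) * √(n : ℝ) := (Real.mul_self_sqrt n.cast_nonneg).symm
    simp only [empDeviation, normSum, centred, B.integral_ψ_densityLaw hf.1, Finset.sum_sub_distrib,
      Finset.sum_const, Finset.card_univ, Fintype.card_fin, nsmul_eq_mul, sub_self, mul_zero,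
      add_zero, mul_sub]
    congr 1
    · rw [← mul_assoc]
      congr 1
      nth_rewrite 2 [hss]
      rw [mul_inv, ← mul_assoc, mul_inv_cancel₀ hs.ne', one_mul]
    · rw [← mul_assoc]
      congr 1
      nth_rewrite 3 [hss]
      rw [← mul_assoc, inv_mul_cancel₀ hs.ne', one_mul]
  · ring

/-- Only levels beyond `j` survive; there the Hölder bound on coefficients is at its worst at `j`,
and the weights are at least `w_j`. -/
theorem norm_bias_le {γ C : ℝ} (hγ : 0 ≤ γ) (hC : ∀ p : Idx J₀,
      (2 : ℝ) ^ ((p.lev : ℝ) * (γ + 1 / 2)) * |B.basis.repr f p| ≤ C) {j : ℕ}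
    (hj : (J₀ : ℤ) - 1 ≤ j) (n : ℕ) :
    ‖√(n : ℝ) • (MZero.trunc w (j + 2 - J₀) (B.basis.repr f) - B.embed w f)‖
      ≤ C * (√(n : ℝ) * (2 : ℝ) ^ (-(j : ℝ) * (γ + 1 / 2)) / w.w j) := by
  have hC0 : 0 ≤ C := le_trans (by positivity) (hC (Classical.arbitrary _))
  have hwj : 0 < w.w j := one_pos.trans_le (w.one_le _ hj)
  refine MZero.norm_le_of_abs_coord_le fun p => ?_
  have hwp := w.at_pos p.1
  rw [MZero.coord_smul, MZero.coord_sub, MZero.coord_trunc, coord_embed]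
  split_ifs with h
  · rw [sub_self, mul_zero, abs_zero]
    positivity
  · have hlev : (j : ℤ) ≤ level J₀ p.1 := by unfold level; omega
    have hle : w.w j ≤ w.at p.1 := w.mono hj (hj.trans hlev) hlev
    have h1 : |B.basis.repr f p| ≤ C * (2 : ℝ) ^ (-(j : ℝ) * (γ + 1 / 2)) := by
      have h2 : (2 : ℝ) ^ ((j : ℝ) * (γ + 1 / 2)) * |B.basis.repr f p| ≤ C := by
        refine le_trans (mul_le_mul_of_nonneg_right ?_ (abs_nonneg _)) (hC p)
        refine Real.rpow_le_rpow_of_exponent_le one_le_two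
          (mul_le_mul_of_nonneg_right ?_ (by positivity))
        have : ((j : ℤ) : ℝ) ≤ (p.lev : ℝ) := by exact_mod_cast hlev
        simpa using this
      rw [neg_mul, Real.rpow_neg zero_le_two, ← div_eq_mul_inv, le_div_iff₀ (by positivity),
        mul_comm]
      exact h2
    rw [zero_sub, mul_neg, abs_neg, abs_mul, abs_of_nonneg (Real.sqrt_nonneg _)]
    calc √(n : ℝ) * |B.basis.repr f p|
        ≤ √(n : ℝ) * (C * (2 : ℝ) ^ (-(j : ℝ) * (γ + 1 / 2))) := by gcongr
      _ = C * (√(n : ℝ) * (2 : ℝ) ^ (-(j : ℝ) * (γ + 1 / 2)) / w.w j) * w.w j := by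
          field_simp
      _ ≤ _ := by gcongr

/-- While `j n < b`, the bias rate is at least `√n` times a positive constant depending on `b`,
which cannot tend to zero. -/
theorem tendsto_resolution_level (w : AdmissibleWeight J₀) {γ : ℝ} (hγ : 0 ≤ γ) {j : ℕ → ℕ}
    (hj : ∀ n, (J₀ : ℤ) - 1 ≤ j n)
    (hlim : Tendsto (fun n : ℕ => √(n : ℝ) * (2 : ℝ) ^ (-(j n : ℝ) * (γ + 1 / 2)) / w.w (j n))
      atTop (𝓝 0)) : Tendsto j atTop atTop := by
  refine tendsto_atTop.2 fun b => ?_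
  by_cases hb : (J₀ : ℤ) - 1 ≤ b
  · have hwb : 0 < w.w b := one_pos.trans_le (w.one_le _ hb)
    have h1 : Tendsto (fun n : ℕ => √(n : ℝ) * ((2 : ℝ) ^ (-(b : ℝ) * (γ + 1 / 2)) / w.w b))
        atTop atTop :=
      (Real.tendsto_sqrt_atTop.comp tendsto_natCast_atTop_atTop).atTop_mul_const (by positivity)
    filter_upwards [h1.eventually_ge_atTop 1, hlim.eventually (gt_mem_nhds one_pos)] with n h2 h3
    by_contra! hlt
    have hwj : 0 < w.w (j n) := one_pos.trans_le (w.one_le _ (hj n))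
    have hle : w.w (j n) ≤ w.w b := w.mono (hj n) hb (by exact_mod_cast hlt.le)
    refine absurd (h2.trans ?_) (not_le.2 h3)
    rw [mul_div_assoc]
    refine mul_le_mul_of_nonneg_left (div_le_div₀ (by positivity) ?_ hwj hle) (Real.sqrt_nonneg _)
    refine Real.rpow_le_rpow_of_exponent_le one_le_two
      (mul_le_mul_of_nonneg_right ?_ (by positivity))
    have : (j n : ℝ) ≤ b := by exact_mod_cast hlt.le
    linarith
  · refine Eventually.of_forall fun n => ?_
    have := hj n
    omega

end WaveletBasis

end

/-! ### The limit law for the projected empirical measure -/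

section

namespace WaveletBasis

variable {J₀ : ℕ} (B : WaveletBasis J₀) {w : AdmissibleWeight J₀} {f : L2}

theorem tendsto_integral_trunc_gaussLaw {a : Idx J₀ → SeqL2 J₀} {M : NNReal}
    (ha : ∀ p, ‖a p‖₊ ≤ M) {Φ : MZero w → ℝ} (hΦ : Continuous Φ) (hb : ∀ x, |Φ x| ≤ 1) :
    Tendsto (fun N => ∫ x, Φ (MZero.trunc w N x.coord) ∂(gaussLaw w a)) atTop
      (𝓝 (∫ x, Φ x ∂(gaussLaw w a))) := by
  have := isProbabilityMeasure_gaussLaw (w := w) ha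
  refine tendsto_integral_of_dominated_convergence (fun _ => 1) (fun N => ?_)
    (integrable_const _) (fun N => Eventually.of_forall fun x => hb _)
    (Eventually.of_forall fun x => (hΦ.tendsto x).comp (MZero.tendsto_trunc x))
  exact (hΦ.measurable.comp
    ((MZero.measurable_trunc N).comp MZero.measurable_coord)).aestronglyMeasurable

theorem two_rpow_level_le_sqrt {l : ℤ} {j : ℕ} (hl : l ≤ j) {y : ℝ} (hy : (2 : ℝ) ^ j ≤ y) :
    (2 : ℝ) ^ ((l : ℝ) / 2) ≤ √y := by
  refine Real.le_sqrt_of_sq_le (le_trans ?_ hy)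
  rw [← Real.rpow_natCast, ← Real.rpow_mul zero_le_two, ← Real.rpow_natCast]
  refine Real.rpow_le_rpow_of_exponent_le one_le_two ?_
  have : (l : ℝ) ≤ ((j : ℤ) : ℝ) := by exact_mod_cast hl
  push_cast at this ⊢
  linarith

theorem abs_integral_empirical_sub_le (hw : Summable fun i : ℕ => w.at i * levelRate J₀ i)
    (hf : IsDensity f) {D : ℝ} (hD : ∀ᵐ x ∂unitVol, f x ≤ D) {n N m : ℕ} (hNm : N ≤ m) {s : ℝ}
    (hs0 : 0 < s) (hs : ∀ i < m,
      s * (√(n : ℝ))⁻¹ * (2 * B.supConst * (2 : ℝ) ^ ((level J₀ i : ℝ) / 2)) ≤ 1)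
    {φ : ℝ → ℝ} (hφ : ∀ z, |φ z| ≤ 1) {K : ℝ} (hK0 : 0 ≤ K)
    (hK : ∀ y z, |φ y - φ z| ≤ K * |y - z|) (hφc : Continuous φ) (v : MZero w) :
    |∫ x, φ ‖B.primitiveCLM hw (MZero.trunc w m (B.empDeviation f n x) + v)‖ ∂(samplingModel n f)
      - ∫ x, φ ‖B.primitiveCLM hw (MZero.trunc w N (B.empDeviation f n x))‖ ∂(samplingModel n f)|
      ≤ K * (B.primitiveConst * ∑ i ∈ Finset.Ico N m, softMaxBound J₀ D s i * levelRate J₀ i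
        + ‖B.primitiveCLM hw‖ * ‖v‖) := by
  have := hf.isProbabilityMeasure_samplingModel n
  obtain ⟨hint, hle⟩ := B.integral_norm_trunc_sub_trunc_le hw hf hD hNm hs0 hs
  have hi : ∀ (k : ℕ) (u : MZero w), Integrable (fun x =>
      φ ‖B.primitiveCLM hw (MZero.trunc w k (B.empDeviation f n x) + u)‖) (samplingModel n f) :=
    fun k u => by
      have hc : Continuous fun y : Idx J₀ → ℝ =>
          φ ‖B.primitiveCLM hw (MZero.trunc w k y + u)‖ :=
        hφc.comp ((B.primitiveCLM hw).continuous.comp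
          ((MZero.continuous_trunc k).add continuous_const)).norm
      exact Integrable.of_bound
        (hc.measurable.comp (B.measurable_empDeviation f n)).aestronglyMeasurable 1
        (Eventually.of_forall fun x => hφ _)
  have hi0 := hi N 0
  simp only [add_zero] at hi0
  rw [← integral_sub (hi m v) hi0]
  refine (abs_integral_le_integral_abs).trans ?_
  calc _ ≤ ∫ x, K * (‖B.primitiveCLM hw (MZero.trunc w m (B.empDeviation f n x)
            - MZero.trunc w N (B.empDeviation f n x))‖ + ‖B.primitiveCLM hw‖ * ‖v‖)
          ∂(samplingModel n f) := by
        refine integral_mono_of_nonneg (Eventually.of_forall fun x => abs_nonneg _)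
          ((hint.add (integrable_const _)).const_mul K) (Eventually.of_forall fun x => ?_)
        refine (hK _ _).trans (mul_le_mul_of_nonneg_left ?_ hK0)
        refine (abs_norm_sub_norm_le _ _).trans ?_
        rw [← map_sub, add_sub_right_comm, map_add]
        exact (norm_add_le _ _).trans (add_le_add le_rfl ((B.primitiveCLM hw).le_opNorm v))
    _ ≤ _ := by
        rw [integral_const_mul, integral_add hint (integrable_const _), integral_const,
          probReal_univ, one_smul]
        gcongr

/-- The projected empirical measure satisfies the central limit theorem, tested on bounded
Lipschitz functions of the uniform norm of the primitive. -/
theorem tendsto_integral_empiricalCentring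
    (hw : Summable fun i : ℕ => w.at i * levelRate J₀ i) (hf : IsDensity f) {D : ℝ}
    (hD : ∀ᵐ x ∂unitVol, f x ≤ D) {M : NNReal} (ha : ∀ p, ‖B.bridgeSeq hf p‖₊ ≤ M)
    {T : ∀ n : ℕ, (Fin n → ℝ) → L2} (hT : B.IsEmpiricalCentring w f T) {φ : ℝ → ℝ}
    (hφ : IsBoundedLipschitz φ) :
    Tendsto (fun n : ℕ => ∫ x, φ ‖B.primitiveCLM hw
        (√(n : ℝ) • (B.embed w (T n x) - B.embed w f))‖ ∂(samplingModel n f)) atTop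
      (𝓝 (∫ x, φ ‖B.primitiveCLM hw x‖ ∂(gaussLaw w (B.bridgeSeq hf)))) := by
  obtain ⟨γ, j, hγ, ⟨-, C, hC⟩, hj, hlim, hO, hTj⟩ := hT
  obtain ⟨hφ1, K, hK0, hK⟩ := id hφ
  have hφc := hφ.continuous
  set L := B.primitiveCLM hw with hL
  have hΦ : Continuous fun x : MZero w => φ ‖L x‖ := hφc.comp L.continuous.norm
  have hjt := tendsto_resolution_level w hγ hj hlim
  obtain ⟨c, hc0, hc⟩ := hO.exists_pos
  rw [Asymptotics.isBigOWith_iff] at hc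
  -- A fixed `s`, independent of `n`, meets the Bernstein condition on all levels up to `j n`: there
  -- the wavelets are at most `supConst * √(c n)`, and the factor `√n` cancels.
  set s : ℝ := (2 * B.supConst * √c + 1)⁻¹ with hs
  have hsup := B.supConst_nonneg
  have hs0 : 0 < s := by positivity
  have hsum : Summable fun i => softMaxBound J₀ D s i * levelRate J₀ i :=
    summable_log_levelCard J₀ s⁻¹ (2 * Real.exp (s ^ 2 * D))
  have htail : Tendsto (fun N => K * (B.primitiveConst *
      ∑' i, softMaxBound J₀ D s (i + N) * levelRate J₀ (i + N))) atTop (𝓝 0) := by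
    have := ((tendsto_sum_nat_add fun i => softMaxBound J₀ D s i * levelRate J₀ i).const_mul
      B.primitiveConst).const_mul K
    simpa using this
  have hbias : Tendsto (fun n : ℕ => K * (‖L‖ * (C * (√(n : ℝ) *
      (2 : ℝ) ^ (-(j n : ℝ) * (γ + 1 / 2)) / w.w (j n))))) atTop (𝓝 0) := by
    have := ((hlim.const_mul C).const_mul ‖L‖).const_mul K
    simpa using this
  have hG := tendsto_integral_trunc_gaussLaw ha hΦ fun x => hφ1 _
  rw [Metric.tendsto_nhds]
  intro ε hε
  -- Four errors: truncation of the Gaussian limit, levels between `N` and `j n`, finite-dimensional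
  -- convergence for this `N`, and bias.
  have hε4 : 0 < ε / 4 := by positivity
  obtain ⟨N, hN1, hN2⟩ := ((Metric.tendsto_nhds.1 hG _ hε4).and
    (htail.eventually (gt_mem_nhds hε4))).exists
  have hfidi := B.tendsto_integral_trunc_empDeviation hf ha hΦ (fun x => hφ1 _) N
  filter_upwards [Metric.tendsto_nhds.1 hfidi _ hε4, hbias.eventually (gt_mem_nhds hε4), hc,
    hjt.eventually_ge_atTop (N + J₀ + 1), eventually_gt_atTop 0] with n h1 h2 h3 h4 hn
  have hn' : (0 : ℝ) < n := by exact_mod_cast hn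
  have hsn : 0 < √(n : ℝ) := Real.sqrt_pos.2 hn'
  -- The factor `j n` in the `O`-bound is at least `1` by now, so it can be dropped.
  have hpow : (2 : ℝ) ^ j n ≤ c * n := by
    rw [Real.norm_of_nonneg (by positivity), Real.norm_of_nonneg hn'.le] at h3
    have h5 : (1 : ℝ) ≤ j n := by exact_mod_cast (by omega : 1 ≤ j n)
    exact (le_mul_of_one_le_right (by positivity) h5).trans h3
  have hsi : ∀ i < j n + 2 - J₀,
      s * (√(n : ℝ))⁻¹ * (2 * B.supConst * (2 : ℝ) ^ ((level J₀ i : ℝ) / 2)) ≤ 1 := fun i hi => by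
    have h5 := two_rpow_level_le_sqrt (l := level J₀ i) (by unfold level; omega) hpow
    rw [Real.sqrt_mul hc0.le] at h5
    calc _ ≤ s * (√(n : ℝ))⁻¹ * (2 * B.supConst * (√c * √(n : ℝ))) := by gcongr
      _ = s * (2 * B.supConst * √c) := by field_simp
      _ ≤ s * (2 * B.supConst * √c + 1) := by
          exact mul_le_mul_of_nonneg_left (by linarith) hs0.le
      _ = 1 := inv_mul_cancel₀ (by positivity)
  have hmain := B.abs_integral_empirical_sub_le hw hf hD (by omega : N ≤ j n + 2 - J₀) hs0 hsi
    hφ1 hK0 hK hφc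
    (√(n : ℝ) • (MZero.trunc w (j n + 2 - J₀) (B.basis.repr f) - B.embed w f))
  simp only [← B.sqrt_smul_empiricalProj_sub hf hn, ← hTj] at hmain
  have h6 : ∑ i ∈ Finset.Ico N (j n + 2 - J₀), softMaxBound J₀ D s i * levelRate J₀ i
      ≤ ∑' i, softMaxBound J₀ D s (i + N) * levelRate J₀ (i + N) := by
    rw [Finset.sum_Ico_eq_sum_range]
    simp only [add_comm N]
    exact ((summable_nat_add_iff N).2 hsum).sum_le_tsum _ fun i _ =>
      mul_nonneg (softMaxBound_nonneg D hs0 _) (levelRate_pos J₀ _).le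
  have h7 := mul_le_mul_of_nonneg_left (add_le_add
    (mul_le_mul_of_nonneg_left h6 B.primitiveConst_nonneg)
    (mul_le_mul_of_nonneg_left (B.norm_bias_le (w := w) hγ hC (hj n) n) (norm_nonneg L))) hK0
  have h8 := hmain.trans h7
  rw [mul_add] at h8
  rw [Real.dist_eq] at *
  rw [abs_lt] at *
  rw [abs_le] at h8
  constructor <;> linarith [h8.1, h8.2, h1.1, h1.2, hN1.1, hN1.2]

end WaveletBasis

end

/-! ### White noise and efficient centrings -/

section

section WhiteNoise

variable {J₀ : ℕ}

/-- The coordinate sequences representing white noise. -/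
noncomputable def unitSeq (p : Idx J₀) : SeqL2 J₀ :=
  lp.single 2 p (1 : ℝ)

theorem unitSeq_apply (p q : Idx J₀) :
    unitSeq p q = if p = q then 1 else 0 := by
  rw [unitSeq, lp.single_apply]
  by_cases h : p = q
  · subst h; simp
  · rw [if_neg h, Pi.single_eq_of_ne' h]

theorem nnnorm_unitSeq_le (p : Idx J₀) : ‖unitSeq p‖₊ ≤ 1 := by
  rw [← NNReal.coe_le_coe, coe_nnnorm, unitSeq, lp.norm_single two_pos]
  simp

theorem isonormal_unitSeq_ae_eq (p : Idx J₀) :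
    isonormal (unitSeq p : Idx J₀ → ℝ) =ᵐ[gaussSeq J₀] fun g => g p := by
  have h : isonormal (unitSeq p : Idx J₀ → ℝ) = evalLp p := by
    rw [← (hasSum_isonormal (unitSeq p)).tsum_eq, tsum_eq_single p fun q hq => by
      rw [unitSeq_apply, if_neg (Ne.symm hq), zero_smul], unitSeq_apply, if_pos rfl, one_smul]
  rw [h]
  exact evalLp_ae_eq p

theorem whiteNoiseLaw_eq (w : AdmissibleWeight J₀) :
    whiteNoiseLaw w = gaussLaw w (unitSeq (J₀ := J₀)) := by
  have h : (gaussSeq J₀).map (fun g p => isonormal (unitSeq p : Idx J₀ → ℝ) g) = gaussSeq J₀ := by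
    refine (Measure.map_congr (g := id) ?_).trans Measure.map_id
    filter_upwards [ae_all_iff.2 fun p : Idx J₀ => isonormal_unitSeq_ae_eq p] with g hg
    exact funext hg
  rw [gaussLaw, h, whiteNoiseLaw]

namespace WaveletBasis

variable (B : WaveletBasis J₀) {w : AdmissibleWeight J₀}

/-- The directions are the unit vectors, with primitives `∫₀ᵗ ψ_q`. If all of these vanished at `t =
1`, Parseval applied to the constant `1` would give `1 = 0`. -/
theorem exists_primitiveCLM_unit_ne_zero (hw : Summable fun i : ℕ => w.at i * levelRate J₀ i) :
    ∃ q, B.primitiveCLM hw (gaussDirection w nnnorm_unitSeq_le q) ≠ 0 := by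
  by_contra! hcon
  have h1 : (1 : ℝ) ∈ Icc (0 : ℝ) 1 := ⟨zero_le_one, le_rfl⟩
  have hψ : ∀ q, B.waveletPrimitive q 1 = 0 := fun q => by
    have h2 : B.primitiveMap (gaussDirection w nnnorm_unitSeq_le q) 1 = 0 := by
      have := congrArg (fun g : C(Icc (0 : ℝ) 1, ℝ) => g ⟨1, h1⟩) (hcon q)
      simpa using this
    rw [← h2, primitiveMap, tsum_eq_single q fun p hp => by
      rw [coord_gaussDirection, unitSeq_apply, if_neg hp, zero_mul],
      coord_gaussDirection, unitSeq_apply, if_pos rfl, one_mul]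
    rfl
  have h3 := B.hasSum_primitive (iocIndicator 1) h1
  simp only [hψ, mul_zero] at h3
  have h4 := hasSum_zero.unique h3
  rw [← inner_iocIndicator _ h1, iocIndicator, L2.inner_indicatorConstLp_indicatorConstLp] at h4
  rw [inter_self, measureReal_restrict_apply measurableSet_Ioc,
    inter_eq_left.2 Ioc_subset_Icc_self, Real.volume_real_Ioc] at h4
  norm_num at h4

theorem isProbabilityMeasure_whiteNoiseModel (n : ℕ) (f : L2) :
    IsProbabilityMeasure (B.whiteNoiseModel w n f) := by
  have := isProbabilityMeasure_gaussLaw (w := w) (nnnorm_unitSeq_le (J₀ := J₀))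
  rw [whiteNoiseModel, whiteNoiseLaw_eq]
  exact Measure.isProbabilityMeasure_map (by fun_prop)

/-- For `n > 0` the rescaled observation has exactly the limit law, so the sequence is eventually
constant. -/
theorem tendsto_integral_whiteNoise (hw : Summable fun i : ℕ => w.at i * levelRate J₀ i) (f : L2)
    {φ : ℝ → ℝ} (hφ : IsBoundedLipschitz φ) :
    Tendsto (fun n : ℕ => ∫ x, φ ‖B.primitiveCLM hw (√(n : ℝ) • (x - B.embed w f))‖
      ∂(B.whiteNoiseModel w n f)) atTop
      (𝓝 (∫ x, φ ‖B.primitiveCLM hw x‖ ∂(gaussLaw w (unitSeq (J₀ := J₀))))) := by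
  refine tendsto_const_nhds.congr' ?_
  filter_upwards [eventually_gt_atTop 0] with n hn
  have hs : √(n : ℝ) ≠ 0 := (Real.sqrt_pos.2 (by exact_mod_cast hn)).ne'
  have hc : Continuous fun x : MZero w =>
      φ ‖B.primitiveCLM hw (√(n : ℝ) • (x - B.embed w f))‖ :=
    hφ.continuous.comp ((B.primitiveCLM hw).continuous.comp
      ((continuous_id.sub continuous_const).fun_const_smul _)).norm
  have hm : Continuous fun z : MZero w => B.embed w f + (√(n : ℝ))⁻¹ • z :=
    continuous_const.add (continuous_id.fun_const_smul _)
  rw [whiteNoiseModel, whiteNoiseLaw_eq,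
    integral_map hm.measurable.aemeasurable hc.aestronglyMeasurable]
  simp only [add_sub_cancel_left, smul_smul, mul_inv_cancel₀ hs, one_smul]

theorem IsEfficient.tendsto_integral {B : WaveletBasis J₀} {D : ℕ → Type*}
    [∀ n, MeasurableSpace (D n)] {P : ∀ n, Measure (D n)} [∀ n, IsProbabilityMeasure (P n)]
    {f₀ : L2} {T : ∀ n, D n → MZero w} {G : Measure (MZero w)} [IsProbabilityMeasure G]
    (h : B.IsEfficient w P f₀ T G) (hT : ∀ n, Measurable (T n))
    (hw : Summable fun i : ℕ => w.at i * levelRate J₀ i) {φ : ℝ → ℝ} (hφ : IsBoundedLipschitz φ) :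
    Tendsto (fun n : ℕ => ∫ x, φ ‖B.primitiveCLM hw (√(n : ℝ) • (T n x - B.embed w f₀))‖ ∂(P n))
      atTop (𝓝 (∫ x, φ ‖B.primitiveCLM hw x‖ ∂G)) := by
  obtain ⟨C, -, hC⟩ := B.abs_integral_norm_primitiveCLM_sub_le hw hφ
  have hm : ∀ n : ℕ, Measurable fun x => √(n : ℝ) • (T n x - B.embed w f₀) := fun n =>
    ((continuous_id.sub continuous_const).fun_const_smul (√(n : ℝ)) :
      Continuous fun y : MZero w => √(n : ℝ) • (y - B.embed w f₀)).measurable.comp (hT n)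
  have hc : Continuous fun x : MZero w => φ ‖B.primitiveCLM hw x‖ :=
    hφ.continuous.comp (B.primitiveCLM hw).continuous.norm
  have hlim : Tendsto (fun n => C * blDist ((P n).map fun x => √(n : ℝ) • (T n x - B.embed w f₀)) G)
      atTop (𝓝 0) := by
    have := Tendsto.const_mul C h
    rwa [mul_zero] at this
  rw [tendsto_iff_dist_tendsto_zero]
  refine squeeze_zero (fun n => dist_nonneg) (fun n => ?_) hlim
  have := Measure.isProbabilityMeasure_map (μ := P n) (hm n).aemeasurable
  have h1 := hC ((P n).map fun x => √(n : ℝ) • (T n x - B.embed w f₀)) G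
  rwa [integral_map (hm n).aemeasurable hc.aestronglyMeasurable] at h1

theorem measurable_embed (w : AdmissibleWeight J₀) : Measurable (B.embed w) :=
  B.continuous_embed.measurable

end WaveletBasis

end WhiteNoise

end

/-! ### The corollary: the Gaussian argument applied to each model and centring -/

theorem mainTheorem9 {J₀ : ℕ} (B : WaveletBasis J₀) (w : AdmissibleWeight J₀)
    (hw : Summable fun i : ℕ => w.at i * (2 : ℝ) ^ (-(level J₀ i : ℝ) / 2))
    (prior : ℕ → Measure L2) (hprior : ∀ n, IsProbabilityMeasure (prior n))
    (f₀ : L2) (α : ℝ) (hα₀ : 0 < α) (hα₁ : α < 1) :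
    -- Gaussian white noise model
    (∀ (post : ℕ → Kernel (MZero w) L2), (∀ n, IsMarkovKernel (post n)) →
      (∀ n, IsPosterior (prior n) (B.whiteNoiseModel w n) (post n)) →
      -- centring at the observation
      ((B.WeakBvM w (fun n => B.whiteNoiseModel w n f₀) post (fun _ X => X)
          (whiteNoiseLaw w) →
        ∀ R : ℕ → MZero w → ℝ,
          IsCredibleBand (fun n => B.whiteNoiseModel w n f₀) post
            (fun _ X => B.primitiveMap X) R α →
          BandConclusion (fun n => B.whiteNoiseModel w n f₀) f₀
            (fun _ X => B.primitiveMap X) R α) ∧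
      -- centring at an efficient estimator with values in `L²`
      (∀ T : ℕ → MZero w → L2, (∀ n, Measurable (T n)) →
        B.IsEfficient w (fun n => B.whiteNoiseModel w n f₀) f₀ (fun n X => B.embed w (T n X))
          (whiteNoiseLaw w) →
        B.WeakBvM w (fun n => B.whiteNoiseModel w n f₀) post (fun n X => B.embed w (T n X))
          (whiteNoiseLaw w) →
        ∀ R : ℕ → MZero w → ℝ,
          IsCredibleBand (fun n => B.whiteNoiseModel w n f₀) post
            (fun n X => primitive (T n X)) R α →
          BandConclusion (fun n => B.whiteNoiseModel w n f₀) f₀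
            (fun n X => primitive (T n X)) R α))) ∧
    -- i.i.d. sampling model, with a bounded true density
    (IsDensity f₀ → (∃ D : ℝ, ∀ᵐ x ∂unitVol, f₀ x ≤ D) →
      (∀ n, ∀ᵐ f ∂(prior n), IsDensity f) →
      ∀ (post : ∀ n : ℕ, Kernel (Fin n → ℝ) L2), (∀ n, IsMarkovKernel (post n)) →
      (∀ n, IsPosterior (prior n) (samplingModel n) (post n)) →
      ∀ T : ∀ n : ℕ, (Fin n → ℝ) → L2, (∀ n, Measurable (T n)) →
        (B.IsEmpiricalCentring w f₀ T ∨
          B.IsEfficient w (fun n => samplingModel n f₀) f₀ (fun n X => B.embed w (T n X))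
            (B.whiteBridgeLaw w f₀)) →
        B.WeakBvM w (fun n => samplingModel n f₀) post (fun n X => B.embed w (T n X))
          (B.whiteBridgeLaw w f₀) →
        ∀ R : ∀ n : ℕ, (Fin n → ℝ) → ℝ,
          IsCredibleBand (fun n => samplingModel n f₀) post
            (fun n X => primitive (T n X)) R α →
          BandConclusion (fun n => samplingModel n f₀) f₀
            (fun n X => primitive (T n X)) R α) := by
  have hw' : Summable fun i : ℕ => w.at i * levelRate J₀ i := hw
  have hgauss := isProbabilityMeasure_gaussLaw (w := w) (nnnorm_unitSeq_le (J₀ := J₀))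
  have hmodel := fun n => B.isProbabilityMeasure_whiteNoiseModel (w := w) n f₀
  refine ⟨fun post hpost _ => ⟨fun hbvm R hR => ?_, fun T hT heff hbvm R hR => ?_⟩,
    fun hf ⟨D, hD⟩ _ post hpost _ T hT hcentre hbvm R hR => ?_⟩
  · rw [whiteNoiseLaw_eq] at hbvm
    exact B.bandConclusion_of_weakBvM hw' nnnorm_unitSeq_le
      (B.exists_primitiveCLM_unit_ne_zero hw') (fun n => measurable_id)
      (fun φ hφ => B.tendsto_integral_whiteNoise hw' f₀ hφ) hbvm hα₀ hα₁
      (fun n x t _ => rfl) hR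
  · rw [whiteNoiseLaw_eq] at hbvm heff
    have hTm : ∀ n, Measurable fun X => B.embed w (T n X) := fun n =>
      (B.measurable_embed w).comp (hT n)
    exact B.bandConclusion_of_weakBvM hw' nnnorm_unitSeq_le
      (B.exists_primitiveCLM_unit_ne_zero hw') hTm
      (fun φ hφ => heff.tendsto_integral hTm hw' hφ) hbvm hα₀ hα₁
      (fun n x t ht => (B.primitiveMap_embed w (T n x) ht).symm) hR
  · have hsampling := hf.isProbabilityMeasure_samplingModel
    have ha := B.nnnorm_bridgeSeq_le hf hD
    have hbridge := isProbabilityMeasure_gaussLaw (w := w) ha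
    rw [B.whiteBridgeLaw_eq w hf] at hbvm hcentre
    have hTm : ∀ n, Measurable fun X => B.embed w (T n X) := fun n =>
      (B.measurable_embed w).comp (hT n)
    refine B.bandConclusion_of_weakBvM hw' ha
      (B.exists_primitiveCLM_bridge_ne_zero hw' hf ha) hTm (fun φ hφ => ?_) hbvm hα₀ hα₁
      (fun n x t ht => (B.primitiveMap_embed w (T n x) ht).symm) hR
    rcases hcentre with hemp | heff
    · exact B.tendsto_integral_empiricalCentring hw' hf hD ha hemp hφ
    · exact heff.tendsto_integral hTm hw' hφ
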